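/- **Model.** Programs are randomized binary fork-join programs on a shared array whose items can only be swapped. A task executes unit-cost instructions (an array swap, $O(1)$ word operations, one round of a rejection sampler) and may fork into two subtasks, waiting until both have finished. The *work* is the total number of instructions, the *parallel depth* is the length of the critical path. A uniform variate from $\{0,\dots,s\}$ or a binomial variate is obtained by rejection sampling: independent unit-cost rounds, each accepted with a fixed probability (depending on the parameters of the distribution) that is at least a constant $p_0>0$; hence expected constant time. A forked subtask is *active* when it has started but not finished (a task waiting for its children is active). Auxiliary memory is measured in words at every moment of every schedule, with any number of workers. **Algorithm.** *Parallel In-Place ScatterShuffle* with $k\ge 2$ buckets and base case size $N_0$, on $m$ consecutive cells: - If $m\le N_0$, run the sequential Fisher–Yates shuffle. Otherwise split the cells into $k$ contiguous buckets of equal size up to rounding. The items of a bucket are first *placed*, then *staged* ones; initially all are staged. A bucket is full if it has no staged item. - *RoughScatter* (sequential): if no bucket is full, repeat: draw $j$ uniformly from $[k]$, swap the first staged item of bucket $1$ with the first staged item of bucket $j$, which thereby becomes placed; stop as soon as a bucket is full. - *ParRoughScatter*: if the total size is at most $N_0$, run RoughScatter. Otherwise split every bucket into two halves, process the $k$ first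 halves and the $k$ second halves recursively in two forked subtasks, merge the halves of each bucket (swapping staged items of the first half with placed items of the second half), and continue with RoughScatter. - *FineScatter*: let $r_i$ be the number of staged items of bucket $i$ and $R=\sum_i r_i$. Draw $(n_i')_i$ from the multinomial distribution with $R$ trials and $k$ equal weights by chaining binomial variates, and let $D_i=\sum_{j\le i}(n'_j-r_j)$. *Parallel TwoSweep*: with one worker per inner bucket boundary, run $k$ rounds; in each round the end of bucket $i$ moves towards its final position, which is at signed distance $D_i$ from the initial one, as far as the staged items permit that the shrinking neighbour holds at the start of the round, with one swap per item. Then compact the $R$ staged items at the front of the cells, shuffle them by Fisher–Yates, and undo the compaction. - Recurse on all $k$ buckets in parallel (binary forking). **Theorem.** For all constants $a\ge1$, $c>0$, $p_0>0$ there is a constant $C>0$ such that the following holds for all integers $k\ge2$, $n\ge2$ and $N_0$ with $k^3\log k\le c\,n$ and $k^2\le N_0\le a\,k^2$, for every input of $n$ items and all rejection samplers with acceptance probabilities at least $p_0$. With probability at least $1-1/n$, Parallel In-Place ScatterShuffle terminates and its execution satisfies all of the following: 1. the parallel depth is at most $C\sqrt{nk/\log k}\cdot\log n$; 2. the work is at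 most $C\,n\log_k n$; 3. at every moment of every schedule the words of auxiliary memory in use are at most $C\,k\,(\log_k n+\mathfrak P)$, where $\mathfrak P$ is the number of forked subtasks that are active at this moment (in particular this holds with $\mathfrak P$ the maximal number of simultaneously active subtasks of the schedule). -/

import Mathlib

open MeasureTheory ProbabilityTheory
open scoped ENNReal unitInterval

universe u

noncomputable section

namespace ForkJoin

/-! ## Executions of binary fork-join programs and their cost -/

/-- The series-parallel structure of one execution of a task: unit-cost instructions, sequential
composition, a binary fork followed by the matching join, and a part of the execution during which
`w` additional words of auxiliary memory are in use by the task. -/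
inductive Exec : Type
  | done : Exec
  | step : Exec
  | seq (a b : Exec) : Exec
  | fork (a b : Exec) : Exec
  | frame (w : ℕ) (a : Exec) : Exec

namespace Exec

/-- `n` unit-cost instructions. -/
def steps : ℕ → Exec
  | 0 => done
  | n + 1 => seq step (steps n)

/-- Total number of instructions; a fork-join costs one instruction itself. -/
def work : Exec → ℕ
  | done => 0
  | step => 1
  | seq a b => work a + work b
  | fork a b => 1 + (work a + work b)
  | frame _ a => work a

/-- Parallel depth: the length of the critical path. -/
def span : Exec → ℕ
  | done => 0
  | step => 1
  | seq a b => span a + span b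
  | fork a b => 1 + max (span a) (span b)
  | frame _ a => span a

/-- `Config E t m`: under some schedule of `E` (with any number of workers) there is a moment at
which exactly `t` forked subtasks are active (started, but not yet finished; a task that waits for
its children is active), and the task and its active subtasks together use `m` words of auxiliary
memory. The two branches of a fork are independent: each may be not started, running at any point
of its own execution, or finished. -/
inductive Config : Exec → ℕ → ℕ → Prop
  | done : Config done 0 0
  | step : Config step 0 0
  | seqLeft {a b : Exec} {t m : ℕ} : Config a t m → Config (seq a b) t m
  | seqRight {a b : Exec} {t m : ℕ} : Config b t m → Config (seq a b) t m
  | frame {w : ℕ} {a : Exec} {t m : ℕ} : Config a t m → Config (frame w a) t (w + m)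
  | forkNone {a b : Exec} : Config (fork a b) 0 0
  | forkLeft {a b : Exec} {t m : ℕ} : Config a t m → Config (fork a b) (t + 1) m
  | forkRight {a b : Exec} {t m : ℕ} : Config b t m → Config (fork a b) (t + 1) m
  | forkBoth {a b : Exec} {t m t' m' : ℕ} :
      Config a t m → Config b t' m' → Config (fork a b) (t + t' + 2) (m + m')

end Exec

/-! ## Randomized fork-join programs on a shared array -/

/-- A randomized program with result type `β` that works on a shared array with cells of type `α`:
it maps the content of the array to the joint law of the result, the new content, and the
execution. The outcome `none` means that the program did not finish (its recursion budget was
exhausted). -/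
def Comp (α : Type u) (β : Type) : Type u :=
  (ℕ → α) → PMF (Option (β × (ℕ → α) × Exec))

namespace Comp

variable {α : Type u} {β γ : Type}

/-- The program that returns `x` at no cost. -/
def ret (x : β) : Comp α β := fun X => PMF.pure (some (x, X, Exec.done))

/-- Sequential composition. -/
def andThen (c : Comp α β) (f : β → Comp α γ) : Comp α γ := fun X =>
  (c X).bind fun o => match o with
    | none => PMF.pure none
    | some (x, Y, e) => (f x Y).bind fun o' => match o' with
      | none => PMF.pure none
      | some (y, Z, e') => PMF.pure (some (y, Z, Exec.seq e e'))

instance : Monad (Comp α) where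
  pure := ret
  bind := andThen

/-- The program that never finishes. -/
def diverge : Comp α β := fun _ => PMF.pure none

/-- `n` unit-cost instructions that do not touch the array. -/
def tick (n : ℕ) : Comp α Unit := fun X => PMF.pure (some ((), X, Exec.steps n))

/-- Swap the content of two cells of the array: one instruction. -/
def swap (i j : ℕ) : Comp α Unit := fun X =>
  PMF.pure (some ((), X ∘ Equiv.swap i j, Exec.step))

/-- Fork into two subtasks and wait until both have finished. In all programs below the two
subtasks access disjoint sets of cells of the array, so the joint effect on the array does not
depend on the order of execution. -/
def fork (c : Comp α β) (d : Comp α γ) : Comp α (β × γ) := fun X =>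
  (c X).bind fun o => match o with
    | none => PMF.pure none
    | some (x, Y, e) => (d Y).bind fun o' => match o' with
      | none => PMF.pure none
      | some (y, Z, e') => PMF.pure (some ((x, y), Z, Exec.fork e e'))

/-- Run `c` while `w` additional words of auxiliary memory are in use. -/
def frame (w : ℕ) (c : Comp α β) : Comp α β := fun X =>
  (c X).map (Option.map fun r => (r.1, r.2.1, Exec.frame w r.2.2))

/-- Rejection sampling from `μ` where every round is accepted with probability `p`: the number of
rejected rounds is geometric and independent of the value that is finally returned. Each round
costs one instruction. -/
def rejection (p : I) (μ : PMF ℕ) : Comp α ℕ := fun X =>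
  (geometricMeasure p).toPMF.bind fun r =>
    μ.bind fun v => PMF.pure (some (v, X, Exec.steps (r + 1)))

/-- Sequential loop that runs `f 0`, …, `f (n - 1)`, with one instruction of overhead each. -/
def loop (n : ℕ) (f : ℕ → Comp α Unit) : Comp α Unit :=
  match n with
  | 0 => pure ()
  | n + 1 => do
    loop n f
    tick 1
    f n

/-- Parallel loop that runs `f lo`, …, `f (lo + len - 1)` through binary forks. Each forked subtask
stores the limits of its range. -/
def parLoop (lo len : ℕ) (f : ℕ → Comp α Unit) : Comp α Unit :=
  if len = 0 then tick 1
  else if len = 1 then do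
    tick 1
    f lo
  else do
    tick 1
    let _ ← fork (frame 4 (parLoop lo (len / 2) f))
      (frame 4 (parLoop (lo + len / 2) (len - len / 2) f))
  termination_by len
  decreasing_by all_goals omega

end Comp

end ForkJoin

namespace ScatterShuffle

open ForkJoin ForkJoin.Comp

/-! ## Random variates -/

/-- The acceptance probabilities of the rejection samplers for uniform variates from `{0, …, s}`
(indexed by `s`) and for binomial variates (indexed by number of trials and success
probability). -/
structure Samplers where
  uniformAcc : ℕ → I
  binomialAcc : ℕ → I → I

/-- The probability `1 / d`. -/
def invProb (d : ℕ) : I :=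
  ⟨(d : ℝ)⁻¹, inv_nonneg.2 (Nat.cast_nonneg d), Nat.cast_inv_le_one d⟩

variable {α : Type u}

/-- Sample uniformly from `{0, …, s}`. -/
def Samplers.uniform (S : Samplers) (s : ℕ) : Comp α ℕ :=
  rejection (S.uniformAcc s) (PMF.uniformOfFinset (Finset.range (s + 1)) ⟨0, by simp⟩)

/-- Sample from the binomial distribution with `m` trials and success probability `q`. -/
def Samplers.binomial (S : Samplers) (m : ℕ) (q : I) : Comp α ℕ :=
  rejection (S.binomialAcc m q) (ProbabilityTheory.binomial m q).toPMF

/-- `multinomial S k i R N` completes the list `N` of the first `i` coordinates of a variate from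
the multinomial distribution with `k` equally weighted classes, when `R` trials remain for the
classes `i, …, k - 1`, by chaining binomial variates. Recursion is on the number `d` of missing
coordinates. -/
def multinomial (S : Samplers) (k : ℕ) (d R : ℕ) (N : ℕ → ℕ) : Comp α (ℕ → ℕ) :=
  match d with
  | 0 => pure N
  | d + 1 => do
    let x ← S.binomial R (invProb (d + 1))
    tick 3
    multinomial S k d (R - x) (Function.update N (k - (d + 1)) x)

/-! ## Fisher-Yates shuffle -/

/-- Sequential Fisher-Yates shuffle of the `m` cells that start at `lo`: for `i = m - 1, …, 1`, cell
`i` is swapped with a random cell from `{0, …, i}`. -/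
def fisherYates (S : Samplers) (lo : ℕ) : ℕ → Comp α Unit
  | 0 => tick 1
  | 1 => tick 1
  | i + 2 => do
    let j ← S.uniform (i + 1)
    swap (lo + (i + 1)) (lo + j)
    tick 1
    fisherYates S lo (i + 1)

/-! ## Buckets -/

/-- A bucket consists of the cells `b, …, e - 1`, where `b, …, s - 1` hold the placed items and
`s, …, e - 1` the staged items. -/
structure Bucket where
  b : ℕ
  s : ℕ
  e : ℕ

/-- Number of cells of a bucket. -/
def Bucket.size (B : Bucket) : ℕ := B.e - B.b

/-- Number of staged items of a bucket. -/
def Bucket.staged (B : Bucket) : ℕ := B.e - B.s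

/-- Buckets are numbered from `0`; only the entries below the number `k` of buckets matter. -/
abbrev Buckets := ℕ → Bucket

/-- Total number of cells. -/
def Buckets.size (k : ℕ) (B : Buckets) : ℕ := ∑ i ∈ Finset.range k, (B i).size

/-- Total number of staged items. -/
def Buckets.staged (k : ℕ) (B : Buckets) : ℕ := ∑ i ∈ Finset.range k, (B i).staged

/-- Partition of the `m` cells that start at `lo` into `k` contiguous buckets of equal size (up to
rounding) with all items staged. -/
def initialBuckets (k lo m : ℕ) : Buckets := fun i =>
  ⟨lo + i * m / k, lo + i * m / k, lo + (i + 1) * m / k⟩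

/-! ## RoughScatter -/

/-- The main loop of `roughScatter`, for buckets none of which is full. The first staged item of
bucket `0` is moved to a random bucket. The loop stops as soon as a bucket is full. Every iteration
places one item, so the number of staged items at the start bounds the number of iterations. -/
def roughScatterLoop (S : Samplers) (k : ℕ) : ℕ → Buckets → Comp α Buckets
  | 0, B => pure B
  | t + 1, B => do
    let j ← S.uniform (k - 1)
    swap (B 0).s (B j).s
    tick 2
    let B' : Buckets := Function.update B j { B j with s := (B j).s + 1 }
    if (B' j).s = (B' j).e then pure B' else roughScatterLoop S k t B'

/-- Sequential RoughScatter; it does nothing if some bucket is already full. -/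
def roughScatter (S : Samplers) (k : ℕ) (B : Buckets) : Comp α Buckets := do
  tick (k + 1)
  if ∃ i ∈ Finset.range k, (B i).s = (B i).e then pure B
  else roughScatterLoop S k (Buckets.staged k B) B

/-- The first halves of buckets that contain only staged items. -/
def firstHalves (B : Buckets) : Buckets := fun i =>
  ⟨(B i).b, (B i).b, (B i).b + (B i).size / 2⟩

/-- The second halves of buckets that contain only staged items. -/
def secondHalves (B : Buckets) : Buckets := fun i =>
  ⟨(B i).b + (B i).size / 2, (B i).b + (B i).size / 2, (B i).e⟩

/-- Merge adjacent halves of each bucket: staged items of the first half are swapped with placed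
items of the second half, such that the placed items become contiguous. -/
def mergeHalves (k : ℕ) (L R : Buckets) : Comp α Buckets := do
  loop k fun i => do
    let q := min (L i).staged ((R i).s - (R i).b)
    tick 3
    loop q fun j => swap ((L i).s + j) ((R i).s - q + j)
  pure fun i => ⟨(L i).b, (L i).s + ((R i).s - (R i).b), (R i).e⟩

/-- ParRoughScatter with base case size `N₀`, on buckets that contain only staged items. The first
numeric argument bounds the number of nested splits. Since splitting makes the total size smaller
as long as some bucket has two cells, the total size is a sufficient bound. Each of the
two subtasks stores `k` bucket triples. -/
def parRoughScatterAux (S : Samplers) (k N₀ : ℕ) : ℕ → Buckets → Comp α Buckets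
  | 0, B => roughScatter S k B
  | h + 1, B => do
    tick (k + 1)
    if Buckets.size k B ≤ N₀ then roughScatter S k B
    else do
      tick (6 * k)
      let (L, R) ← fork
        (frame (3 * k + 8) (parRoughScatterAux S k N₀ h (firstHalves B)))
        (frame (3 * k + 8) (parRoughScatterAux S k N₀ h (secondHalves B)))
      let B' ← mergeHalves k L R
      roughScatter S k B'

/-- ParRoughScatter with base case size `N₀`. -/
def parRoughScatter (S : Samplers) (k N₀ : ℕ) (B : Buckets) : Comp α Buckets :=
  parRoughScatterAux S k N₀ (Buckets.size k B) B

/-! ## FineScatter -/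

/-- `boundaryShift B N i` is the signed distance by which the end of bucket `i` has to be moved to
the right such that every bucket `j` ends up with `N j` staged items: the prefix sum of the
deviations of the final bucket sizes from the current ones. -/
def boundaryShift (B : Buckets) (N : ℕ → ℕ) (i : ℕ) : ℤ :=
  ∑ j ∈ Finset.range (i + 1), ((N j : ℤ) - ((B j).staged : ℤ))

/-- The signed distance by which the boundary between the buckets `i` and `i + 1` moves in one
round, if `D i` is the outstanding distance: as far as the staged items permit which the
shrinking bucket has at the start of the round. -/
def roundShift (B : Buckets) (D : ℕ → ℤ) (i : ℕ) : ℤ :=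
  if 0 ≤ D i then min (D i) ((B (i + 1)).staged : ℤ) else max (D i) (-((B i).staged : ℤ))

/-- Move the boundary between the buckets `i` and `i + 1` by `t`, one item at a time: one swap makes
the boundary item of the shrinking bucket a staged one and adjusts the pointers. -/
def moveBoundary (B : Buckets) (i : ℕ) (t : ℤ) : Comp α Unit :=
  if 0 ≤ t then
    loop t.toNat fun j => do
      swap ((B i).e + j) ((B (i + 1)).s + j)
      tick 3
  else
    loop (-t).toNat fun j => do
      swap ((B i).e - 1 - j) ((B (i + 1)).s - 1 - j)
      tick 3

/-- The buckets `0, …, k - 1` after all inner boundaries `i` have moved by `δ i`. -/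
def shiftBuckets (k : ℕ) (B : Buckets) (δ : ℕ → ℤ) : Buckets := fun i =>
  let l : ℤ := if i = 0 then 0 else δ (i - 1)
  let r : ℤ := if i + 1 < k then δ i else 0
  ⟨((B i).b + l).toNat, ((B i).s + l).toNat, ((B i).e + r).toNat⟩

/-- The rounds of the parallel TwoSweep, with one worker per inner bucket boundary. A round first
computes all shifts from the current bucket pointers and then moves all boundaries. -/
def sweepRounds (k : ℕ) : ℕ → Buckets → (ℕ → ℤ) → Comp α Buckets
  | 0, B, _ => pure B
  | r + 1, B, D => do
    let δ := roundShift B D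
    parLoop 0 (k - 1) fun _ => tick 3
    parLoop 0 (k - 1) fun i => moveBoundary B i (δ i)
    sweepRounds k r (shiftBuckets k B δ) (fun i => D i - δ i)

/-- Parallel TwoSweep: `k` rounds, after which bucket `i` has `N i` staged items. -/
def parTwoSweep (k : ℕ) (B : Buckets) (N : ℕ → ℕ) : Comp α Buckets := do
  tick (3 * k)
  sweepRounds k k B (boundaryShift B N)

/-- Number of staged items in the first `i` buckets. -/
def stagedBefore (B : Buckets) (i : ℕ) : ℕ := ∑ j ∈ Finset.range i, (B j).staged

/-- Compact all staged items into the cells that start at `lo`. -/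
def compactStaged (k lo : ℕ) (B : Buckets) : Comp α Unit :=
  loop k fun i => do
    tick 2
    loop (B i).staged fun j => swap (lo + stagedBefore B i + j) ((B i).s + j)

/-- The swaps of `compactStaged` in reverse order. -/
def restoreStaged (k lo : ℕ) (B : Buckets) : Comp α Unit :=
  loop k fun i' => do
    let i := k - 1 - i'
    tick 2
    loop (B i).staged fun j' => do
      let j := (B i).staged - 1 - j'
      swap (lo + stagedBefore B i + j) ((B i).s + j)

/-- Assign the staged items to the buckets by a random permutation of the staged items. -/
def shuffleStaged (S : Samplers) (k lo : ℕ) (B : Buckets) : Comp α Unit := do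
  compactStaged k lo B
  fisherYates S lo (Buckets.staged k B)
  restoreStaged k lo B

/-- FineScatter: draw the final bucket sizes, adjust the bucket boundaries, and assign the staged
items. -/
def parFineScatter (S : Samplers) (k lo : ℕ) (B : Buckets) : Comp α Buckets := do
  tick (k + 1)
  let N ← multinomial S k k (Buckets.staged k B) (fun _ => 0)
  let B' ← parTwoSweep k B N
  shuffleStaged S k lo B'
  pure B'

/-! ## Parallel In-Place ScatterShuffle -/

/-- Parallel In-Place ScatterShuffle with `k` buckets and base case size `N₀` of the `m` cells that
start at `lo`, where the nesting depth of the recursion is limited to less than the first numeric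
argument. A call that does not fall into the base case uses `k` bucket triples, and arrays of
`k` words each for the multinomial variate, its prefix sums and the shifts of a round. -/
def pIpScShuf (S : Samplers) (k N₀ : ℕ) : ℕ → ℕ → ℕ → Comp α Unit
  | 0, _, _ => diverge
  | f + 1, lo, m => do
    tick 1
    if m ≤ N₀ then frame 8 (fisherYates S lo m)
    else frame (6 * k + 16) do
      tick (3 * k)
      let B ← parRoughScatter S k N₀ (initialBuckets k lo m)
      let B' ← parFineScatter S k lo B
      parLoop 0 k fun i => pIpScShuf S k N₀ f (B' i).b (B' i).size

/-- The probability that Parallel In-Place ScatterShuffle, run on the first `n` cells of the array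
`X`, finishes with an execution that satisfies `P`. The run with a larger recursion limit extends
the one with a smaller limit, so the supremum is the limit for unbounded recursion. -/
def shuffleProb (S : Samplers) (k N₀ n : ℕ) (X : ℕ → α) (P : Exec → Prop) : ℝ≥0∞ :=
  ⨆ f : ℕ, ((pIpScShuf S k N₀ f 0 n : Comp α Unit) X).toOuterMeasure
    {o | ∃ Y E, o = some ((), Y, E) ∧ P E}

end ScatterShuffle

end

/-!
Every cost is controlled through an exponential moment. For a program `c`, `cwp κ l c G` is the
mean of `exp (l * cost) * G result`, maximized over the initial arrays. It is a number in `ℝ≥0∞`,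
so that no integrability has to be checked; runs that do not finish count as zero and are treated
separately through `pnone`. Sequential composition becomes nesting, a fork costs a product for the
work and, since the exponential of a maximum is at most the sum of the exponentials, a sum for the
parallel depth. A rejection sampler has a geometric number of rounds, whose exponential moment at a
rate `l ≤ p₀ / 2` is at most `exp (2 * l / p₀)` (`mean_geometric_le`).

*Staged items.* Give bucket `i` a weight `y i` such that the average of the weights is at most `1`.
Placing an item in a uniform bucket multiplies `placedWeight`, the product of the `y i` to the
numbers of placed items, by a factor of mean at most `1`. Neither RoughScatter, in any of its
recursive forms, nor the multinomial variate increases its mean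
(`cwp_parRoughScatterAux_placedWeight_le`, `cwp_multinomial_le`). When RoughScatter stops, some
bucket `j` is full, so that its number of placed items exceeds the average by the average number of
staged items. For the weights `tilt`, which favour one bucket, this gives the tail of the number of
staged items (`cwp_staged_le`), which is of the order `√(m * k * log k)` for `m` items. Weights that
favour an initial segment of the buckets give the tail of the distances by which the bucket ends
move (`drawMean_boundaryShift_le`), and weights that favour one bucket give the second moments of
the final bucket sizes (`drawMean_sum_sq_le`).

*One call.* The parts of a call are dependent, but the exponential is convex: if each part has a
bounded exponential moment at four times the rate, then so does the sum at the rate itself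
(`Sublinear.eexp_convex`). Parallel RoughScatter halves the sizes from one level of its recursion to
the next, so that the number of staged items decreases geometrically; the estimates of its depth and
work (`cwp_span_parRoughScatterAux_le`, `cwp_work_parRoughScatterAux_le`) are inductions in which
the rate grows by a constant factor in the subtasks. In TwoSweep a bucket end that still has to move
to the right after `s` rounds has at least `s + 1` buckets to its right, and one that has to move to
the left has at least `s` buckets to its left. This invariant, `SweepInv`, is preserved because an
end is stopped short of its target only if its neighbour has no more staged items to give, in which
case the next end has to move as well. Hence `k` rounds suffice (`post_parTwoSweep`).

*The recursion.* The depth of the `k` recursive calls is bounded by a sum over the calls, that is,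
at the price of a factor `k`. At the rate `√(log k / (n * k))`, up to a constant factor, a level of
the recursion then contributes a multiple of `log k` to the exponent (`cwp_span_pIpScShuf_le`). The
work adds up to a multiple of `n` per level (`cwp_work_pIpScShuf_le`). The sum of the squares of the
sizes shrinks in the mean by a factor `1.86 / k < 1` per level, so that the recursion ends after
`O(log n / log k)` levels except with probability `n⁻³` (`pnone_pIpScShuf_le`). Markov's inequality
bounds the probabilities of a large depth and of a large work by `n⁻³` each, and `3 * n⁻³ ≤ n⁻¹`.
The memory bound is deterministic: every active subtask holds `O(k)` words (`memLe_pIpScShuf`).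
-/

noncomputable section

/-! ### Exponential weights and means -/

/-- The exponential function with values in `ℝ≥0∞`. -/
def eexp (x : ℝ) : ℝ≥0∞ := ENNReal.ofReal (Real.exp x)

lemma eexp_zero : eexp 0 = 1 := by simp [eexp]

lemma eexp_add (x y : ℝ) : eexp (x + y) = eexp x * eexp y := by
  rw [eexp, Real.exp_add, ENNReal.ofReal_mul (Real.exp_pos x).le, eexp, eexp]

lemma eexp_mono {x y : ℝ} (h : x ≤ y) : eexp x ≤ eexp y :=
  ENNReal.ofReal_le_ofReal (Real.exp_le_exp.2 h)

lemma one_le_eexp {x : ℝ} (h : 0 ≤ x) : 1 ≤ eexp x := eexp_zero ▸ eexp_mono h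

lemma eexp_neg_mul (x : ℝ) : eexp (-x) * eexp x = 1 := by
  rw [← eexp_add, neg_add_cancel, eexp_zero]

lemma eexp_sum {ι : Type*} (s : Finset ι) (f : ι → ℝ) :
    eexp (∑ i ∈ s, f i) = ∏ i ∈ s, eexp (f i) := by
  classical
  induction s using Finset.induction_on with
  | empty => simp [eexp_zero]
  | insert a s ha ih => rw [Finset.sum_insert ha, Finset.prod_insert ha, eexp_add, ih]

lemma eexp_nat_mul (n : ℕ) (x : ℝ) : eexp (n * x) = eexp x ^ n := by
  rw [eexp, Real.exp_nat_mul, ENNReal.ofReal_pow (Real.exp_pos x).le, eexp]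

/-- Convexity of the exponential function. -/
lemma eexp_convex {ι : Type*} (s : Finset ι) (w x : ι → ℝ) (hw : ∀ i ∈ s, 0 ≤ w i)
    (h1 : ∑ i ∈ s, w i = 1) :
    eexp (∑ i ∈ s, w i * x i) ≤ ∑ i ∈ s, ENNReal.ofReal (w i) * eexp (x i) := by
  have h := convexOn_exp.map_sum_le hw h1 (p := x) (fun _ _ => Set.mem_univ _)
  simp only [smul_eq_mul] at h
  calc eexp (∑ i ∈ s, w i * x i) ≤ ENNReal.ofReal (∑ i ∈ s, w i * Real.exp (x i)) :=
        ENNReal.ofReal_le_ofReal h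
    _ = ∑ i ∈ s, ENNReal.ofReal (w i) * eexp (x i) := by
        rw [ENNReal.ofReal_sum_of_nonneg fun i hi => mul_nonneg (hw i hi) (Real.exp_pos _).le]
        exact Finset.sum_congr rfl fun i hi => by rw [ENNReal.ofReal_mul (hw i hi), eexp]

/-- The mean of a weight under a probability mass function. -/
def mean {γ : Type*} (p : PMF γ) (h : γ → ℝ≥0∞) : ℝ≥0∞ := ∑' a, p a * h a

section mean

variable {γ δ : Type*} (p : PMF γ)

lemma mean_mono {h h' : γ → ℝ≥0∞} (H : ∀ a, p a ≠ 0 → h a ≤ h' a) : mean p h ≤ mean p h' := by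
  refine ENNReal.tsum_le_tsum fun a => ?_
  by_cases ha : p a = 0
  · simp [ha]
  · gcongr
    exact H a ha

lemma mean_add (h h' : γ → ℝ≥0∞) : mean p (fun a => h a + h' a) = mean p h + mean p h' := by
  simp [mean, mul_add, ENNReal.tsum_add]

lemma mean_const_mul (b : ℝ≥0∞) (h : γ → ℝ≥0∞) : mean p (fun a => b * h a) = b * mean p h := by
  simp only [mean, mul_left_comm _ b, ENNReal.tsum_mul_left]

lemma mean_const (b : ℝ≥0∞) : mean p (fun _ => b) = b := by
  simp [mean, ENNReal.tsum_mul_right, p.tsum_coe]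

lemma mean_pure (a : γ) (h : γ → ℝ≥0∞) : mean (PMF.pure a) h = h a := by
  classical
  rw [mean, tsum_eq_single a]
  · simp
  · intro b hb
    simp [PMF.pure_apply, hb]

lemma mean_bind (f : γ → PMF δ) (h : δ → ℝ≥0∞) :
    mean (p.bind f) h = mean p fun a => mean (f a) h := by
  simp only [mean, PMF.bind_apply, ← ENNReal.tsum_mul_right, ← ENNReal.tsum_mul_left]
  rw [ENNReal.tsum_comm]
  simp only [mul_assoc]

lemma mean_map (f : γ → δ) (h : δ → ℝ≥0∞) : mean (p.map f) h = mean p fun a => h (f a) := by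
  rw [PMF.map, mean_bind]
  simp [mean_pure]

end mean

namespace ForkJoin

namespace Comp

variable {α : Type u} {β γ : Type}

/-! ### Weights of randomized programs -/

/-- The weight `g` of an outcome; unfinished runs have weight zero. -/
def weight (g : β → Exec → ℝ≥0∞) : Option (β × (ℕ → α) × Exec) → ℝ≥0∞
  | none => 0
  | some (x, _, e) => g x e

/-- The mean weight of the outcome of a program, for the worst initial content of the array. -/
def wp (c : Comp α β) (g : β → Exec → ℝ≥0∞) : ℝ≥0∞ := ⨆ X, mean (c X) (weight g)

/-- The probability that a program does not finish, for the worst initial content of the array. -/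
def pnone (c : Comp α β) : ℝ≥0∞ := ⨆ X, c X none

/-- All possible outcomes of finished runs of a program satisfy `Q`. -/
def Post (c : Comp α β) (Q : β → Exec → Prop) : Prop :=
  ∀ X x Y e, c X (some (x, Y, e)) ≠ 0 → Q x e

lemma mean_le_wp (c : Comp α β) (g : β → Exec → ℝ≥0∞) (X : ℕ → α) :
    mean (c X) (weight g) ≤ wp c g := le_iSup (fun X => mean (c X) (weight g)) X

lemma wp_mono_of_post {c : Comp α β} {g g' : β → Exec → ℝ≥0∞}
    (h : Post c fun x e => g x e ≤ g' x e) : wp c g ≤ wp c g' := by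
  refine iSup_mono fun X => mean_mono _ fun o ho => ?_
  match o, ho with
  | none, _ => exact le_rfl
  | some (x, Y, e), ho => exact h X x Y e ho

lemma Post.of_forall {c : Comp α β} {Q : β → Exec → Prop} (h : ∀ x e, Q x e) : Post c Q :=
  fun _ x _ e _ => h x e

lemma Post.mono {c : Comp α β} {Q Q' : β → Exec → Prop} (h : Post c Q)
    (h' : ∀ x e, Q x e → Q' x e) : Post c Q' := fun X x Y e ho => h' x e (h X x Y e ho)

lemma Post.and {c : Comp α β} {Q Q' : β → Exec → Prop} (h : Post c Q) (h' : Post c Q') :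
    Post c fun x e => Q x e ∧ Q' x e := fun X x Y e ho => ⟨h X x Y e ho, h' X x Y e ho⟩

lemma wp_mono {c : Comp α β} {g g' : β → Exec → ℝ≥0∞} (h : ∀ x e, g x e ≤ g' x e) :
    wp c g ≤ wp c g' := wp_mono_of_post (Post.of_forall h)

lemma wp_add_le (c : Comp α β) (g g' : β → Exec → ℝ≥0∞) :
    wp c (fun x e => g x e + g' x e) ≤ wp c g + wp c g' := by
  refine iSup_le fun X => ?_
  have : (weight fun x e => g x e + g' x e : Option (β × (ℕ → α) × Exec) → ℝ≥0∞) =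
      fun o => weight g o + weight g' o := by
    funext o; match o with
    | none => simp [weight]
    | some (x, Y, e) => rfl
  rw [this, mean_add]
  exact add_le_add (mean_le_wp _ _ _) (mean_le_wp _ _ _)

lemma wp_zero (c : Comp α β) : wp c (fun _ _ => 0) = 0 := by
  refine le_antisymm (iSup_le fun X => ?_) zero_le
  refine (mean_mono _ (h' := fun _ => 0) fun o _ => ?_).trans (mean_const _ 0).le
  match o with
  | none => exact le_rfl
  | some (x, Y, e) => exact le_rfl

lemma wp_sum_le {ι : Type*} (c : Comp α β) (s : Finset ι) (g : ι → β → Exec → ℝ≥0∞) :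
    wp c (fun x e => ∑ i ∈ s, g i x e) ≤ ∑ i ∈ s, wp c (g i) := by
  classical
  induction s using Finset.induction_on with
  | empty => simp [wp_zero]
  | insert a s ha ih =>
    simp only [Finset.sum_insert ha]
    exact (wp_add_le _ _ _).trans (by gcongr)

lemma wp_const_mul (c : Comp α β) (b : ℝ≥0∞) (g : β → Exec → ℝ≥0∞) :
    wp c (fun x e => b * g x e) = b * wp c g := by
  have : (weight fun x e => b * g x e : Option (β × (ℕ → α) × Exec) → ℝ≥0∞) =
      fun o => b * weight g o := by
    funext o; match o with
    | none => simp [weight]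
    | some (x, Y, e) => rfl
  simp only [wp, this, mean_const_mul, ENNReal.mul_iSup]

lemma wp_const_le (c : Comp α β) (b : ℝ≥0∞) : wp c (fun _ _ => b) ≤ b := by
  refine iSup_le fun X => ?_
  refine (mean_mono _ (h' := fun _ => b) fun o _ => ?_).trans (mean_const _ b).le
  match o with
  | none => exact zero_le
  | some (x, Y, e) => exact le_rfl

lemma wp_le_of_post {c : Comp α β} {g : β → Exec → ℝ≥0∞} {b : ℝ≥0∞}
    (h : Post c fun x e => g x e ≤ b) : wp c g ≤ b :=
  (wp_mono_of_post h).trans (wp_const_le c b)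

lemma wp_pure_le (x : β) (g : β → Exec → ℝ≥0∞) : wp (pure x : Comp α β) g ≤ g x .done :=
  iSup_le fun X => (mean_pure (some (x, X, Exec.done)) (weight g)).le

lemma wp_tick_le (n : ℕ) (g : Unit → Exec → ℝ≥0∞) :
    wp (tick n : Comp α Unit) g ≤ g () (.steps n) :=
  iSup_le fun X => (mean_pure (some ((), X, Exec.steps n)) (weight g)).le

lemma wp_swap_le (i j : ℕ) (g : Unit → Exec → ℝ≥0∞) :
    wp (swap i j : Comp α Unit) g ≤ g () .step :=
  iSup_le fun X => (mean_pure (some ((), X ∘ Equiv.swap i j, Exec.step)) (weight g)).le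

lemma wp_bind_le (c : Comp α β) (f : β → Comp α γ) (g : γ → Exec → ℝ≥0∞) :
    wp (c >>= f) g ≤ wp c fun x e => wp (f x) fun y e' => g y (.seq e e') := by
  refine iSup_le fun X => le_trans ?_ (mean_le_wp _ _ X)
  refine (mean_bind (c X) _ _).trans_le (mean_mono _ fun o _ => ?_)
  match o with
  | none => exact (mean_pure _ _).le
  | some (x, Y, e) =>
    refine (mean_bind _ _ _).trans_le (le_trans ?_ (mean_le_wp _ _ Y))
    refine mean_mono _ fun o' _ => ?_
    match o' with
    | none => exact (mean_pure _ _).le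
    | some (y, Z, e') => exact (mean_pure _ _).le

lemma wp_fork_le (c : Comp α β) (d : Comp α γ) (g : β × γ → Exec → ℝ≥0∞) :
    wp (fork c d) g ≤ wp c fun x e => wp d fun y e' => g (x, y) (.fork e e') := by
  refine iSup_le fun X => le_trans ?_ (mean_le_wp _ _ X)
  refine (mean_bind (c X) _ _).trans_le (mean_mono _ fun o _ => ?_)
  match o with
  | none => exact (mean_pure _ _).le
  | some (x, Y, e) =>
    refine (mean_bind _ _ _).trans_le (le_trans ?_ (mean_le_wp _ _ Y))
    refine mean_mono _ fun o' _ => ?_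
    match o' with
    | none => exact (mean_pure _ _).le
    | some (y, Z, e') => exact (mean_pure _ _).le

lemma wp_frame_le (w : ℕ) (c : Comp α β) (g : β → Exec → ℝ≥0∞) :
    wp (frame w c) g ≤ wp c fun x e => g x (.frame w e) := by
  refine iSup_le fun X => le_trans ?_ (mean_le_wp _ _ X)
  refine (mean_map (c X) _ _).trans_le (mean_mono _ fun o _ => ?_)
  match o with
  | none => exact le_rfl
  | some (x, Y, e) => exact le_rfl

lemma wp_rejection_le (p : I) (μ : PMF ℕ) (g : ℕ → Exec → ℝ≥0∞) :
    wp (rejection p μ : Comp α ℕ) g ≤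
      mean (geometricMeasure p).toPMF fun r => mean μ fun v => g v (.steps (r + 1)) := by
  refine iSup_le fun X => ?_
  refine (mean_bind _ _ _).trans_le (mean_mono _ fun r _ => ?_)
  refine (mean_bind _ _ _).trans_le (mean_mono _ fun v _ => ?_)
  exact (mean_pure _ _).le

/-! ### Certain properties of the outcome -/

lemma post_pure {x : β} {Q : β → Exec → Prop} (h : Q x .done) : Post (pure x : Comp α β) Q := by
  intro X x' Y e ho
  have : some (x', Y, e) = some (x, X, Exec.done) := by
    by_contra hne
    exact ho (PMF.pure_apply_of_ne _ _ hne)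
  simp only [Option.some.injEq, Prod.mk.injEq] at this
  obtain ⟨rfl, -, rfl⟩ := this
  exact h

lemma post_tick {n : ℕ} {Q : Unit → Exec → Prop} (h : Q () (.steps n)) :
    Post (tick n : Comp α Unit) Q := by
  intro X x' Y e ho
  have : some (x', Y, e) = some ((), X, Exec.steps n) := by
    by_contra hne
    exact ho (PMF.pure_apply_of_ne _ _ hne)
  simp only [Option.some.injEq, Prod.mk.injEq] at this
  obtain ⟨-, -, rfl⟩ := this
  exact h

lemma post_swap {i j : ℕ} {Q : Unit → Exec → Prop} (h : Q () .step) :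
    Post (swap i j : Comp α Unit) Q := by
  intro X x' Y e ho
  have : some (x', Y, e) = some ((), X ∘ Equiv.swap i j, Exec.step) := by
    by_contra hne
    exact ho (PMF.pure_apply_of_ne _ _ hne)
  simp only [Option.some.injEq, Prod.mk.injEq] at this
  obtain ⟨-, -, rfl⟩ := this
  exact h

lemma post_diverge {Q : β → Exec → Prop} : Post (diverge : Comp α β) Q := by
  intro X x' Y e ho
  exact absurd (PMF.pure_apply_of_ne _ _ (by simp)) ho

lemma Post.bind {c : Comp α β} {f : β → Comp α γ} {P : β → Exec → Prop} {Q : γ → Exec → Prop}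
    (hc : Post c P) (hf : ∀ x e, P x e → Post (f x) fun y e' => Q y (.seq e e')) :
    Post (c >>= f) Q := by
  intro X y Z e'' ho
  obtain ⟨o, ho1, ho2⟩ := (PMF.mem_support_bind_iff _ _ _).1 ((PMF.mem_support_iff _ _).2 ho)
  match o, ho1, ho2 with
  | none, _, ho2 => simp at ho2
  | some (x, Y, e), ho1, ho2 =>
    obtain ⟨o', ho3, ho4⟩ := (PMF.mem_support_bind_iff _ _ _).1 ho2
    match o', ho3, ho4 with
    | none, _, ho4 => simp at ho4
    | some (y', Z', e'), ho3, ho4 =>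
      simp only [PMF.support_pure, Set.mem_singleton_iff, Option.some.injEq, Prod.mk.injEq] at ho4
      obtain ⟨rfl, rfl, rfl⟩ := ho4
      exact hf x e (hc X x Y e ho1) Y _ _ _ ho3

lemma Post.fork {c : Comp α β} {d : Comp α γ} {P : β → Exec → Prop} {P' : γ → Exec → Prop}
    {Q : β × γ → Exec → Prop} (hc : Post c P) (hd : Post d P')
    (h : ∀ x e y e', P x e → P' y e' → Q (x, y) (.fork e e')) : Post (fork c d) Q := by
  intro X y Z e'' ho
  obtain ⟨o, ho1, ho2⟩ := (PMF.mem_support_bind_iff _ _ _).1 ((PMF.mem_support_iff _ _).2 ho)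
  match o, ho1, ho2 with
  | none, _, ho2 => simp at ho2
  | some (x, Y, e), ho1, ho2 =>
    obtain ⟨o', ho3, ho4⟩ := (PMF.mem_support_bind_iff _ _ _).1 ho2
    match o', ho3, ho4 with
    | none, _, ho4 => simp at ho4
    | some (y', Z', e'), ho3, ho4 =>
      simp only [PMF.support_pure, Set.mem_singleton_iff, Option.some.injEq, Prod.mk.injEq] at ho4
      obtain ⟨rfl, rfl, rfl⟩ := ho4
      exact h _ _ _ _ (hc X x Y e ho1) (hd Y _ _ _ ho3)

lemma Post.frame {w : ℕ} {c : Comp α β} {Q : β → Exec → Prop}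
    (h : Post c fun x e => Q x (.frame w e)) : Post (frame w c) Q := by
  intro X x Y e ho
  obtain ⟨o, ho1, ho2⟩ := (PMF.mem_support_map_iff _ _ _).1 ((PMF.mem_support_iff _ _).2 ho)
  match o, ho1, ho2 with
  | none, _, ho2 => simp at ho2
  | some (x', Y', e'), ho1, ho2 =>
    simp only [Option.map_some, Option.some.injEq, Prod.mk.injEq] at ho2
    obtain ⟨rfl, rfl, rfl⟩ := ho2
    exact h X _ _ _ ho1

lemma post_rejection {p : I} {μ : PMF ℕ} {Q : ℕ → Exec → Prop}
    (h : ∀ r v, μ v ≠ 0 → Q v (.steps (r + 1))) : Post (rejection p μ : Comp α ℕ) Q := by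
  intro X x Y e ho
  obtain ⟨r, -, ho2⟩ := (PMF.mem_support_bind_iff _ _ _).1 ((PMF.mem_support_iff _ _).2 ho)
  obtain ⟨v, hv, ho3⟩ := (PMF.mem_support_bind_iff _ _ _).1 ho2
  simp only [PMF.support_pure, Set.mem_singleton_iff, Option.some.injEq, Prod.mk.injEq] at ho3
  obtain ⟨rfl, rfl, rfl⟩ := ho3
  exact h r _ hv

/-! ### The probability of not finishing -/

lemma le_pnone (c : Comp α β) (X : ℕ → α) : c X none ≤ pnone c := le_iSup (fun X => c X none) X

lemma apply_none_eq_mean (c : Comp α β) (X : ℕ → α) :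
    c X none = mean (c X) (fun o => if o = none then 1 else 0) := by
  rw [mean, tsum_eq_single none]
  · simp
  · intro o ho
    simp [ho]

lemma pnone_pure (x : β) : pnone (pure x : Comp α β) = 0 := by
  refine le_antisymm (iSup_le fun X => ?_) zero_le
  exact (PMF.pure_apply_of_ne _ _ (by simp)).le

lemma pnone_tick (n : ℕ) : pnone (tick n : Comp α Unit) = 0 := by
  refine le_antisymm (iSup_le fun X => ?_) zero_le
  exact (PMF.pure_apply_of_ne _ _ (by simp)).le

lemma pnone_swap (i j : ℕ) : pnone (swap i j : Comp α Unit) = 0 := by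
  refine le_antisymm (iSup_le fun X => ?_) zero_le
  exact (PMF.pure_apply_of_ne _ _ (by simp)).le

lemma pnone_rejection (p : I) (μ : PMF ℕ) : pnone (rejection p μ : Comp α ℕ) = 0 := by
  refine le_antisymm (iSup_le fun X => ?_) zero_le
  by_contra hne
  obtain ⟨r, -, ho2⟩ := (PMF.mem_support_bind_iff _ _ _).1
    ((PMF.mem_support_iff _ _).2 fun h => hne h.le)
  obtain ⟨v, hv, ho3⟩ := (PMF.mem_support_bind_iff _ _ _).1 ho2
  simp at ho3

lemma pnone_le_one (c : Comp α β) : pnone c ≤ 1 := iSup_le fun _ => PMF.coe_le_one _ _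

lemma mean_le_pnone_add_wp (c : Comp α β) (X : ℕ → α)
    (h : Option (β × (ℕ → α) × Exec) → ℝ≥0∞) (h0 : h none ≤ 1) (g : β → Exec → ℝ≥0∞)
    (hg : ∀ x Y e, h (some (x, Y, e)) ≤ g x e) : mean (c X) h ≤ pnone c + wp c g := by
  have : mean (c X) h ≤ mean (c X) (fun o => (if o = none then 1 else 0) + weight g o) := by
    refine mean_mono _ fun o _ => ?_
    match o with
    | none => simpa [weight] using h0
    | some (x, Y, e) => simpa [weight] using hg x Y e
  refine this.trans ?_
  rw [mean_add, ← apply_none_eq_mean]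
  exact add_le_add (le_pnone _ _) (mean_le_wp _ _ _)

lemma pnone_bind_le (c : Comp α β) (f : β → Comp α γ) :
    pnone (c >>= f) ≤ pnone c + wp c fun x _ => pnone (f x) := by
  refine iSup_le fun X => ?_
  rw [apply_none_eq_mean]
  refine (mean_bind (c X) _ _).trans_le (mean_le_pnone_add_wp c X _ ?_ _ ?_)
  · exact (mean_pure _ _).le.trans (by simp)
  · intro x Y e
    refine (mean_bind _ _ _).trans_le (le_trans ?_ (le_pnone _ Y))
    rw [apply_none_eq_mean]
    refine mean_mono _ fun o' _ => ?_
    match o' with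
    | none => exact (mean_pure _ _).le
    | some (y, Z, e') => exact (mean_pure _ _).le

lemma pnone_fork_le (c : Comp α β) (d : Comp α γ) :
    pnone (fork c d) ≤ pnone c + pnone d := by
  refine iSup_le fun X => ?_
  rw [apply_none_eq_mean]
  refine ((mean_bind (c X) _ _).trans_le
    (mean_le_pnone_add_wp c X _ ?_ (fun _ _ => pnone d) ?_)).trans
    (by gcongr; exact wp_const_le _ _)
  · exact (mean_pure _ _).le.trans (by simp)
  · intro x Y e
    refine (mean_bind _ _ _).trans_le (le_trans ?_ (le_pnone _ Y))
    rw [apply_none_eq_mean]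
    refine mean_mono _ fun o' _ => ?_
    match o' with
    | none => exact (mean_pure _ _).le
    | some (y, Z, e') => exact (mean_pure _ _).le

lemma pnone_frame (w : ℕ) (c : Comp α β) : pnone (frame w c) ≤ pnone c := by
  refine iSup_le fun X => ?_
  rw [apply_none_eq_mean]
  refine (mean_map (c X) _ _).trans_le (le_trans ?_ (le_pnone _ X))
  rw [apply_none_eq_mean]
  refine mean_mono _ fun o' _ => ?_
  match o' with
  | none => exact le_rfl
  | some (y, Z, e') => exact le_rfl

lemma pnone_bind_eq_zero {c : Comp α β} {f : β → Comp α γ} (hc : pnone c = 0)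
    (hf : ∀ x, pnone (f x) = 0) : pnone (c >>= f) = 0 := by
  refine le_antisymm ((pnone_bind_le c f).trans ?_) zero_le
  simp [hc, hf, wp_zero]

end Comp
end ForkJoin

namespace ForkJoin

/-! ### Costs of executions -/

/-- A measure of the cost of executions that counts instructions and is additive along sequential
composition, such as work and parallel depth. -/
structure SeqCost (κ : Exec → ℕ) : Prop where
  done : κ .done = 0
  step : κ .step = 1
  seq : ∀ a b, κ (.seq a b) = κ a + κ b
  frame : ∀ w a, κ (.frame w a) = κ a

lemma seqCost_work : SeqCost Exec.work := ⟨rfl, rfl, fun _ _ => rfl, fun _ _ => rfl⟩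

lemma seqCost_span : SeqCost Exec.span := ⟨rfl, rfl, fun _ _ => rfl, fun _ _ => rfl⟩

lemma SeqCost.steps {κ : Exec → ℕ} (hκ : SeqCost κ) (n : ℕ) : κ (.steps n) = n := by
  induction n with
  | zero => exact hκ.done
  | succ n ih => rw [Exec.steps, hκ.seq, hκ.step, ih, add_comm]

namespace Comp

variable {α : Type u} {β γ : Type} {κ : Exec → ℕ} {l : ℝ}

/-- The mean of the weight `G` of the result, multiplied with the exponential of `l` times the
cost of the execution. -/
def cwp (κ : Exec → ℕ) (l : ℝ) (c : Comp α β) (G : β → ℝ≥0∞) : ℝ≥0∞ :=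
  wp c fun x e => eexp (l * κ e) * G x

lemma cwp_mono_of_post {c : Comp α β} {G G' : β → ℝ≥0∞} (h : Post c fun x _ => G x ≤ G' x) :
    cwp κ l c G ≤ cwp κ l c G' :=
  wp_mono_of_post (h.mono fun x e hx => by gcongr)

lemma cwp_mono {c : Comp α β} {G G' : β → ℝ≥0∞} (h : ∀ x, G x ≤ G' x) :
    cwp κ l c G ≤ cwp κ l c G' := cwp_mono_of_post (Post.of_forall fun x _ => h x)

lemma cwp_const_mul (c : Comp α β) (b : ℝ≥0∞) (G : β → ℝ≥0∞) :
    cwp κ l c (fun x => b * G x) = b * cwp κ l c G := by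
  simp only [cwp, mul_left_comm _ b, wp_const_mul]

lemma cwp_sum_le {ι : Type*} (c : Comp α β) (s : Finset ι) (G : ι → β → ℝ≥0∞) :
    cwp κ l c (fun x => ∑ i ∈ s, G i x) ≤ ∑ i ∈ s, cwp κ l c (G i) := by
  simp only [cwp, Finset.mul_sum]
  exact wp_sum_le _ _ _

lemma cwp_zero (c : Comp α β) (G : β → ℝ≥0∞) : cwp κ 0 c G = wp c fun x _ => G x := by
  simp [cwp, eexp_zero]

lemma cwp_le_of_post {c : Comp α β} {G : β → ℝ≥0∞} {w : ℝ} (hl : 0 ≤ l) {b : ℝ≥0∞}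
    (h : Post c fun x e => (κ e : ℝ) ≤ w ∧ G x ≤ b) : cwp κ l c G ≤ eexp (l * w) * b :=
  wp_le_of_post (h.mono fun x e hx => mul_le_mul' (eexp_mono (by gcongr; exact hx.1)) hx.2)

section seq
variable (hκ : SeqCost κ)
include hκ

lemma cwp_pure_le (x : β) (G : β → ℝ≥0∞) : cwp κ l (pure x : Comp α β) G ≤ G x :=
  (wp_pure_le _ _).trans (by simp [hκ.done, eexp_zero])

lemma cwp_bind_le (c : Comp α β) (f : β → Comp α γ) (G : γ → ℝ≥0∞) :
    cwp κ l (c >>= f) G ≤ cwp κ l c fun x => cwp κ l (f x) G := by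
  refine (wp_bind_le _ _ _).trans (wp_mono fun x e => ?_)
  refine le_trans ?_ (wp_const_mul _ _ _).le
  refine wp_mono fun y e' => ?_
  rw [hκ.seq, Nat.cast_add, mul_add, eexp_add, mul_assoc]

lemma cwp_tick_le (n : ℕ) (G : Unit → ℝ≥0∞) :
    cwp κ l (tick n : Comp α Unit) G ≤ eexp (l * n) * G () :=
  (wp_tick_le _ _).trans (by simp [hκ.steps])

lemma cwp_swap_le (i j : ℕ) (G : Unit → ℝ≥0∞) :
    cwp κ l (swap i j : Comp α Unit) G ≤ eexp l * G () :=
  (wp_swap_le _ _ _).trans (by simp [hκ.step])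

lemma cwp_frame_le (w : ℕ) (c : Comp α β) (G : β → ℝ≥0∞) :
    cwp κ l (frame w c) G ≤ cwp κ l c G :=
  (wp_frame_le _ _ _).trans (by simp only [hκ.frame]; exact le_rfl)

lemma cwp_tick_bind_le (n : ℕ) (f : Unit → Comp α γ) (G : γ → ℝ≥0∞) :
    cwp κ l (tick n >>= f) G ≤ eexp (l * n) * cwp κ l (f ()) G :=
  (cwp_bind_le hκ _ _ _).trans (cwp_tick_le hκ _ _)

lemma cwp_swap_bind_le (i j : ℕ) (f : Unit → Comp α γ) (G : γ → ℝ≥0∞) :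
    cwp κ l (swap i j >>= f) G ≤ eexp l * cwp κ l (f ()) G :=
  (cwp_bind_le hκ _ _ _).trans (cwp_swap_le hκ _ _ _)

end seq

lemma post_loop (hκ : SeqCost κ) (n : ℕ) (f : ℕ → Comp α Unit) (w : ℕ → ℕ)
    (h : ∀ i, i < n → Post (f i) fun _ e => κ e ≤ w i) :
    Post (loop n f) fun _ e => κ e ≤ n + ∑ i ∈ Finset.range n, w i := by
  induction n with
  | zero => exact post_pure (by simp [hκ.done])
  | succ n ih =>
    refine (ih fun i hi => h i (by omega)).bind fun _ e he => Post.bind (P := fun _ e => κ e = 1)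
      (post_tick (hκ.steps 1)) fun _ e' he' => (h n (by omega)).mono fun _ e'' he'' => ?_
    rw [hκ.seq, hκ.seq, Finset.sum_range_succ]
    omega

end Comp

/-! ### Rejection samplers -/

/-- The number of rounds of a rejection sampler has exponential moments. -/
lemma mean_geometric_le {p₀ l : ℝ} (hp₀ : 0 < p₀) (hl : 0 ≤ l) (hl' : l ≤ p₀ / 2) (p : I)
    (hp : p₀ ≤ p) :
    mean (geometricMeasure p).toPMF (fun r => eexp (l * (r + 1 : ℕ))) ≤ eexp (2 / p₀ * l) := by
  have hpos : (0 : ℝ) < p := hp₀.trans_le hp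
  have hp0 : p ≠ 0 := by
    rintro rfl
    simp at hpos
  have h1 : 1 - l ≤ Real.exp (-l) := by
    have := Real.add_one_le_exp (-l)
    linarith
  have hel : Real.exp (-l) * Real.exp l = 1 := by rw [← Real.exp_add]; simp
  have hE := Real.exp_pos l
  have hr0 : 0 ≤ (1 - (p : ℝ)) * Real.exp l :=
    mul_nonneg (sub_nonneg.2 p.2.2) hE.le
  have hr1 : (1 - (p : ℝ)) * Real.exp l < 1 := by
    rw [← hel]
    gcongr
    linarith
  have hs := (hasSum_geometric_of_lt_one hr0 hr1).mul_left ((p : ℝ) * Real.exp l)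
  have key : mean (geometricMeasure p).toPMF (fun r => eexp (l * (r + 1 : ℕ))) =
      ENNReal.ofReal ((p : ℝ) * Real.exp l * (1 - (1 - (p : ℝ)) * Real.exp l)⁻¹) := by
    rw [← hs.tsum_eq, ENNReal.ofReal_tsum_of_nonneg _ hs.summable]
    · refine tsum_congr fun r => ?_
      simp only [eexp]
      rw [Measure.toPMF_apply, geometricMeasure_singleton hp0,
        ← ENNReal.ofReal_mul (geometricMeasure_nonneg p r)]
      congr 1
      rw [mul_pow, ← Real.exp_nat_mul, Nat.cast_add_one, mul_add, Real.exp_add]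
      ring_nf
    · intro n
      positivity
  rw [key]
  refine ENNReal.ofReal_le_ofReal ?_
  have hy : 0 ≤ l / p := by positivity
  have hy2 : l / p ≤ 1 / 2 := by
    rw [div_le_iff₀ hpos]
    linarith
  have hyp : l / p * p = l := by field_simp
  have hden : 0 < 1 - (1 - (p : ℝ)) * Real.exp l := by linarith
  calc (p : ℝ) * Real.exp l * (1 - (1 - (p : ℝ)) * Real.exp l)⁻¹
      ≤ 1 + 2 * (l / p) := by
        rw [← div_eq_mul_inv, div_le_iff₀ hden]
        have e1 : 1 - (1 - (p : ℝ)) * Real.exp l =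
            Real.exp l * (Real.exp (-l) - (1 - p)) := by
          linear_combination (-1 : ℝ) * hel
        rw [e1]
        have h2 : (1 + 2 * (l / p)) * ((p : ℝ) - l) ≤
            (1 + 2 * (l / p)) * (Real.exp (-l) - (1 - p)) :=
          mul_le_mul_of_nonneg_left (by linarith) (by positivity)
        have h3 : (p : ℝ) ≤ (1 + 2 * (l / p)) * ((p : ℝ) - l) := by
          have : (1 + 2 * (l / p)) * ((p : ℝ) - l) =
              p + l * (1 - 2 * (l / p)) := by
            linear_combination (2 : ℝ) * hyp
          rw [this]
          have := mul_nonneg hl (show 0 ≤ 1 - 2 * (l / p) by linarith)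
          linarith
        nlinarith
    _ ≤ Real.exp (2 * (l / p)) := by
        have := Real.add_one_le_exp (2 * (l / p))
        linarith
    _ ≤ Real.exp (2 / p₀ * l) := by
        refine Real.exp_le_exp.2 ?_
        have : l / (p : ℝ) ≤ l / p₀ := by gcongr
        calc 2 * (l / p) ≤ 2 * (l / p₀) := by gcongr
          _ = 2 / p₀ * l := by ring

lemma Comp.cwp_rejection_le {α : Type u} {κ : Exec → ℕ} (hκ : SeqCost κ) {p₀ l : ℝ} (hp₀ : 0 < p₀)
    (hl : 0 ≤ l) (hl' : l ≤ p₀ / 2) (p : I) (hp : p₀ ≤ p) (μ : PMF ℕ) (G : ℕ → ℝ≥0∞) :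
    cwp κ l (rejection p μ : Comp α ℕ) G ≤ eexp (2 / p₀ * l) * mean μ G := by
  refine (wp_rejection_le _ _ _).trans ?_
  simp only [hκ.steps, mean_const_mul]
  simp only [mul_comm _ (mean μ G), mean_const_mul]
  gcongr
  exact mean_geometric_le hp₀ hl hl' p hp

end ForkJoin

namespace ScatterShuffle
open ForkJoin ForkJoin.Comp

/-- All acceptance probabilities are at least `p₀`. -/
structure Samplers.AcceptAtLeast (S : Samplers) (p₀ : ℝ) : Prop where
  pos : 0 < p₀
  uniform : ∀ s, p₀ ≤ (S.uniformAcc s : ℝ)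
  binomial : ∀ m q, p₀ ≤ (S.binomialAcc m q : ℝ)

variable {α : Type u} {κ : Exec → ℕ} {l p₀ : ℝ} {S : Samplers}

lemma mean_uniform_le {s : ℕ} (hs : (Finset.range (s + 1)).Nonempty) {G : ℕ → ℝ≥0∞} {b : ℝ≥0∞}
    (h : ∑ j ∈ Finset.range (s + 1), G j ≤ (s + 1 : ℕ) * b) :
    mean (PMF.uniformOfFinset (Finset.range (s + 1)) hs) G ≤ b := by
  rw [mean, tsum_eq_sum (s := Finset.range (s + 1))]
  · have : ∀ j ∈ Finset.range (s + 1),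
        PMF.uniformOfFinset (Finset.range (s + 1)) hs j * G j =
          ((s + 1 : ℕ) : ℝ≥0∞)⁻¹ * G j := fun j hj => by
      rw [PMF.uniformOfFinset_apply_of_mem _ hj, Finset.card_range]
    rw [Finset.sum_congr rfl this, ← Finset.mul_sum]
    calc ((s + 1 : ℕ) : ℝ≥0∞)⁻¹ * ∑ j ∈ Finset.range (s + 1), G j
        ≤ ((s + 1 : ℕ) : ℝ≥0∞)⁻¹ * ((s + 1 : ℕ) * b) := by gcongr
      _ = b := by
        rw [← mul_assoc, ENNReal.inv_mul_cancel (by simp) (ENNReal.natCast_ne_top _), one_mul]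
  · intro j hj
    rw [PMF.uniformOfFinset_apply_of_notMem _ hj, zero_mul]

lemma cwp_uniform_le (hκ : SeqCost κ) (hS : S.AcceptAtLeast p₀) (hl : 0 ≤ l) (hl' : l ≤ p₀ / 2)
    {s : ℕ} {G : ℕ → ℝ≥0∞} {b : ℝ≥0∞}
    (h : ∑ j ∈ Finset.range (s + 1), G j ≤ (s + 1 : ℕ) * b) :
    cwp κ l (S.uniform s : Comp α ℕ) G ≤ eexp (2 / p₀ * l) * b :=
  (cwp_rejection_le hκ hS.pos hl hl' _ (hS.uniform s) _ _).trans
    (by gcongr; exact mean_uniform_le _ h)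

lemma post_uniform {s : ℕ} : Post (S.uniform s : Comp α ℕ) fun j _ => j < s + 1 := by
  refine post_rejection fun r v hv => ?_
  have := (PMF.mem_support_uniformOfFinset_iff (Finset.nonempty_range_add_one) v).1
    ((PMF.mem_support_iff _ _).2 hv)
  simpa using this

/-- The probability generating function of the binomial distribution. -/
lemma mean_binomial (m : ℕ) (q : I) (y z : ℝ≥0∞) :
    mean (ProbabilityTheory.binomial m q).toPMF (fun x => y ^ x * z ^ (m - x)) =
      (ENNReal.ofReal q * y + ENNReal.ofReal (1 - q) * z) ^ m := by
  have hq0 : (0 : ℝ) ≤ q := q.2.1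
  have hq1 : (0 : ℝ) ≤ 1 - q := sub_nonneg.2 q.2.2
  rw [mean, tsum_eq_sum (s := Finset.range (m + 1)), add_pow]
  · refine Finset.sum_congr rfl fun x _ => ?_
    rw [Measure.toPMF_apply, binomial_singleton, ENNReal.ofReal_mul (by positivity),
      ENNReal.ofReal_mul (by positivity), ENNReal.ofReal_natCast, ENNReal.ofReal_pow hq0,
      ENNReal.ofReal_pow hq1, mul_pow, mul_pow]
    ring
  · intro x hx
    have : m < x := by simpa using hx
    rw [Measure.toPMF_apply, binomial_singleton, Nat.choose_eq_zero_of_lt this]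
    simp

lemma binomial_toPMF_ne_zero {m x : ℕ} {q : I}
    (h : (ProbabilityTheory.binomial m q).toPMF x ≠ 0) : x ≤ m ∧ ((q : ℝ) = 1 → x = m) := by
  rw [Measure.toPMF_apply, binomial_singleton] at h
  have hx : x ≤ m := by
    by_contra hx
    simp [Nat.choose_eq_zero_of_lt (not_le.1 hx)] at h
  refine ⟨hx, fun hq => ?_⟩
  by_contra hne
  have : m - x ≠ 0 := by omega
  simp [hq, this] at h

lemma cwp_binomial_le (hκ : SeqCost κ) (hS : S.AcceptAtLeast p₀) (hl : 0 ≤ l) (hl' : l ≤ p₀ / 2)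
    (m : ℕ) (q : I) (y z : ℝ≥0∞) :
    cwp κ l (S.binomial m q : Comp α ℕ) (fun x => y ^ x * z ^ (m - x)) ≤
      eexp (2 / p₀ * l) * (ENNReal.ofReal q * y + ENNReal.ofReal (1 - q) * z) ^ m :=
  (cwp_rejection_le hκ hS.pos hl hl' _ (hS.binomial m q) _ _).trans_eq (by rw [mean_binomial])

lemma post_binomial {m : ℕ} {q : I} :
    Post (S.binomial m q : Comp α ℕ) fun x _ => x ≤ m ∧ ((q : ℝ) = 1 → x = m) :=
  post_rejection fun _ _ hv => binomial_toPMF_ne_zero hv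

/-! ### Fisher-Yates shuffle -/

/-- The cost per item, up to exponential moments, of a loop whose rounds consist of one sampler call
and at most four further instructions, if samplers accept with probability at least `p₀`. -/
def costRate (p₀ : ℝ) : ℝ := 2 / p₀ + 4

lemma cwp_fisherYates_le (hκ : SeqCost κ) (hS : S.AcceptAtLeast p₀) (hl : 0 ≤ l)
    (hl' : l ≤ p₀ / 2) (lo n : ℕ) :
    cwp κ l (fisherYates S lo n : Comp α Unit) (fun _ => 1) ≤
      eexp (l * (costRate p₀ * n + 1)) := by
  rw [costRate]
  have hp₀ := hS.pos
  induction n with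
  | zero =>
    rw [fisherYates]
    exact (cwp_tick_le hκ _ _).trans (by simp)
  | succ n ih =>
    match n, ih with
    | 0, _ =>
      rw [fisherYates]
      refine (cwp_tick_le hκ _ _).trans ?_
      rw [mul_one]
      apply eexp_mono
      gcongr
      simp
      positivity
    | i + 1, ih =>
      rw [fisherYates]
      refine (cwp_bind_le hκ _ _ _).trans ?_
      have : ∀ j, cwp κ l (do
          swap (lo + (i + 1)) (lo + j)
          tick 1
          fisherYates S lo (i + 1) : Comp α Unit) (fun _ => 1) ≤
          eexp l * (eexp l * eexp (l * ((2 / p₀ + 4) * (i + 1 : ℕ) + 1))) := fun j => by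
        refine (cwp_swap_bind_le hκ _ _ _ _).trans ?_
        gcongr
        refine (cwp_tick_bind_le hκ _ _ _).trans ?_
        simp only [Nat.cast_one, mul_one]
        gcongr
      refine (cwp_mono this).trans ((cwp_uniform_le hκ hS hl hl'
        (b := eexp l * (eexp l * eexp (l * ((2 / p₀ + 4) * (i + 1 : ℕ) + 1)))) ?_).trans ?_)
      · rw [Finset.sum_const, Finset.card_range, nsmul_eq_mul]
      · rw [← eexp_add, ← eexp_add, ← eexp_add]
        apply eexp_mono
        push_cast
        nlinarith [show 0 ≤ 2 / p₀ by positivity]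

end ScatterShuffle

namespace ForkJoin.Comp

variable {α : Type u} {β γ : Type} {κ : Exec → ℕ} {l : ℝ}

/-! ### Costs of forks and loops -/

lemma cwp_zero_fork_le (c : Comp α β) (d : Comp α γ) (G : β × γ → ℝ≥0∞) :
    cwp κ 0 (fork c d) G ≤ cwp κ 0 c fun x => cwp κ 0 d fun y => G (x, y) := by
  simp only [cwp_zero]
  exact wp_fork_le c d _

lemma cwp_work_fork_le (c : Comp α β) (d : Comp α γ) (G : β × γ → ℝ≥0∞) :
    cwp Exec.work l (fork c d) G ≤
      eexp l * cwp Exec.work l c fun x => cwp Exec.work l d fun y => G (x, y) := by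
  refine (wp_fork_le c d _).trans ?_
  rw [cwp, ← wp_const_mul]
  refine wp_mono fun x e => ?_
  rw [cwp, ← wp_const_mul, ← wp_const_mul]
  refine wp_mono fun y e' => ?_
  rw [Exec.work, Nat.cast_add, Nat.cast_add, mul_add, mul_add, eexp_add, eexp_add]
  simp [mul_assoc]

/-- The exponential of a maximum is at most the sum of the exponentials. -/
lemma eexp_span_fork_le (e e' : Exec) :
    eexp (l * Exec.span (.fork e e')) ≤
      eexp l * (eexp (l * Exec.span e) + eexp (l * Exec.span e')) := by
  rw [Exec.span, Nat.cast_add, mul_add, eexp_add, Nat.cast_one, mul_one]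
  gcongr
  rcases le_total (Exec.span e) (Exec.span e') with h | h
  · rw [max_eq_right h]
    exact le_add_self
  · rw [max_eq_left h]
    exact le_self_add

lemma pnone_loop (n : ℕ) (f : ℕ → Comp α Unit) (h : ∀ i, pnone (f i) = 0) :
    pnone (loop n f) = 0 := by
  induction n with
  | zero => exact pnone_pure _
  | succ n ih =>
    exact pnone_bind_eq_zero ih fun _ => pnone_bind_eq_zero (pnone_tick _) fun _ => h n

end ForkJoin.Comp

namespace ScatterShuffle
open ForkJoin ForkJoin.Comp

/-! ### Placed and staged items -/

/-- Number of placed items of a bucket. -/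
def Bucket.placed (B : Bucket) : ℕ := B.s - B.b

/-- The pointers of every bucket are in order. -/
def Valid (k : ℕ) (B : Buckets) : Prop := ∀ i, i < k → (B i).b ≤ (B i).s ∧ (B i).s ≤ (B i).e

/-- All items of all buckets are staged. -/
def AllStaged (k : ℕ) (B : Buckets) : Prop := ∀ i, i < k → (B i).s = (B i).b ∧ (B i).b ≤ (B i).e

/-- `B'` has the same cells as `B`, with possibly other items placed. -/
def SameCells (k : ℕ) (B B' : Buckets) : Prop :=
  ∀ i, i < k → (B' i).b = (B i).b ∧ (B' i).e = (B i).e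

/-- Some bucket has no staged item. -/
def HasFull (k : ℕ) (B : Buckets) : Prop := ∃ i, i < k ∧ (B i).s = (B i).e

lemma AllStaged.valid {k : ℕ} {B : Buckets} (h : AllStaged k B) : Valid k B :=
  fun i hi => ⟨(h i hi).1.ge, (h i hi).1.trans_le (h i hi).2⟩

/-- The product of `y i` to the number of placed items of bucket `i`. If the weights `y i` have
average one, then random placements do not increase its mean. -/
def placedWeight (k : ℕ) (y : ℕ → ℝ≥0∞) (B : Buckets) : ℝ≥0∞ :=
  ∏ i ∈ Finset.range k, y i ^ (B i).placed

@[simp] lemma placedWeight_one (k : ℕ) (B : Buckets) : placedWeight k (fun _ => 1) B = 1 := by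
  simp [placedWeight]

lemma placedWeight_const_one (k : ℕ) : placedWeight k (fun _ => 1) = fun _ => 1 :=
  funext (placedWeight_one k)

lemma AllStaged.placedWeight_eq {k : ℕ} {B : Buckets} (h : AllStaged k B) (y : ℕ → ℝ≥0∞) :
    placedWeight k y B = 1 :=
  Finset.prod_eq_one fun i hi => by simp [Bucket.placed, (h i (Finset.mem_range.1 hi)).1]

lemma AllStaged.staged_eq {k : ℕ} {B : Buckets} (h : AllStaged k B) :
    B.staged k = B.size k :=
  Finset.sum_congr rfl fun i hi => by
    simp [Bucket.staged, Bucket.size, (h i (Finset.mem_range.1 hi)).1]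

lemma Valid.placed_add_staged {k : ℕ} {B : Buckets} (h : Valid k B) {i : ℕ} (hi : i < k) :
    (B i).placed + (B i).staged = (B i).size := by
  have := h i hi
  simp only [Bucket.placed, Bucket.staged, Bucket.size]
  omega

lemma Valid.sum_placed_add_staged {k : ℕ} {B : Buckets} (h : Valid k B) :
    ∑ i ∈ Finset.range k, (B i).placed + B.staged k = B.size k := by
  rw [Buckets.staged, Buckets.size, ← Finset.sum_add_distrib]
  exact Finset.sum_congr rfl fun i hi => h.placed_add_staged (Finset.mem_range.1 hi)

lemma SameCells.size_eq {k : ℕ} {B B' : Buckets} (h : SameCells k B B') {i : ℕ} (hi : i < k) :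
    (B' i).size = (B i).size := by
  rw [Bucket.size, Bucket.size, (h i hi).1, (h i hi).2]

lemma SameCells.total_eq {k : ℕ} {B B' : Buckets} (h : SameCells k B B') :
    B'.size k = B.size k :=
  Finset.sum_congr rfl fun _ hi => h.size_eq (Finset.mem_range.1 hi)

lemma SameCells.trans {k : ℕ} {B B' B'' : Buckets} (h : SameCells k B B')
    (h' : SameCells k B' B'') :
    SameCells k B B'' :=
  fun i hi => ⟨(h' i hi).1.trans (h i hi).1, (h' i hi).2.trans (h i hi).2⟩

/-! ### Sequential RoughScatter -/

variable {α : Type u} {κ : Exec → ℕ} {l p₀ : ℝ} {S : Samplers} {k : ℕ}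

/-- The buckets after the first staged item of bucket `j` has become placed. -/
def place (B : Buckets) (j : ℕ) : Buckets :=
  Function.update B j { B j with s := (B j).s + 1 }

lemma roughScatterLoop_succ (t : ℕ) (B : Buckets) :
    (roughScatterLoop S k (t + 1) B : Comp α Buckets) = (do
      let j ← S.uniform (k - 1)
      swap (B 0).s (B j).s
      tick 2
      if (place B j j).s = (place B j j).e then pure (place B j)
        else roughScatterLoop S k t (place B j)) := rfl

lemma placedWeight_place {B : Buckets} {j : ℕ} (hj : j < k) (hB : (B j).b ≤ (B j).s)
    (y : ℕ → ℝ≥0∞) : placedWeight k y (place B j) = y j * placedWeight k y B := by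
  have hj' : j ∈ Finset.range k := Finset.mem_range.2 hj
  rw [placedWeight, placedWeight, ← Finset.mul_prod_erase _ _ hj', ← Finset.mul_prod_erase _ _ hj',
    ← mul_assoc, ← pow_succ']
  congr 1
  · simp [place, Bucket.placed, Nat.sub_add_comm hB]
  · refine Finset.prod_congr rfl fun i hi => ?_
    simp [place, Function.update_of_ne (Finset.ne_of_mem_erase hi)]

lemma sum_place_eq {B : Buckets} {j : ℕ} (hj : j < k) (h : (B j).s < (B j).e) :
    (place B j).staged k + 1 = B.staged k := by
  have hj' : j ∈ Finset.range k := Finset.mem_range.2 hj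
  rw [Buckets.staged, Buckets.staged, ← Finset.add_sum_erase _ _ hj',
    ← Finset.add_sum_erase _ _ hj']
  have : ∑ i ∈ (Finset.range k).erase j, (place B j i).staged =
      ∑ i ∈ (Finset.range k).erase j, (B i).staged := by
    refine Finset.sum_congr rfl fun i hi => ?_
    simp [place, Function.update_of_ne (Finset.ne_of_mem_erase hi)]
  rw [this]
  simp only [place, Function.update_self, Bucket.staged]
  omega

lemma Valid.place {B : Buckets} (hB : Valid k B) {j : ℕ} (h : (B j).s < (B j).e) :
    Valid k (place B j) := by
  intro i hi
  by_cases hij : i = j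
  · subst hij
    have := hB i hi
    simp only [ScatterShuffle.place, Function.update_self]
    omega
  · simpa [ScatterShuffle.place, Function.update_of_ne hij] using hB i hi

lemma sameCells_place (B : Buckets) (j : ℕ) : SameCells k B (place B j) := by
  intro i _
  by_cases hij : i = j
  · subst hij
    simp [place]
  · simp [place, Function.update_of_ne hij]

lemma post_roughScatterLoop (hk : 0 < k) (t : ℕ) (B : Buckets) (hB : Valid k B)
    (hf : ∀ i, i < k → (B i).s ≠ (B i).e) (ht : B.staged k ≤ t) :
    Post (roughScatterLoop S k t B : Comp α Buckets)
      fun B' _ => Valid k B' ∧ SameCells k B B' ∧ HasFull k B' := by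
  induction t generalizing B with
  | zero =>
    exfalso
    have h0 : (B 0).staged = 0 := by
      have : ∑ i ∈ Finset.range k, (B i).staged = 0 := by simpa [Buckets.staged] using ht
      exact Finset.sum_eq_zero_iff.1 this 0 (Finset.mem_range.2 hk)
    have := hB 0 hk
    have := hf 0 hk
    simp only [Bucket.staged] at h0
    omega
  | succ t ih =>
    rw [roughScatterLoop_succ]
    refine post_uniform.bind fun j _ hj => ?_
    have hj' : j < k := by omega
    have hlt : (B j).s < (B j).e := lt_of_le_of_ne (hB j hj').2 (hf j hj')
    refine (post_swap (Q := fun _ _ => True) trivial).bind fun _ _ _ =>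
      (post_tick (Q := fun _ _ => True) trivial).bind fun _ _ _ => ?_
    split_ifs with hfull
    · exact post_pure ⟨hB.place hlt, sameCells_place B j, j, hj', hfull⟩
    · refine (ih (place B j) (hB.place hlt) ?_ ?_).mono fun B' _ h => ⟨h.1, ?_, h.2.2⟩
      · intro i hi
        by_cases hij : i = j
        · subst hij; exact hfull
        · simpa [place, Function.update_of_ne hij] using hf i hi
      · have := sum_place_eq (k := k) hj' hlt
        omega
      · exact (sameCells_place B j).trans h.2.1

lemma cwp_roughScatterLoop_le (hκ : SeqCost κ) (hS : S.AcceptAtLeast p₀) (hl : 0 ≤ l)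
    (hl' : l ≤ p₀ / 2) (hk : 0 < k) {y : ℕ → ℝ≥0∞} (hy : ∑ i ∈ Finset.range k, y i ≤ k) (t : ℕ)
    (B : Buckets) (hB : ∀ i, i < k → (B i).b ≤ (B i).s) :
    cwp κ l (roughScatterLoop S k t B : Comp α Buckets) (placedWeight k y) ≤
      eexp (l * (costRate p₀ * t)) * placedWeight k y B := by
  have hp₀ := hS.pos
  have hc : 0 ≤ costRate p₀ := by rw [costRate]; positivity
  induction t generalizing B with
  | zero =>
    rw [roughScatterLoop]
    exact (cwp_pure_le hκ _ _).trans (by simp [eexp_zero])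
  | succ t ih =>
    rw [roughScatterLoop_succ]
    refine (cwp_bind_le hκ _ _ _).trans ?_
    have key : ∀ j, j < k → cwp κ l (do
        swap (B 0).s (B j).s
        tick 2
        if (place B j j).s = (place B j j).e then pure (place B j)
          else roughScatterLoop S k t (place B j) : Comp α Buckets) (placedWeight k y) ≤
        y j * (eexp (l * (3 + costRate p₀ * t)) * placedWeight k y B) := fun j hj => by
      refine (cwp_swap_bind_le hκ _ _ _ _).trans ?_
      have h2 := (cwp_tick_bind_le hκ 2 (fun _ =>
        if (place B j j).s = (place B j j).e then pure (place B j)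
          else (roughScatterLoop S k t (place B j) : Comp α Buckets)) (placedWeight k y) (l := l))
      have h3 : cwp κ l (if (place B j j).s = (place B j j).e then pure (place B j)
          else (roughScatterLoop S k t (place B j) : Comp α Buckets)) (placedWeight k y) ≤
          eexp (l * (costRate p₀ * t)) * placedWeight k y (place B j) := by
        split_ifs
        · refine (cwp_pure_le hκ _ _).trans ?_
          exact le_mul_of_one_le_left' (one_le_eexp (by positivity))
        · refine ih _ fun i hi => ?_
          by_cases hij : i = j
          · subst hij
            have := hB i hi
            simp only [place, Function.update_self]
            omega
          · simpa [place, Function.update_of_ne hij] using hB i hi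
      calc _ ≤ eexp l * (eexp (l * (2 : ℕ)) * (eexp (l * (costRate p₀ * t)) *
              placedWeight k y (place B j))) := by
            gcongr
            exact h2.trans (by gcongr)
        _ = _ := by
          rw [placedWeight_place hj (hB j hj),
            show l * (3 + costRate p₀ * t) = l + (l * (2 : ℕ) + l * (costRate p₀ * t)) by
              push_cast; ring, eexp_add, eexp_add]
          ring
    refine (cwp_mono_of_post (post_uniform.mono fun j _ hj => key j (by omega))).trans ?_
    refine (cwp_uniform_le hκ hS hl hl'
      (b := eexp (l * (3 + costRate p₀ * t)) * placedWeight k y B) ?_).trans ?_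
    · rw [Nat.sub_add_cancel hk, ← Finset.sum_mul]
      gcongr
    · rw [← mul_assoc, ← eexp_add]
      gcongr
      apply eexp_mono
      rw [show l * (costRate p₀ * (t + 1 : ℕ)) = l * (costRate p₀ * t) + (2 / p₀ * l + 4 * l) by
        push_cast; rw [costRate]; ring]
      linarith

lemma post_roughScatter (hk : 0 < k) (B : Buckets) (hB : Valid k B) :
    Post (roughScatter S k B : Comp α Buckets)
      fun B' _ => Valid k B' ∧ SameCells k B B' ∧ HasFull k B' := by
  rw [roughScatter]
  refine (post_tick (Q := fun _ _ => True) trivial).bind fun _ _ _ => ?_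
  split_ifs with h
  · obtain ⟨i, hi, hfull⟩ := h
    exact post_pure ⟨hB, fun _ _ => ⟨rfl, rfl⟩, i, Finset.mem_range.1 hi, hfull⟩
  · push Not at h
    exact post_roughScatterLoop hk _ B hB (fun i hi => h i (Finset.mem_range.2 hi)) le_rfl

lemma cwp_roughScatter_le (hκ : SeqCost κ) (hS : S.AcceptAtLeast p₀) (hl : 0 ≤ l)
    (hl' : l ≤ p₀ / 2) (hk : 0 < k) {y : ℕ → ℝ≥0∞} (hy : ∑ i ∈ Finset.range k, y i ≤ k)
    (B : Buckets) (hB : Valid k B) :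
    cwp κ l (roughScatter S k B : Comp α Buckets) (placedWeight k y) ≤
      eexp (l * (k + 1 + costRate p₀ * B.staged k)) * placedWeight k y B := by
  have hp₀ := hS.pos
  have hc : 0 ≤ costRate p₀ := by rw [costRate]; positivity
  rw [roughScatter]
  refine (cwp_tick_bind_le hκ _ _ _).trans ?_
  rw [mul_add, eexp_add, mul_assoc]
  push_cast
  gcongr
  split_ifs with h
  · refine (cwp_pure_le hκ _ _).trans ?_
    exact le_mul_of_one_le_left' (one_le_eexp (by positivity))
  · exact cwp_roughScatterLoop_le hκ hS hl hl' hk hy _ B fun i hi => (hB i hi).1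

lemma pnone_roughScatterLoop (t : ℕ) (B : Buckets) :
    pnone (roughScatterLoop S k t B : Comp α Buckets) = 0 := by
  induction t generalizing B with
  | zero => exact pnone_pure _
  | succ t ih =>
    rw [roughScatterLoop_succ]
    refine pnone_bind_eq_zero (pnone_rejection _ _) fun j =>
      pnone_bind_eq_zero (pnone_swap _ _) fun _ => pnone_bind_eq_zero (pnone_tick _) fun _ => ?_
    split_ifs
    · exact pnone_pure _
    · exact ih _

lemma pnone_roughScatter (B : Buckets) : pnone (roughScatter S k B : Comp α Buckets) = 0 := by
  rw [roughScatter]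
  refine pnone_bind_eq_zero (pnone_tick _) fun _ => ?_
  split_ifs
  · exact pnone_pure _
  · exact pnone_roughScatterLoop _ _

/-! ### Parallel RoughScatter -/

/-- The buckets that consist of two adjacent halves each. -/
def merged (L R : Buckets) : Buckets :=
  fun i => ⟨(L i).b, (L i).s + ((R i).s - (R i).b), (R i).e⟩

/-- The end of the first halves is the beginning of the second halves. -/
def Adjacent (k : ℕ) (L R : Buckets) : Prop := ∀ i, i < k → (L i).e = (R i).b

lemma post_mergeHalves (hκ : SeqCost κ) (L R : Buckets) :
    Post (mergeHalves k L R : Comp α Buckets)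
      fun B' e => B' = merged L R ∧ κ e ≤ 4 * k + 2 * L.staged k := by
  rw [mergeHalves]
  refine (post_loop hκ k _ (fun i => 3 + 2 * (L i).staged) fun i _ => ?_).bind fun _ e he =>
    post_pure ⟨rfl, ?_⟩
  · refine (post_tick (Q := fun _ e => κ e = 3) (hκ.steps 3)).bind fun _ e he => ?_
    refine (post_loop hκ _ _ (fun _ => 1) fun j _ => post_swap hκ.step.le).mono fun _ e' he' => ?_
    rw [hκ.seq]
    simp at he'
    have := min_le_left (L i).staged ((R i).s - (R i).b)
    omega
  · rw [hκ.seq, hκ.done, Buckets.staged, Finset.mul_sum]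
    simp [Finset.sum_add_distrib] at he
    omega

lemma pnone_mergeHalves (L R : Buckets) : pnone (mergeHalves k L R : Comp α Buckets) = 0 :=
  pnone_bind_eq_zero (pnone_loop _ _ fun _ => pnone_bind_eq_zero (pnone_tick _) fun _ =>
    pnone_loop _ _ fun _ => pnone_swap _ _) fun _ => pnone_pure _

lemma allStaged_firstHalves (B : Buckets) : AllStaged k (firstHalves B) :=
  fun i _ => by simp [ScatterShuffle.firstHalves]

lemma AllStaged.secondHalves {B : Buckets} (h : AllStaged k B) : AllStaged k (secondHalves B) :=
  fun i hi => by
    have := h i hi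
    simp only [ScatterShuffle.secondHalves, Bucket.size, true_and]
    omega

lemma valid_merged {L R : Buckets} (hL : Valid k L) (hR : Valid k R) (hLR : Adjacent k L R) :
    Valid k (merged L R) := fun i hi => by
  have := hL i hi
  have := hR i hi
  have := hLR i hi
  simp only [merged]
  omega

lemma placedWeight_merged {L R : Buckets} (hL : Valid k L) (y : ℕ → ℝ≥0∞) :
    placedWeight k y (merged L R) = placedWeight k y L * placedWeight k y R := by
  rw [placedWeight, placedWeight, placedWeight, ← Finset.prod_mul_distrib]
  refine Finset.prod_congr rfl fun i hi => ?_
  rw [← pow_add]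
  congr 1
  have := hL i (Finset.mem_range.1 hi)
  simp only [merged, Bucket.placed]
  omega

lemma staged_merged {L R : Buckets} (hL : Valid k L) (hR : Valid k R) (hLR : Adjacent k L R) :
    (merged L R).staged k = L.staged k + R.staged k := by
  rw [Buckets.staged, Buckets.staged, Buckets.staged, ← Finset.sum_add_distrib]
  refine Finset.sum_congr rfl fun i hi => ?_
  have := hL i (Finset.mem_range.1 hi)
  have := hR i (Finset.mem_range.1 hi)
  have := hLR i (Finset.mem_range.1 hi)
  simp only [merged, Bucket.staged]
  omega

/-- What is certain about the outcome of `parRoughScatterAux` on the buckets `B`. -/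
structure Scattered (k : ℕ) (B B' : Buckets) : Prop where
  valid : Valid k B'
  same : SameCells k B B'
  full : HasFull k B'

variable {N₀ : ℕ}

lemma adjacent_of_scattered {B L R : Buckets} (hL : Scattered k (firstHalves B) L)
    (hR : Scattered k (secondHalves B) R) : Adjacent k L R := fun i hi => by
  rw [(hL.same i hi).2, (hR.same i hi).1]
  rfl

/-- The two forked subtasks of `parRoughScatterAux`. -/
def forkHalves (S : Samplers) (k N₀ h : ℕ) (B : Buckets) : Comp α (Buckets × Buckets) :=
  fork (frame (3 * k + 8) (parRoughScatterAux S k N₀ h (firstHalves B)))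
    (frame (3 * k + 8) (parRoughScatterAux S k N₀ h (secondHalves B)))

lemma parRoughScatterAux_succ (h : ℕ) (B : Buckets) :
    (parRoughScatterAux S k N₀ (h + 1) B : Comp α Buckets) = (do
      tick (k + 1)
      if B.size k ≤ N₀ then roughScatter S k B
      else do
        tick (6 * k)
        let p ← forkHalves S k N₀ h B
        let B' ← mergeHalves k p.1 p.2
        roughScatter S k B') := rfl

lemma post_parRoughScatterAux (hk : 0 < k) (h : ℕ) (B : Buckets) (hB : AllStaged k B) :
    Post (parRoughScatterAux S k N₀ h B : Comp α Buckets) fun B' _ => Scattered k B B' := by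
  induction h generalizing B with
  | zero =>
    rw [parRoughScatterAux]
    exact (post_roughScatter hk B hB.valid).mono fun _ _ h => ⟨h.1, h.2.1, h.2.2⟩
  | succ h ih =>
    rw [parRoughScatterAux_succ]
    refine (post_tick (Q := fun _ _ => True) trivial).bind fun _ _ _ => ?_
    split_ifs
    · exact (post_roughScatter hk B hB.valid).mono fun _ _ h => ⟨h.1, h.2.1, h.2.2⟩
    refine (post_tick (Q := fun _ _ => True) trivial).bind fun _ _ _ => ?_
    refine (Post.fork (Q := fun p _ => Scattered k (firstHalves B) p.1 ∧
      Scattered k (secondHalves B) p.2) (P := fun x _ => Scattered k (firstHalves B) x)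
      (P' := fun y _ => Scattered k (secondHalves B) y) (ih _ (allStaged_firstHalves B)).frame
      (ih _ hB.secondHalves).frame
      fun x _ y _ hx hy => ⟨hx, hy⟩).bind fun p _ ⟨hL, hR⟩ => ?_
    refine (post_mergeHalves seqCost_span p.1 p.2).bind fun B' _ ⟨hB', _⟩ => ?_
    subst hB'
    refine (post_roughScatter hk _
      (valid_merged hL.valid hR.valid (adjacent_of_scattered hL hR))).mono
      fun B'' _ h => ⟨h.1, SameCells.trans (fun i hi => ?_) h.2.1, h.2.2⟩
    exact ⟨(hL.same i hi).1, (hR.same i hi).2⟩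

lemma post_forkHalves (hk : 0 < k) (h : ℕ) (B : Buckets) (hB : AllStaged k B) :
    Post (forkHalves S k N₀ h B : Comp α (Buckets × Buckets)) fun p _ =>
      Scattered k (firstHalves B) p.1 ∧ Scattered k (secondHalves B) p.2 :=
  Post.fork (P := fun x _ => Scattered k (firstHalves B) x)
    (P' := fun y _ => Scattered k (secondHalves B) y)
    (post_parRoughScatterAux hk h _ (allStaged_firstHalves B)).frame
    (post_parRoughScatterAux hk h _ hB.secondHalves).frame fun _ _ _ _ hx hy => ⟨hx, hy⟩

lemma pnone_parRoughScatterAux (h : ℕ) (B : Buckets) :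
    pnone (parRoughScatterAux S k N₀ h B : Comp α Buckets) = 0 := by
  induction h generalizing B with
  | zero =>
    rw [parRoughScatterAux]
    exact pnone_roughScatter B
  | succ h ih =>
    rw [parRoughScatterAux_succ]
    refine pnone_bind_eq_zero (pnone_tick _) fun _ => ?_
    split_ifs
    · exact pnone_roughScatter B
    refine pnone_bind_eq_zero (pnone_tick _) fun _ => pnone_bind_eq_zero ?_ fun p =>
      pnone_bind_eq_zero (pnone_mergeHalves _ _) fun _ => pnone_roughScatter _
    refine le_antisymm ((pnone_fork_le _ _).trans ?_) zero_le
    refine (add_le_add (pnone_frame _ _) (pnone_frame _ _)).trans ?_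
    simp [ih]

/-- One level of the recursion of `parRoughScatterAux`: apart from the subtasks, the cost is
governed by the number of items that the subtasks leave staged. -/
lemma cwp_parRoughScatterAux_succ_le (hκ : SeqCost κ) (hS : S.AcceptAtLeast p₀) (hl : 0 ≤ l)
    (hl' : l ≤ p₀ / 2) (hk : 0 < k) {y : ℕ → ℝ≥0∞} (hy : ∑ i ∈ Finset.range k, y i ≤ k) (h : ℕ)
    (B : Buckets) (hB : AllStaged k B) (hN : N₀ < B.size k) :
    cwp κ l (parRoughScatterAux S k N₀ (h + 1) B : Comp α Buckets) (placedWeight k y) ≤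
      cwp κ l (forkHalves S k N₀ h B : Comp α (Buckets × Buckets)) fun p =>
        eexp (l * (14 * k + (costRate p₀ + 2) * (p.1.staged k + p.2.staged k))) *
          (placedWeight k y p.1 * placedWeight k y p.2) := by
  rw [parRoughScatterAux_succ]
  refine (cwp_tick_bind_le hκ _ _ _).trans ?_
  rw [if_neg (not_le.2 hN)]
  refine (mul_le_mul' le_rfl (cwp_tick_bind_le hκ _ _ _)).trans ?_
  refine (mul_le_mul' le_rfl (mul_le_mul' le_rfl (cwp_bind_le hκ _ _ _))).trans ?_
  rw [← mul_assoc, ← eexp_add, ← cwp_const_mul]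
  refine cwp_mono_of_post ((post_forkHalves hk h B hB).mono fun p _ ⟨hL, hR⟩ => ?_)
  have hadj := adjacent_of_scattered hL hR
  have h1 : cwp κ l (do
      let B' ← mergeHalves k p.1 p.2
      roughScatter S k B' : Comp α Buckets) (placedWeight k y) ≤
      eexp (l * ((4 * k + 2 * p.1.staged k : ℕ) : ℝ)) *
        (eexp (l * (k + 1 + costRate p₀ * (merged p.1 p.2).staged k)) *
          placedWeight k y (merged p.1 p.2)) := by
    refine (cwp_bind_le hκ _ _ _).trans (cwp_le_of_post hl ?_)
    refine (post_mergeHalves hκ p.1 p.2).mono fun B' e ⟨hB', he⟩ => ⟨by exact_mod_cast he, ?_⟩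
    subst hB'
    exact cwp_roughScatter_le hκ hS hl hl' hk hy _ (valid_merged hL.valid hR.valid hadj)
  refine (mul_le_mul' le_rfl h1).trans ?_
  rw [placedWeight_merged hL.valid, staged_merged hL.valid hR.valid hadj, ← mul_assoc, ← mul_assoc,
    ← eexp_add, ← eexp_add]
  gcongr
  apply eexp_mono
  rw [← mul_add, ← mul_add, ← mul_add]
  refine mul_le_mul_of_nonneg_left ?_ hl
  push_cast
  have : (1 : ℝ) ≤ k := by exact_mod_cast hk
  have : (0 : ℝ) ≤ p.2.staged k := by positivity
  linarith

lemma cwp_parRoughScatterAux_placedWeight_le (hκ : SeqCost κ) (hS : S.AcceptAtLeast p₀)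
    (hk : 0 < k) {y : ℕ → ℝ≥0∞} (hy : ∑ i ∈ Finset.range k, y i ≤ k) (h : ℕ) (B : Buckets)
    (hB : AllStaged k B) :
    cwp κ 0 (parRoughScatterAux S k N₀ h B : Comp α Buckets) (placedWeight k y) ≤ 1 := by
  have hp₀ := hS.pos
  have base : cwp κ 0 (roughScatter S k B : Comp α Buckets) (placedWeight k y) ≤ 1 := by
    refine (cwp_roughScatter_le hκ hS le_rfl (by positivity) hk hy B hB.valid).trans ?_
    simp [eexp_zero, hB.placedWeight_eq]
  induction h generalizing B with
  | zero =>
    rw [parRoughScatterAux]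
    exact base
  | succ h ih =>
    by_cases hN : B.size k ≤ N₀
    · rw [parRoughScatterAux_succ]
      refine (cwp_tick_bind_le hκ _ _ _).trans ?_
      rw [if_pos hN]
      simpa [eexp_zero] using base
    · refine (cwp_parRoughScatterAux_succ_le hκ hS le_rfl (by positivity) hk hy h B hB
        (not_le.1 hN)).trans ?_
      have ih' : ∀ B, AllStaged k B →
          cwp κ 0 (parRoughScatterAux S k N₀ h B : Comp α Buckets) (placedWeight k y) ≤ 1 := by
        intro B hB
        refine ih B hB ?_
        refine (cwp_roughScatter_le hκ hS le_rfl (by positivity) hk hy B hB.valid).trans ?_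
        simp [eexp_zero, hB.placedWeight_eq]
      simp only [zero_mul, eexp_zero, one_mul]
      refine (cwp_zero_fork_le _ _ _).trans ?_
      simp only [cwp_const_mul]
      refine (cwp_frame_le hκ _ _ _).trans (le_trans (cwp_mono fun x => ?_)
        (ih' _ (allStaged_firstHalves B)))
      exact mul_le_of_le_one_right' ((cwp_frame_le hκ _ _ _).trans (ih' _ hB.secondHalves))

end ScatterShuffle

namespace ForkJoin.Comp

variable {α : Type u} {β γ : Type} {κ : Exec → ℕ} {l : ℝ}

/-! ### Sublinear functionals -/

/-- A functional on weights that behaves like a worst-case mean. -/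
structure Sublinear {Ω : Type*} (Φ : (Ω → ℝ≥0∞) → ℝ≥0∞) : Prop where
  mono : ∀ g g', (∀ x, g x ≤ g' x) → Φ g ≤ Φ g'
  add : ∀ g g', Φ (fun x => g x + g' x) ≤ Φ g + Φ g'
  mul : ∀ (b : ℝ≥0∞) g, Φ (fun x => b * g x) ≤ b * Φ g
  one : Φ (fun _ => 1) ≤ 1

lemma sublinear_wp (c : Comp α β) :
    Sublinear fun g : β × Exec → ℝ≥0∞ => wp c fun x e => g (x, e) :=
  ⟨fun _ _ h => wp_mono fun _ _ => h _, fun _ _ => wp_add_le _ _ _,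
    fun _ _ => (wp_const_mul _ _ _).le, wp_const_le c 1⟩

namespace Sublinear

variable {Ω : Type*} {Φ : (Ω → ℝ≥0∞) → ℝ≥0∞} (hΦ : Sublinear Φ)
include hΦ

lemma zero : Φ (fun _ => 0) = 0 :=
  le_antisymm (by simpa using hΦ.mul 0 fun _ => 0) zero_le

lemma sum {ι : Type*} (s : Finset ι) (g : ι → Ω → ℝ≥0∞) :
    Φ (fun x => ∑ i ∈ s, g i x) ≤ ∑ i ∈ s, Φ (g i) := by
  classical
  induction s using Finset.induction_on with
  | empty => simp [hΦ.zero]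
  | insert a s ha ih =>
    simp only [Finset.sum_insert ha]
    exact (hΦ.add _ _).trans (by gcongr)

/-- Exponential moments of a convex combination are controlled by those of its parts. This takes
the place of Hölder's inequality, for dependent parts. -/
lemma eexp_convex {ι : Type*} (s : Finset ι) (w X : ι → ℝ) (f : ι → Ω → ℝ)
    (hw : ∀ i ∈ s, 0 ≤ w i) (h1 : ∑ i ∈ s, w i = 1)
    (h : ∀ i ∈ s, Φ (fun x => eexp (f i x)) ≤ eexp (X i)) :
    Φ (fun x => eexp (∑ i ∈ s, w i * f i x)) ≤ eexp (∑ i ∈ s, w i * X i) := by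
  have key : ∀ x, eexp (∑ i ∈ s, w i * f i x) ≤ eexp (∑ i ∈ s, w i * X i) *
      ∑ i ∈ s, (ENNReal.ofReal (w i) * eexp (-X i)) * eexp (f i x) := by
    intro x
    have : ∑ i ∈ s, w i * f i x = ∑ i ∈ s, w i * X i + ∑ i ∈ s, w i * (-X i + f i x) := by
      rw [← Finset.sum_add_distrib]
      exact Finset.sum_congr rfl fun i _ => by ring
    rw [this, eexp_add]
    gcongr
    refine (_root_.eexp_convex s w _ hw h1).trans_eq (Finset.sum_congr rfl fun i _ => ?_)
    rw [eexp_add, mul_assoc]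
  refine (hΦ.mono _ _ key).trans ((hΦ.mul _ _).trans ?_)
  refine mul_le_of_le_one_right' ((hΦ.sum _ _).trans ?_)
  calc ∑ i ∈ s, Φ (fun x => (ENNReal.ofReal (w i) * eexp (-X i)) * eexp (f i x))
      ≤ ∑ i ∈ s, ENNReal.ofReal (w i) := by
        refine Finset.sum_le_sum fun i hi => (hΦ.mul _ _).trans ?_
        rw [mul_assoc]
        refine mul_le_of_le_one_right' ?_
        exact (mul_le_mul' le_rfl (h i hi)).trans (eexp_neg_mul _).le
    _ = 1 := by rw [← ENNReal.ofReal_sum_of_nonneg hw, h1, ENNReal.ofReal_one]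

lemma eexp_convex_two {v w : ℝ} (hv : 0 ≤ v) (hw : 0 ≤ w) (h1 : v + w = 1)
    {f g : Ω → ℝ} {X Y : ℝ} (hf : Φ (fun x => eexp (f x)) ≤ eexp X)
    (hg : Φ (fun x => eexp (g x)) ≤ eexp Y) :
    Φ (fun x => eexp (v * f x + w * g x)) ≤ eexp (v * X + w * Y) := by
  have := hΦ.eexp_convex Finset.univ ![v, w] ![X, Y] ![f, g]
    (by simp [Fin.forall_fin_two, hv, hw]) (by simpa [Fin.sum_univ_two] using h1)
    (by simp [Fin.forall_fin_two, hf, hg])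
  simpa [Fin.sum_univ_two] using this

/-- Exponential moments with a smaller rate. -/
lemma eexp_mul {v : ℝ} (hv : 0 ≤ v) (hv1 : v ≤ 1) {f : Ω → ℝ} {X : ℝ}
    (hf : Φ (fun x => eexp (f x)) ≤ eexp X) :
    Φ (fun x => eexp (v * f x)) ≤ eexp (v * X) := by
  have := hΦ.eexp_convex_two hv (sub_nonneg.2 hv1) (by ring) hf (g := fun _ => 0) (Y := 0)
    (by simpa [eexp_zero] using hΦ.one)
  simpa using this

end Sublinear

lemma wp_eexp_convex_two_le (c : Comp α β) {v w : ℝ} (hv : 0 ≤ v) (hw : 0 ≤ w) (h1 : v + w = 1)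
    {f g : β → Exec → ℝ} {X Y : ℝ} (hf : wp c (fun x e => eexp (f x e)) ≤ eexp X)
    (hg : wp c (fun x e => eexp (g x e)) ≤ eexp Y) :
    wp c (fun x e => eexp (v * f x e + w * g x e)) ≤ eexp (v * X + w * Y) :=
  (sublinear_wp c).eexp_convex_two hv hw h1 (f := fun p => f p.1 p.2) (g := fun p => g p.1 p.2)
    hf hg

lemma wp_eexp_mul_le (c : Comp α β) {v : ℝ} (hv : 0 ≤ v) (hv1 : v ≤ 1)
    {f : β → Exec → ℝ} {X : ℝ} (hf : wp c (fun x e => eexp (f x e)) ≤ eexp X) :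
    wp c (fun x e => eexp (v * f x e)) ≤ eexp (v * X) :=
  (sublinear_wp c).eexp_mul hv hv1 (f := fun p => f p.1 p.2) hf

lemma wp_fork_fst_le (c : Comp α β) (d : Comp α γ) (g : β → Exec → ℝ≥0∞) :
    wp c (fun x e => wp d fun _ _ => g x e) ≤ wp c g := wp_mono fun _ _ => wp_const_le _ _

lemma wp_fork_snd_le (c : Comp α β) (d : Comp α γ) (g : γ → Exec → ℝ≥0∞) :
    wp c (fun _ _ => wp d fun y e => g y e) ≤ wp d g := wp_const_le _ _

lemma cwp_span_fork_le (c : Comp α β) (d : Comp α γ) :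
    cwp Exec.span l (fork c d) (fun _ => 1) ≤
      eexp l * (cwp Exec.span l c (fun _ => 1) + cwp Exec.span l d (fun _ => 1)) := by
  simp only [cwp, mul_one]
  refine (wp_fork_le c d _).trans ?_
  refine (wp_mono fun x e => wp_mono fun y e' => eexp_span_fork_le e e').trans ?_
  simp only [wp_const_mul]
  gcongr
  refine (wp_mono fun x e => wp_add_le _ _ _).trans ((wp_add_le _ _ _).trans ?_)
  exact add_le_add (wp_fork_fst_le _ _ _) (wp_fork_snd_le _ _ _)

end ForkJoin.Comp

namespace ScatterShuffle
open ForkJoin ForkJoin.Comp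

/-! ### Tilted weights -/

/-- Weights with average at most one that count the placements into the buckets in `A`. -/
def tilt (k : ℕ) (A : Finset ℕ) (ν : ℝ) (i : ℕ) : ℝ≥0∞ :=
  eexp ((if i ∈ A then ν else 0) - (Real.exp ν - 1) * A.card / k)

lemma sum_tilt_le {k : ℕ} (hk : 0 < k) {A : Finset ℕ} (hA : A ⊆ Finset.range k) (ν : ℝ) :
    ∑ i ∈ Finset.range k, tilt k A ν i ≤ k := by
  have hk' : (0 : ℝ) < k := by exact_mod_cast hk
  set x := (Real.exp ν - 1) * A.card / k with hx
  have h1 : ∑ i ∈ Finset.range k, Real.exp (if i ∈ A then ν else 0) = k + k * x := by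
    have : ∀ i ∈ Finset.range k, Real.exp (if i ∈ A then ν else 0) =
        1 + if i ∈ A then Real.exp ν - 1 else 0 := fun i _ => by split_ifs <;> simp
    rw [Finset.sum_congr rfl this, Finset.sum_add_distrib, Finset.sum_ite_mem,
      Finset.inter_eq_right.2 hA]
    simp [hx]
    field_simp
  have h2 : ∑ i ∈ Finset.range k, Real.exp ((if i ∈ A then ν else 0) - x) ≤ k := by
    simp only [sub_eq_add_neg, Real.exp_add]
    rw [← Finset.sum_mul, h1]
    have h3 := Real.add_one_le_exp x
    calc ((k : ℝ) + k * x) * Real.exp (-x) = k * ((x + 1) * Real.exp (-x)) := by ring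
      _ ≤ k * (Real.exp x * Real.exp (-x)) := by gcongr
      _ = k := by rw [← Real.exp_add]; simp
  calc ∑ i ∈ Finset.range k, tilt k A ν i
      = ENNReal.ofReal (∑ i ∈ Finset.range k, Real.exp ((if i ∈ A then ν else 0) - x)) := by
        rw [ENNReal.ofReal_sum_of_nonneg fun _ _ => (Real.exp_pos _).le]
        rfl
    _ ≤ ENNReal.ofReal k := ENNReal.ofReal_le_ofReal h2
    _ = k := by simp

lemma prod_tilt_pow {k : ℕ} {A : Finset ℕ} (hA : A ⊆ Finset.range k) (ν : ℝ) (n : ℕ → ℕ) :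
    ∏ i ∈ Finset.range k, tilt k A ν i ^ n i =
      eexp (ν * (∑ i ∈ A, n i : ℕ) -
        (Real.exp ν - 1) * A.card / k * (∑ i ∈ Finset.range k, n i : ℕ)) := by
  simp only [tilt, ← eexp_nat_mul]
  rw [← eexp_sum]
  congr 1
  simp only [mul_sub, Finset.sum_sub_distrib]
  congr 1
  · push_cast
    rw [Finset.mul_sum, ← Finset.sum_subset hA]
    · exact Finset.sum_congr rfl fun i hi => by rw [if_pos hi, mul_comm]
    · intro i _ hi
      rw [if_neg hi, mul_zero]
  · push_cast
    rw [← Finset.sum_mul, mul_comm]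

lemma eexp_log_natCast {k : ℕ} (hk : 0 < k) : eexp (Real.log k) = k := by
  rw [eexp, Real.exp_log (by exact_mod_cast hk), ENNReal.ofReal_natCast]

lemma exp_sub_one_le {x : ℝ} (h : |x| ≤ 1) : Real.exp x - 1 ≤ x + x ^ 2 := by
  have := (abs_le.1 (Real.abs_exp_sub_one_sub_id_le h)).2
  linarith

/-! ### Balanced buckets -/

/-- The bucket sizes differ by at most one. -/
def Balanced (k : ℕ) (B : Buckets) : Prop :=
  ∃ q, ∀ i, i < k → q ≤ (B i).size ∧ (B i).size ≤ q + 1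

variable {α : Type u} {κ : Exec → ℕ} {l p₀ : ℝ} {S : Samplers} {k N₀ : ℕ} {B : Buckets}

lemma size_firstHalves (B : Buckets) (i : ℕ) : (firstHalves B i).size = (B i).size / 2 := by
  simp [firstHalves, Bucket.size]

lemma size_secondHalves (hB : AllStaged k B) {i : ℕ} (hi : i < k) :
    (secondHalves B i).size = (B i).size - (B i).size / 2 := by
  have := (hB i hi).2
  simp only [secondHalves, Bucket.size]
  omega

lemma Balanced.firstHalves (h : Balanced k B) : Balanced k (firstHalves B) := by
  obtain ⟨q, hq⟩ := h
  refine ⟨q / 2, fun i hi => ?_⟩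
  have := hq i hi
  rw [size_firstHalves]
  omega

lemma Balanced.secondHalves (hB : AllStaged k B) (h : Balanced k B) :
    Balanced k (secondHalves B) := by
  obtain ⟨q, hq⟩ := h
  refine ⟨q - q / 2, fun i hi => ?_⟩
  have := hq i hi
  rw [size_secondHalves hB hi]
  omega

lemma size_halves_add (hB : AllStaged k B) :
    (firstHalves B).size k + (secondHalves B).size k = B.size k := by
  rw [Buckets.size, Buckets.size, Buckets.size, ← Finset.sum_add_distrib]
  refine Finset.sum_congr rfl fun i hi => ?_
  rw [size_firstHalves, size_secondHalves hB (Finset.mem_range.1 hi)]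
  omega

lemma Balanced.two_le_size (h : Balanced k B) (hk : 2 ≤ k) (hN : k ^ 2 < B.size k) {i : ℕ}
    (hi : i < k) : 2 ≤ (B i).size := by
  obtain ⟨q, hq⟩ := h
  have h1 : B.size k ≤ k * (q + 1) := by
    rw [Buckets.size]
    refine (Finset.sum_le_card_nsmul _ _ (q + 1) fun i hi => (hq i (Finset.mem_range.1 hi)).2).trans
      ?_
    simp
  have h2 : k < q + 1 := by
    by_contra hcon
    have := Nat.mul_le_mul_left k (not_lt.1 hcon)
    nlinarith
  have := hq i hi
  omega

lemma size_le_three_mul_halves (hB : AllStaged k B) (h : Balanced k B) (hk : 2 ≤ k)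
    (hN : k ^ 2 < B.size k) :
    B.size k ≤ 3 * (firstHalves B).size k ∧ B.size k ≤ 3 * (secondHalves B).size k := by
  simp only [Buckets.size, Finset.mul_sum]
  refine ⟨Finset.sum_le_sum fun i hi => ?_, Finset.sum_le_sum fun i hi => ?_⟩ <;>
    have hi := Finset.mem_range.1 hi <;> have := h.two_le_size hk hN hi
  · rw [size_firstHalves]
    omega
  · rw [size_secondHalves hB hi]
    omega

/-! ### The number of items that Parallel RoughScatter leaves staged -/

/-- Some bucket `j` is full in the end. If many items are staged, then bucket `j` has received more
than its share of the placed ones, which is unlikely by the weights `tilt k {j}`. -/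
lemma cwp_staged_le (hκ : SeqCost κ) (hS : S.AcceptAtLeast p₀) (hk : 0 < k) {μ : ℝ} (hμ : 0 ≤ μ)
    (hμk : μ * k ≤ 1) (h : ℕ) (hB : AllStaged k B) (hbal : Balanced k B) :
    cwp κ 0 (parRoughScatterAux S k N₀ h B : Comp α Buckets) (fun B' => eexp (μ * B'.staged k)) ≤
      k * eexp (μ * k + μ ^ 2 * (B.size k * k)) := by
  have hk' : (0 : ℝ) < k := by exact_mod_cast hk
  obtain ⟨q, hq⟩ := hbal
  have hsize : B.size k ≤ k * (q + 1) := by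
    rw [Buckets.size]
    refine (Finset.sum_le_card_nsmul _ _ (q + 1) fun i hi => (hq i (Finset.mem_range.1 hi)).2).trans
      ?_
    simp
  have key : ∀ B', Scattered k B B' → eexp (μ * B'.staged k) ≤
      eexp (μ * k + μ ^ 2 * (B.size k * k)) *
        ∑ j ∈ Finset.range k, placedWeight k (tilt k {j} (μ * k)) B' := by
    intro B' hB'
    obtain ⟨j, hj, hfull⟩ := hB'.full
    have hjm : j ∈ Finset.range k := Finset.mem_range.2 hj
    refine le_trans ?_ (mul_le_mul' le_rfl (Finset.single_le_sum
      (f := fun j => placedWeight k (tilt k {j} (μ * k)) B') (fun _ _ => zero_le) hjm))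
    have hA : ({j} : Finset ℕ) ⊆ Finset.range k := by simpa using hj
    simp only [placedWeight]
    rw [prod_tilt_pow hA (μ * k) (fun i => (B' i).placed), ← eexp_add]
    apply eexp_mono
    rw [Finset.sum_singleton, Finset.card_singleton, Nat.cast_one, mul_one]
    have hsum := hB'.valid.sum_placed_add_staged
    rw [hB'.same.total_eq] at hsum
    have hP : (B' j).placed = (B j).size := by
      rw [← hB'.same.size_eq hj, Bucket.placed, Bucket.size, hfull]
    have hsumR : ((∑ i ∈ Finset.range k, (B' i).placed : ℕ) : ℝ) = B.size k - B'.staged k := by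
      rw [← hsum]; push_cast; ring
    have hMR : (B.size k : ℝ) ≤ k * ((B j).size + 1) := by
      have := (hq j hj).1
      exact_mod_cast hsize.trans (Nat.mul_le_mul_left k (by omega))
    rw [hP, hsumR]
    have hLM : (0 : ℝ) ≤ B.size k - B'.staged k := by rw [← hsumR]; positivity
    have hexp : (Real.exp (μ * k) - 1) / k ≤ μ + μ ^ 2 * k := by
      rw [div_le_iff₀ hk']
      refine (exp_sub_one_le (by rwa [abs_of_nonneg (by positivity)])).trans_eq (by ring)
    have h1 := mul_le_mul_of_nonneg_right hexp hLM
    have h2 := mul_le_mul_of_nonneg_left hMR hμ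
    have h3 : 0 ≤ μ ^ 2 * k * B'.staged k := by positivity
    nlinarith
  refine (cwp_mono_of_post ((post_parRoughScatterAux hk h B hB).mono fun B' _ => key B')).trans ?_
  rw [cwp_const_mul, mul_comm]
  gcongr
  refine (cwp_sum_le _ _ _).trans ?_
  refine (Finset.sum_le_sum (g := fun _ => 1) fun j hj => ?_).trans (by simp)
  refine cwp_parRoughScatterAux_placedWeight_le hκ hS hk (sum_tilt_le hk ?_ _) h B hB
  simpa using hj

/-- The number of staged items that the two subtasks leave together. The weights multiply along the
fork, so that the bound for one subtask appears twice. -/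
lemma cwp_staged_forkHalves_le (hκ : SeqCost κ) (hS : S.AcceptAtLeast p₀) (hk : 0 < k) {μ : ℝ}
    (hμ : 0 ≤ μ) (hμk : μ * k ≤ 1) (h : ℕ) (hB : AllStaged k B) (hbal : Balanced k B) :
    cwp κ 0 (forkHalves S k N₀ h B : Comp α (Buckets × Buckets))
        (fun p => eexp (μ * (p.1.staged k + p.2.staged k))) ≤
      eexp (2 * (Real.log k + (μ * k + μ ^ 2 * (B.size k * k)))) := by
  have hk' : (0 : ℝ) < k := by exact_mod_cast hk
  have hadd := size_halves_add hB
  have e1 : (k : ℝ≥0∞) * eexp (μ * k + μ ^ 2 * (B.size k * k)) =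
      eexp (Real.log k + (μ * k + μ ^ 2 * (B.size k * k))) := by
    rw [eexp_add (Real.log k), eexp_log_natCast hk]
  have half : ∀ B', AllStaged k B' → Balanced k B' → B'.size k ≤ B.size k →
      cwp κ 0 (frame (3 * k + 8) (parRoughScatterAux S k N₀ h B') : Comp α Buckets)
        (fun B' => eexp (μ * B'.staged k)) ≤
        eexp (Real.log k + (μ * k + μ ^ 2 * (B.size k * k))) := by
    intro B' hB' hbal' hle
    refine (cwp_frame_le hκ _ _ _).trans ((cwp_staged_le hκ hS hk hμ hμk h hB' hbal').trans ?_)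
    rw [← e1]
    gcongr
    apply eexp_mono
    gcongr
  refine (cwp_zero_fork_le _ _ _).trans ?_
  simp only [mul_add, eexp_add, cwp_const_mul]
  rw [two_mul (Real.log k), two_mul (μ * k), two_mul (μ ^ 2 * _)]
  refine (cwp_mono fun x => mul_le_mul' le_rfl
    (half _ hB.secondHalves (hbal.secondHalves hB) (by omega))).trans ?_
  simp only [mul_comm _ (eexp (Real.log k + _)), cwp_const_mul]
  refine (mul_le_mul' le_rfl
    (half _ (allStaged_firstHalves B) hbal.firstHalves (by omega))).trans_eq ?_
  simp only [eexp_add]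
  ring

/-! ### Depth and work of Parallel RoughScatter -/

lemma four_le_costRate (hS : S.AcceptAtLeast p₀) : 4 ≤ costRate p₀ := by
  have := hS.pos
  rw [costRate]
  linarith [show 0 ≤ 2 / p₀ by positivity]

/-- The largest rate that is used in exponential moments, up to scaling. -/
def rateBound (p₀ : ℝ) : ℝ := 1 / (12 * (costRate p₀ + 2))

lemma rateBound_pos (hS : S.AcceptAtLeast p₀) : 0 < rateBound p₀ := by
  have := four_le_costRate hS
  rw [rateBound]
  positivity

lemma rateBound_le (hS : S.AcceptAtLeast p₀) : rateBound p₀ ≤ p₀ / 2 := by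
  have hp := hS.pos
  have h4 := four_le_costRate hS
  rw [rateBound, div_le_iff₀ (by positivity), costRate]
  have : p₀ * (2 / p₀) = 2 := by field_simp
  nlinarith

lemma rateBound_mul (hS : S.AcceptAtLeast p₀) : 6 * (costRate p₀ + 2) * rateBound p₀ = 1 / 2 := by
  have h4 := four_le_costRate hS
  rw [rateBound]
  field_simp
  norm_num

lemma rateBound_le' (hS : S.AcceptAtLeast p₀) : rateBound p₀ ≤ 1 / 72 := by
  have h4 := four_le_costRate hS
  rw [rateBound]
  apply one_div_le_one_div_of_le <;> linarith

lemma half_le_log {k : ℕ} (hk : 2 ≤ k) : 1 / 2 ≤ Real.log k := by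
  have h2 : Real.log 2 ≤ Real.log k := Real.log_le_log (by norm_num) (by exact_mod_cast hk)
  have := Real.log_two_gt_d9
  linarith

/-- A task of the recursion that is not split. -/
lemma cwp_leaf_le (hκ : SeqCost κ) (hS : S.AcceptAtLeast p₀) (hk : 0 < k) (hB : AllStaged k B)
    (hl : 0 ≤ l) (hl' : l ≤ p₀ / 2) :
    eexp (l * (k + 1)) * cwp κ l (roughScatter S k B : Comp α Buckets) (fun _ => 1) ≤
      eexp (l * (2 * k + 2 + costRate p₀ * B.size k)) := by
  have := cwp_roughScatter_le (α := α) hκ hS hl hl' hk (y := fun _ => 1) (by simp) B hB.valid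
  rw [placedWeight_const_one, hB.staged_eq, mul_one] at this
  refine (mul_le_mul' le_rfl this).trans ?_
  rw [← eexp_add]
  apply eexp_mono
  apply le_of_eq
  ring

lemma rate_le_of_sq_le {M : ℝ} (hS : S.AcceptAtLeast p₀) (hk : 2 ≤ k) (hM : 1 ≤ M)
    (hrate : l ^ 2 * (M * k) ≤ rateBound p₀ ^ 2 * Real.log k) : l ≤ rateBound p₀ := by
  have hε := rateBound_pos hS
  have hk2 : (2 : ℝ) ≤ k := by exact_mod_cast hk
  have hlogk : Real.log k ≤ k := (Real.log_le_sub_one_of_pos (by linarith)).trans (by linarith)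
  refine le_of_sq_le_sq ?_ hε.le
  have h1 : l ^ 2 * k ≤ rateBound p₀ ^ 2 * k := by
    calc l ^ 2 * k ≤ l ^ 2 * (M * k) := by
          gcongr
          exact le_mul_of_one_le_left (by positivity) hM
      _ ≤ _ := hrate
      _ ≤ _ := by gcongr
  exact le_of_mul_le_mul_right h1 (by linarith)

/-- The depth of Parallel RoughScatter, apart from the base cases, has bounded exponential moments
at the rate that belongs to the typical number of staged items. -/
lemma cwp_span_parRoughScatterAux_le (hS : S.AcceptAtLeast p₀) (hk : 2 ≤ k) (hN : k ^ 2 ≤ N₀)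
    (h : ℕ) (hB : AllStaged k B) (hbal : Balanced k B) (hl : 0 ≤ l) (hM : k ^ 2 ≤ 3 * B.size k)
    (hh : B.size k ≤ N₀ + h)
    (hrate : l ^ 2 * (B.size k * k) ≤ rateBound p₀ ^ 2 * Real.log k) :
    cwp Exec.span l (parRoughScatterAux S k N₀ h B : Comp α Buckets) (fun _ => 1) ≤
      eexp (14 * Real.log k + l * ((costRate p₀ + 2) * N₀)) := by
  have hg := four_le_costRate hS
  have hε := rateBound_pos hS
  have hε2 := rateBound_le' hS
  have hk2 : (2 : ℝ) ≤ k := by exact_mod_cast hk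
  have hlogk : Real.log k ≤ k := (Real.log_le_sub_one_of_pos (by linarith)).trans (by linarith)
  have hlog2 := half_le_log hk
  have hNk : (k : ℝ) ^ 2 ≤ N₀ := by exact_mod_cast hN
  induction h generalizing B l with
  | zero =>
    have hM1 : (1 : ℝ) ≤ B.size k := by
      have : 0 < B.size k := by nlinarith
      exact_mod_cast this
    have hl' := (rate_le_of_sq_le hS hk hM1 hrate).trans (rateBound_le hS)
    rw [parRoughScatterAux]
    refine le_trans (le_mul_of_one_le_left' (one_le_eexp (by positivity)))
      ((cwp_leaf_le (κ := Exec.span) seqCost_span hS (by omega) hB hl hl').trans (eexp_mono ?_))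
    have hle' : (B.size k : ℝ) ≤ N₀ := by exact_mod_cast hh
    have h1 : l * (2 * k + 2 + costRate p₀ * B.size k) ≤ l * ((costRate p₀ + 2) * N₀) := by
      refine mul_le_mul_of_nonneg_left ?_ hl
      have : costRate p₀ * B.size k ≤ costRate p₀ * N₀ := by gcongr
      nlinarith
    linarith
  | succ h ih =>
    have hM1 : (1 : ℝ) ≤ B.size k := by
      have : 0 < B.size k := by nlinarith
      exact_mod_cast this
    have hl' := (rate_le_of_sq_le hS hk hM1 hrate).trans (rateBound_le hS)
    by_cases hle : B.size k ≤ N₀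
    · rw [parRoughScatterAux_succ]
      refine (cwp_tick_bind_le seqCost_span _ _ _).trans ?_
      rw [if_pos hle]
      push_cast
      refine (cwp_leaf_le (κ := Exec.span) seqCost_span hS (by omega) hB hl hl').trans (eexp_mono ?_)
      have hle' : (B.size k : ℝ) ≤ N₀ := by exact_mod_cast hle
      have h1 : l * (2 * k + 2 + costRate p₀ * B.size k) ≤ l * ((costRate p₀ + 2) * N₀) := by
        refine mul_le_mul_of_nonneg_left ?_ hl
        have : costRate p₀ * B.size k ≤ costRate p₀ * N₀ := by gcongr
        nlinarith
      linarith
    have hlt := not_le.1 hle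
    have hsq : k ^ 2 < B.size k := hN.trans_lt hlt
    have h3 := size_le_three_mul_halves hB hbal hk hsq
    have hadd := size_halves_add hB
    have hsqR : (k : ℝ) ^ 2 ≤ B.size k := by exact_mod_cast hsq.le
    have hlε := rate_le_of_sq_le hS hk hM1 hrate
    have hlk : l * k ≤ rateBound p₀ := by
      refine le_of_sq_le_sq ?_ hε.le
      have h1 : (l * k) ^ 2 * k ≤ rateBound p₀ ^ 2 * k := by
        calc (l * k) ^ 2 * k = l ^ 2 * (k ^ 2 * k) := by ring
          _ ≤ l ^ 2 * (B.size k * k) := by gcongr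
          _ ≤ _ := hrate
          _ ≤ _ := by gcongr
      exact le_of_mul_le_mul_right h1 (by linarith)
    have step := cwp_parRoughScatterAux_succ_le (α := α) seqCost_span hS hl hl' (by omega)
      (y := fun _ => 1) (by simp) h B hB hlt
    simp only [placedWeight_const_one, mul_one] at step
    refine step.trans ?_
    -- The subtasks at the rate `6 / 5 * l`.
    have child : ∀ B', AllStaged k B' → Balanced k B' → B.size k ≤ 3 * B'.size k →
        3 * B'.size k ≤ 2 * B.size k → cwp Exec.span (6 / 5 * l)
          (frame (3 * k + 8) (parRoughScatterAux S k N₀ h B') : Comp α Buckets) (fun _ => 1) ≤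
        eexp (14 * Real.log k + 6 / 5 * l * ((costRate p₀ + 2) * N₀)) := by
      intro B' hB' hbal' hge hle'
      refine (cwp_frame_le seqCost_span _ _ _).trans
        (ih hB' hbal' (by positivity) (by omega) (by omega) ?_)
      have h5 : (3 : ℝ) * B'.size k ≤ 2 * B.size k := by exact_mod_cast hle'
      calc (6 / 5 * l) ^ 2 * (B'.size k * k) =
            l ^ 2 * (36 / 75 * (3 * B'.size k) * k) := by ring
        _ ≤ l ^ 2 * (36 / 75 * (2 * B.size k) * k) := by gcongr
        _ ≤ l ^ 2 * (B.size k * k) := by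
          gcongr
          linarith
        _ ≤ _ := hrate
    have hsub : wp (forkHalves S k N₀ h B : Comp α (Buckets × Buckets))
        (fun _ e => eexp (6 / 5 * l * e.span)) ≤
        eexp (6 / 5 * l + (Real.log (2 : ℕ) +
          (14 * Real.log k + 6 / 5 * l * ((costRate p₀ + 2) * N₀)))) := by
      have := cwp_span_fork_le (l := 6 / 5 * l)
        (frame (3 * k + 8) (parRoughScatterAux S k N₀ h (firstHalves B)) : Comp α Buckets)
        (frame (3 * k + 8) (parRoughScatterAux S k N₀ h (secondHalves B)))
      simp only [cwp, mul_one] at this child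
      refine this.trans ?_
      rw [eexp_add, eexp_add (Real.log (2 : ℕ)), eexp_log_natCast two_pos]
      gcongr
      rw [Nat.cast_two, two_mul]
      exact add_le_add (child _ (allStaged_firstHalves B) hbal.firstHalves h3.1 (by omega))
        (child _ hB.secondHalves (hbal.secondHalves hB) h3.2 (by omega))
    -- The staged items that the subtasks leave.
    have hrate2 : 6 * (costRate p₀ + 2) * l * k ≤ 1 / 2 := by
      rw [← rateBound_mul hS, mul_assoc]
      gcongr
    have hleft := cwp_staged_forkHalves_le (α := α) (N₀ := N₀) seqCost_span hS (by omega)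
      (μ := 6 * (costRate p₀ + 2) * l) (by positivity) (hrate2.trans (by norm_num)) h hB hbal
    rw [cwp_zero] at hleft
    have hvar : (6 * (costRate p₀ + 2) * l) ^ 2 * (B.size k * k) ≤ 1 / 4 * Real.log k := by
      calc (6 * (costRate p₀ + 2) * l) ^ 2 * (B.size k * k)
          = (6 * (costRate p₀ + 2)) ^ 2 * (l ^ 2 * (B.size k * k)) := by ring
        _ ≤ (6 * (costRate p₀ + 2)) ^ 2 * (rateBound p₀ ^ 2 * Real.log k) := by gcongr
        _ = (6 * (costRate p₀ + 2) * rateBound p₀) ^ 2 * Real.log k := by ring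
        _ = _ := by rw [rateBound_mul hS]; norm_num
    have hrest : wp (forkHalves S k N₀ h B : Comp α (Buckets × Buckets))
        (fun p _ => eexp (6 * (l * (14 * k + (costRate p₀ + 2) * (p.1.staged k + p.2.staged k)))))
        ≤ eexp (8 * Real.log k) := by
      have e2 : ∀ p : Buckets × Buckets,
          6 * (l * (14 * k + (costRate p₀ + 2) * (p.1.staged k + p.2.staged k))) =
          84 * (l * k) + 6 * (costRate p₀ + 2) * l * (p.1.staged k + p.2.staged k) :=
        fun p => by ring
      simp only [e2, eexp_add (84 * _), wp_const_mul]
      refine (mul_le_mul' le_rfl hleft).trans ?_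
      rw [← eexp_add]
      apply eexp_mono
      linarith
    have := wp_eexp_convex_two_le _ (v := 5 / 6) (w := 1 / 6) (by norm_num) (by norm_num)
      (by norm_num) hsub hrest
    refine le_trans (wp_mono fun p e => ?_) (this.trans (eexp_mono ?_))
    · rw [← eexp_add]
      apply eexp_mono
      apply le_of_eq
      ring
    · have h6 : Real.log (2 : ℕ) ≤ Real.log k :=
        Real.log_le_log (by norm_num) (by exact_mod_cast hk)
      generalize Real.log (2 : ℕ) = x at h6 ⊢
      generalize Real.log k = z at h6 hlog2 ⊢
      have h7 : 6 / 5 * l * ((costRate p₀ + 2) * N₀) = 6 / 5 * (l * ((costRate p₀ + 2) * N₀)) := by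
        ring
      rw [h7]
      linarith

/-- The coefficient of `k * √M` that the induction for the work of Parallel RoughScatter gains. -/
def workGain (p₀ : ℝ) : ℝ := 28 * (costRate p₀ + 4)

/-- The work of Parallel RoughScatter is linear, up to exponential moments. The sum over a level of
the recursion of the numbers of staged items is of the order `k * √(m * 2 ^ h)` on level `h`, so
that subtracting a multiple of `k * √M` makes the induction work. -/
lemma cwp_work_parRoughScatterAux_le (hS : S.AcceptAtLeast p₀) (hk : 2 ≤ k) (hN : k ^ 2 ≤ N₀)
    (h : ℕ) (hB : AllStaged k B) (hbal : Balanced k B) (hl : 0 ≤ l) (hM : k ^ 2 ≤ 3 * B.size k)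
    (hh : B.size k ≤ N₀ + h)
    (hrate : l ^ 2 * B.size k ≤ rateBound p₀ ^ 2) :
    cwp Exec.work l (parRoughScatterAux S k N₀ h B : Comp α Buckets) (fun _ => 1) ≤
      eexp (l * ((costRate p₀ + 6 + 2 * workGain p₀) * B.size k -
        workGain p₀ * (k * √(B.size k)))) := by
  have hg := four_le_costRate hS
  have hε := rateBound_pos hS
  have hk2 : (2 : ℝ) ≤ k := by exact_mod_cast hk
  have hD : 0 ≤ workGain p₀ := by rw [workGain]; positivity
  have facts : ∀ (B' : Buckets) (l' : ℝ), 0 ≤ l' → k ^ 2 ≤ 3 * B'.size k →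
      l' ^ 2 * B'.size k ≤ rateBound p₀ ^ 2 →
      l' ≤ p₀ / 2 ∧ l' * (2 * k + 2 + costRate p₀ * B'.size k) ≤
        l' * ((costRate p₀ + 6 + 2 * workGain p₀) * B'.size k -
          workGain p₀ * (k * √(B'.size k))) := by
    intro B' l' hl' hM' hr'
    have hM1 : (1 : ℝ) ≤ B'.size k := by
      have : 0 < B'.size k := by nlinarith
      exact_mod_cast this
    have hMR : (k : ℝ) ^ 2 ≤ 3 * B'.size k := by exact_mod_cast hM'
    have hs0 := Real.sqrt_nonneg (B'.size k : ℝ)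
    have hss := Real.mul_self_sqrt (show (0 : ℝ) ≤ B'.size k by linarith)
    have hs1 : 1 ≤ √(B'.size k : ℝ) := Real.one_le_sqrt.2 hM1
    have hks : (k : ℝ) ≤ 2 * √(B'.size k) := by nlinarith
    refine ⟨(le_of_sq_le_sq ?_ hε.le).trans (rateBound_le hS), mul_le_mul_of_nonneg_left ?_ hl'⟩
    · exact (le_mul_of_one_le_right (by positivity) hM1).trans hr'
    · have h1 : (k : ℝ) * √(B'.size k) ≤ 2 * B'.size k := by nlinarith
      have h2 := mul_le_mul_of_nonneg_left h1 hD
      nlinarith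
  induction h generalizing B l with
  | zero =>
    obtain ⟨hl', hbase⟩ := facts B l hl hM hrate
    rw [parRoughScatterAux]
    exact le_trans (le_mul_of_one_le_left' (one_le_eexp (by positivity)))
      ((cwp_leaf_le (κ := Exec.work) seqCost_work hS (by omega) hB hl hl').trans (eexp_mono hbase))
  | succ h ih =>
    obtain ⟨hl', hbase⟩ := facts B l hl hM hrate
    by_cases hle : B.size k ≤ N₀
    · rw [parRoughScatterAux_succ]
      refine (cwp_tick_bind_le seqCost_work _ _ _).trans ?_
      rw [if_pos hle]
      push_cast
      exact (cwp_leaf_le (κ := Exec.work) seqCost_work hS (by omega) hB hl hl').trans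
        (eexp_mono hbase)
    have hlt := not_le.1 hle
    have hsq : k ^ 2 < B.size k := hN.trans_lt hlt
    have h3 := size_le_three_mul_halves hB hbal hk hsq
    have hadd := size_halves_add hB
    have hsqR : (k : ℝ) ^ 2 ≤ B.size k := by exact_mod_cast hsq.le
    have hM0 : (0 : ℝ) < B.size k := by nlinarith
    set r := √(B.size k : ℝ) with hr
    have hrr : r * r = B.size k := Real.mul_self_sqrt hM0.le
    have hr0 : 0 < r := Real.sqrt_pos.2 hM0
    have hkr : (k : ℝ) ≤ r := Real.le_sqrt_of_sq_le hsqR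
    have hlr : l * r ≤ rateBound p₀ := by
      refine le_of_sq_le_sq ?_ hε.le
      calc (l * r) ^ 2 = l ^ 2 * (r * r) := by ring
        _ ≤ _ := by rw [hrr]; exact hrate
    have step := cwp_parRoughScatterAux_succ_le (α := α) seqCost_work hS hl hl' (by omega)
      (y := fun _ => 1) (by simp) h B hB hlt
    simp only [placedWeight_const_one, mul_one] at step
    refine step.trans ?_
    set f : Buckets → ℝ := fun B => (costRate p₀ + 6 + 2 * workGain p₀) * B.size k -
        workGain p₀ * (k * √(B.size k)) with hf
    -- The subtasks at the rate `6 / 5 * l`.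
    have child : ∀ B', AllStaged k B' → Balanced k B' → B.size k ≤ 3 * B'.size k →
        3 * B'.size k ≤ 2 * B.size k → cwp Exec.work (6 / 5 * l)
          (frame (3 * k + 8) (parRoughScatterAux S k N₀ h B') : Comp α Buckets) (fun _ => 1) ≤
        eexp (6 / 5 * l * f B') := by
      intro B' hB' hbal' hge hle'
      refine (cwp_frame_le seqCost_work _ _ _).trans
        (ih hB' hbal' (by positivity) (by omega) (by omega) ?_)
      have h5 : (3 : ℝ) * B'.size k ≤ 2 * B.size k := by exact_mod_cast hle'
      calc (6 / 5 * l) ^ 2 * (B'.size k : ℝ) = l ^ 2 * (36 / 75 * (3 * B'.size k)) := by ring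
        _ ≤ l ^ 2 * (36 / 75 * (2 * B.size k)) := by gcongr
        _ ≤ l ^ 2 * B.size k := by
          gcongr
          linarith
        _ ≤ _ := hrate
    have hsub : wp (forkHalves S k N₀ h B : Comp α (Buckets × Buckets))
        (fun _ e => eexp (6 / 5 * l * e.work)) ≤
        eexp (6 / 5 * l + (6 / 5 * l * f (firstHalves B) + 6 / 5 * l * f (secondHalves B))) := by
      have h6 := cwp_work_fork_le (l := 6 / 5 * l)
        (frame (3 * k + 8) (parRoughScatterAux S k N₀ h (firstHalves B)) : Comp α Buckets)
        (frame (3 * k + 8) (parRoughScatterAux S k N₀ h (secondHalves B))) (fun _ => 1)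
      have h7 := child _ (allStaged_firstHalves B) hbal.firstHalves h3.1 (by omega)
      have h8 := child _ hB.secondHalves (hbal.secondHalves hB) h3.2 (by omega)
      rw [show (fun _ _ => eexp _ : Buckets × Buckets → Exec → ℝ≥0∞) =
        fun _ e => eexp (6 / 5 * l * e.work) * 1 by simp]
      refine h6.trans ?_
      rw [eexp_add, eexp_add]
      gcongr
      refine (cwp_mono fun x => h8.trans_eq (mul_one _).symm).trans ?_
      rw [cwp_const_mul, mul_comm]
      gcongr
    -- The staged items that the subtasks leave.
    have hleft := cwp_staged_forkHalves_le (α := α) (N₀ := N₀) seqCost_work hS (by omega)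
      (μ := 1 / r) (by positivity) (by rw [one_div_mul_eq_div, div_le_one hr0]; exact hkr) h hB hbal
    rw [cwp_zero] at hleft
    have hleft' : wp (forkHalves S k N₀ h B : Comp α (Buckets × Buckets))
        (fun p _ => eexp (1 / r * (p.1.staged k + p.2.staged k))) ≤ eexp (4 * k) := by
      refine hleft.trans (eexp_mono ?_)
      have h9 : (1 / r) ^ 2 * (B.size k * k) = k := by
        rw [← hrr]
        field_simp
      have h10 : 1 / r * k ≤ 1 := by rw [one_div_mul_eq_div, div_le_one hr0]; exact hkr
      have h11 := Real.log_le_sub_one_of_pos (show (0 : ℝ) < k by linarith)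
      rw [h9]
      linarith
    have hθ : 6 * (costRate p₀ + 2) * l * r ≤ 1 := by
      have : 6 * (costRate p₀ + 2) * (l * r) ≤ 6 * (costRate p₀ + 2) * rateBound p₀ := by gcongr
      rw [rateBound_mul hS] at this
      linarith
    have hrest : wp (forkHalves S k N₀ h B : Comp α (Buckets × Buckets))
        (fun p _ => eexp (6 * (l * (14 * k + (costRate p₀ + 2) * (p.1.staged k + p.2.staged k)))))
        ≤ eexp (84 * (l * k) + 6 * (costRate p₀ + 2) * l * r * (4 * k)) := by
      have e2 : ∀ p : Buckets × Buckets,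
          6 * (l * (14 * k + (costRate p₀ + 2) * (p.1.staged k + p.2.staged k))) =
          84 * (l * k) + 6 * (costRate p₀ + 2) * l * r *
            (1 / r * (p.1.staged k + p.2.staged k)) :=
        fun p => by field_simp; ring
      simp only [e2, eexp_add (84 * _), wp_const_mul]
      gcongr
      exact wp_eexp_mul_le _ (by positivity) hθ hleft'
    have := wp_eexp_convex_two_le _ (v := 5 / 6) (w := 1 / 6) (by norm_num) (by norm_num)
      (by norm_num) hsub hrest
    refine le_trans (wp_mono fun p e => ?_) (this.trans (eexp_mono ?_))
    · rw [← eexp_add]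
      apply eexp_mono
      apply le_of_eq
      ring
    · have hhalf : ∀ x : ℕ, B.size k ≤ 3 * x → 0.575 * r ≤ √(x : ℝ) := by
        intro x hx
        have hxR : (B.size k : ℝ) ≤ 3 * x := by exact_mod_cast hx
        refine Real.le_sqrt_of_sq_le ?_
        nlinarith
      have h12 := hhalf _ h3.1
      have h13 := hhalf _ h3.2
      have haddR : ((firstHalves B).size k : ℝ) + (secondHalves B).size k = B.size k := by
        exact_mod_cast hadd
      have h14 : 1 + f (firstHalves B) + f (secondHalves B) + 14 * k + (costRate p₀ + 2) * r * (4 * k)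
          ≤ f B := by
        simp only [hf]
        have h15 : workGain p₀ * (k * (0.575 * r + 0.575 * r)) ≤ workGain p₀ *
            (k * (√((firstHalves B).size k : ℝ) + √((secondHalves B).size k : ℝ))) := by gcongr
        have h16 : (costRate p₀ + 6 + 2 * workGain p₀) * ((firstHalves B).size k : ℝ) +
            (costRate p₀ + 6 + 2 * workGain p₀) * ((secondHalves B).size k : ℝ) =
            (costRate p₀ + 6 + 2 * workGain p₀) * B.size k := by rw [← mul_add, haddR]
        have h17 : workGain p₀ * (k * (0.15 * r)) = (4.2 * costRate p₀ + 16.8) * (k * r) := by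
          rw [workGain]; ring
        have h18 : 2 * (k : ℝ) ≤ k * r := by nlinarith
        have h19 : 0 ≤ costRate p₀ * (k * r) := by positivity
        rw [← hr]
        nlinarith
      have := mul_le_mul_of_nonneg_left h14 hl
      linarith

end ScatterShuffle

namespace ForkJoin.Comp

variable {α : Type u} {β γ : Type} {κ : Exec → ℕ} {l : ℝ}

/-! ### Parallel loops -/

lemma parLoop_zero (lo : ℕ) (f : ℕ → Comp α Unit) : parLoop lo 0 f = tick 1 := by
  rw [parLoop, if_pos rfl]

lemma parLoop_one (lo : ℕ) (f : ℕ → Comp α Unit) :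
    parLoop lo 1 f = tick 1 >>= fun _ => f lo := by
  rw [parLoop, if_neg one_ne_zero, if_pos rfl]

lemma parLoop_of_two_le {len : ℕ} (h : 2 ≤ len) (lo : ℕ) (f : ℕ → Comp α Unit) :
    parLoop lo len f = tick 1 >>= fun _ =>
      fork (frame 4 (parLoop lo (len / 2) f))
        (frame 4 (parLoop (lo + len / 2) (len - len / 2) f)) >>= fun _ => pure () := by
  rw [parLoop, if_neg (by omega), if_neg (by omega)]

/-- The two halves of the range of a parallel loop. -/
lemma sum_Ico_halves {M : Type*} [AddCommMonoid M] (lo len : ℕ) (w : ℕ → M) :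
    ∑ i ∈ Finset.Ico lo (lo + len / 2), w i +
      ∑ i ∈ Finset.Ico (lo + len / 2) (lo + len / 2 + (len - len / 2)), w i =
    ∑ i ∈ Finset.Ico lo (lo + len), w i := by
  rw [Finset.sum_Ico_consecutive _ (by omega) (by omega)]
  congr 2
  omega

lemma post_parLoop {lo len : ℕ} (hlen : 1 ≤ len) {f : ℕ → Comp α Unit} {s : ℕ} {w : ℕ → ℕ}
    (h : ∀ i, lo ≤ i → i < lo + len → Post (f i) fun _ e => e.span ≤ s ∧ e.work ≤ w i) :
    Post (parLoop lo len f) fun _ e => e.span ≤ 3 * len + s ∧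
      e.work + 2 ≤ 3 * len + ∑ i ∈ Finset.Ico lo (lo + len), w i := by
  induction len using Nat.strong_induction_on generalizing lo with
  | _ len ih =>
    rcases hlen.eq_or_lt with rfl | h2
    · rw [parLoop_one]
      refine (post_tick (Q := fun _ e => e = .steps 1) rfl).bind fun _ e he =>
        (h lo le_rfl (by omega)).mono fun _ e' he' => ?_
      subst he
      simp only [Exec.steps, Exec.span, Exec.work, Nat.Ico_succ_singleton, Finset.sum_singleton]
      omega
    · rw [parLoop_of_two_le h2]
      refine (post_tick (Q := fun _ e => e = .steps 1) rfl).bind fun _ e he => ?_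
      subst he
      have h1 : Post (frame 4 (parLoop lo (len / 2) f)) fun _ e => e.span ≤ 3 * (len / 2) + s ∧
          e.work + 2 ≤ 3 * (len / 2) + ∑ i ∈ Finset.Ico lo (lo + len / 2), w i :=
        Post.frame (ih (len / 2) (by omega) (by omega) fun i hi hi' => h i hi (by omega))
      have h2 : Post (frame 4 (parLoop (lo + len / 2) (len - len / 2) f)) fun _ e =>
          e.span ≤ 3 * (len - len / 2) + s ∧ e.work + 2 ≤ 3 * (len - len / 2) +
            ∑ i ∈ Finset.Ico (lo + len / 2) (lo + len / 2 + (len - len / 2)), w i :=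
        Post.frame (ih (len - len / 2) (by omega) (by omega) fun i hi hi' =>
          h i (by omega) (by omega))
      refine (Post.fork (Q := fun _ e => e.span + 2 ≤ 3 * len + s ∧
          e.work + 3 ≤ 3 * len + ∑ i ∈ Finset.Ico lo (lo + len), w i) h1 h2 ?_).bind
        fun _ e he => post_pure ?_
      · intro _ e _ e' h1 h2
        have hs := sum_Ico_halves lo len w
        simp only [Exec.span, Exec.work] at h1 h2 ⊢
        omega
      · simp only [Exec.steps, Exec.span, Exec.work]
        omega

lemma pnone_parLoop_le (lo len : ℕ) (f : ℕ → Comp α Unit) :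
    pnone (parLoop lo len f) ≤ ∑ i ∈ Finset.Ico lo (lo + len), pnone (f i) := by
  induction len using Nat.strong_induction_on generalizing lo with
  | _ len ih =>
    rcases Nat.lt_or_ge len 2 with h2 | h2
    · interval_cases len
      · rw [parLoop_zero, pnone_tick]
        exact zero_le
      · rw [parLoop_one]
        refine (pnone_bind_le _ _).trans ?_
        rw [pnone_tick, zero_add]
        simpa using wp_const_le _ _
    · rw [parLoop_of_two_le h2]
      refine (pnone_bind_le _ _).trans ?_
      rw [pnone_tick, zero_add]
      refine (wp_const_le _ _).trans ((pnone_bind_le _ _).trans ?_)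
      simp only [pnone_pure, wp_zero, add_zero]
      refine (pnone_fork_le _ _).trans ?_
      rw [← sum_Ico_halves]
      exact add_le_add ((pnone_frame _ _).trans (ih _ (by omega) _))
        ((pnone_frame _ _).trans (ih _ (by omega) _))

end ForkJoin.Comp

namespace ScatterShuffle
open ForkJoin ForkJoin.Comp

variable {α : Type u} {κ : Exec → ℕ} {l p₀ : ℝ} {S : Samplers} {k N₀ : ℕ} {B : Buckets}

/-! ### Multinomial variates -/

lemma ofReal_invProb (d : ℕ) :
    ENNReal.ofReal (invProb (d + 1) : ℝ) = ((d + 1 : ℕ) : ℝ≥0∞)⁻¹ ∧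
      ENNReal.ofReal (1 - (invProb (d + 1) : ℝ)) = d * ((d + 1 : ℕ) : ℝ≥0∞)⁻¹ := by
  have hd : (0 : ℝ) < (d + 1 : ℕ) := by positivity
  have h1 : ENNReal.ofReal (invProb (d + 1) : ℝ) = ((d + 1 : ℕ) : ℝ≥0∞)⁻¹ := by
    rw [invProb, ENNReal.ofReal_inv_of_pos hd, ENNReal.ofReal_natCast]
  refine ⟨h1, ?_⟩
  have : 1 - (invProb (d + 1) : ℝ) = d * ((d + 1 : ℕ) : ℝ)⁻¹ := by
    simp only [invProb]
    field_simp
    push_cast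
    ring
  rw [this, ENNReal.ofReal_mul (by positivity), ENNReal.ofReal_natCast,
    ENNReal.ofReal_inv_of_pos hd, ENNReal.ofReal_natCast]

lemma post_multinomial (d R : ℕ) (N : ℕ → ℕ) (hd : d ≤ k) (hR : d = 0 → R = 0) :
    Post (multinomial S k d R N : Comp α (ℕ → ℕ)) fun N' _ =>
      ∑ i ∈ Finset.range k, N' i = ∑ i ∈ Finset.range (k - d), N i + R := by
  induction d generalizing R N with
  | zero =>
    rw [multinomial]
    exact post_pure (by simp [hR rfl])
  | succ d ih =>
    rw [multinomial]
    refine post_binomial.bind fun x _ hx => (post_tick (Q := fun _ _ => True) trivial).bind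
      fun _ _ _ => (ih _ _ (by omega) fun hd0 => ?_).mono fun N' _ hN' => ?_
    · have := hx.2 (by simp [invProb, hd0])
      omega
    · rw [hN', show k - d = k - (d + 1) + 1 by omega, Finset.sum_range_succ, Function.update_self]
      have : ∑ i ∈ Finset.range (k - (d + 1)), Function.update N (k - (d + 1)) x i =
          ∑ i ∈ Finset.range (k - (d + 1)), N i :=
        Finset.sum_congr rfl fun i hi =>
          Function.update_of_ne (Finset.mem_range.1 hi).ne _ _
      have := hx.1
      omega

lemma cwp_multinomial_le (hκ : SeqCost κ) (hS : S.AcceptAtLeast p₀) (hl : 0 ≤ l) (hl' : l ≤ p₀ / 2)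
    (y : ℕ → ℝ≥0∞) (z : ℝ≥0∞) (d R : ℕ) (N : ℕ → ℕ) (hd : d ≤ k) (hR : d = 0 → R = 0)
    (hz : ∑ i ∈ Finset.Ico (k - d) k, y i ≤ d * z) :
    cwp κ l (multinomial S k d R N : Comp α (ℕ → ℕ)) (fun N' => ∏ i ∈ Finset.range k, y i ^ N' i) ≤
      eexp (l * (costRate p₀ * d)) * ((∏ i ∈ Finset.range (k - d), y i ^ N i) * z ^ R) := by
  induction d generalizing R N z with
  | zero =>
    rw [multinomial]
    refine (cwp_pure_le hκ _ _).trans ?_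
    simp [hR rfl, eexp_zero]
  | succ d ih =>
    rw [multinomial]
    refine (cwp_bind_le hκ _ _ _).trans ?_
    set z' : ℝ≥0∞ := (∑ i ∈ Finset.Ico (k - d) k, y i) / d with hz'
    have hdz : d * z' = ∑ i ∈ Finset.Ico (k - d) k, y i := by
      rcases Nat.eq_zero_or_pos d with rfl | hpos
      · simp
      · exact ENNReal.mul_div_cancel (by exact_mod_cast hpos.ne') (ENNReal.natCast_ne_top d)
    have hkd : k - d = k - (d + 1) + 1 := by omega
    set P := ∏ i ∈ Finset.range (k - (d + 1)), y i ^ N i with hP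
    have inner : ∀ x, x ≤ R ∧ (((invProb (d + 1) : I) : ℝ) = 1 → x = R) →
        cwp κ l (tick 3 >>= fun _ => (multinomial S k d (R - x)
          (Function.update N (k - (d + 1)) x) : Comp α (ℕ → ℕ)))
          (fun N' => ∏ i ∈ Finset.range k, y i ^ N' i) ≤
        eexp (l * 3) * (eexp (l * (costRate p₀ * d)) * P) *
          (y (k - (d + 1)) ^ x * z' ^ (R - x)) := by
      intro x hx
      refine (cwp_tick_bind_le hκ _ _ _).trans ?_
      refine (mul_le_mul' le_rfl (ih z' (R - x) _ (by omega) (fun hd0 => ?_) hdz.ge)).trans_eq ?_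
      · have := hx.2 (by simp [invProb, hd0])
        omega
      · rw [hkd, Finset.prod_range_succ, Function.update_self]
        have : ∏ i ∈ Finset.range (k - (d + 1)), y i ^ Function.update N (k - (d + 1)) x i = P :=
          Finset.prod_congr rfl fun i hi => by
            rw [Function.update_of_ne (Finset.mem_range.1 hi).ne]
        rw [this]
        push_cast
        ring
    refine (cwp_mono_of_post (post_binomial.mono fun x _ hx => inner x hx)).trans ?_
    rw [cwp_const_mul]
    refine (mul_le_mul' le_rfl (cwp_binomial_le hκ hS hl hl' R _ _ _)).trans ?_
    have hq : ENNReal.ofReal (invProb (d + 1) : ℝ) * y (k - (d + 1)) +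
        ENNReal.ofReal (1 - (invProb (d + 1) : ℝ)) * z' ≤ z := by
      rw [(ofReal_invProb d).1, (ofReal_invProb d).2]
      calc ((d + 1 : ℕ) : ℝ≥0∞)⁻¹ * y (k - (d + 1)) + d * ((d + 1 : ℕ) : ℝ≥0∞)⁻¹ * z'
          = ((d + 1 : ℕ) : ℝ≥0∞)⁻¹ * (y (k - (d + 1)) + d * z') := by ring
        _ = ((d + 1 : ℕ) : ℝ≥0∞)⁻¹ * ∑ i ∈ Finset.Ico (k - (d + 1)) k, y i := by
          rw [hdz, hkd, ← Finset.sum_eq_sum_Ico_succ_bot (by omega)]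
        _ ≤ ((d + 1 : ℕ) : ℝ≥0∞)⁻¹ * ((d + 1 : ℕ) * z) := by gcongr
        _ = z := by
          rw [← mul_assoc, ENNReal.inv_mul_cancel (by simp) (ENNReal.natCast_ne_top _), one_mul]
    calc _ ≤ eexp (l * 3) * (eexp (l * (costRate p₀ * d)) * P) * (eexp (2 / p₀ * l) * z ^ R) := by
          gcongr
      _ = (eexp (l * 3) * eexp (l * (costRate p₀ * d)) * eexp (2 / p₀ * l)) * (P * z ^ R) := by ring
      _ ≤ _ := by
          rw [← eexp_add, ← eexp_add]
          gcongr
          apply eexp_mono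
          rw [show l * (costRate p₀ * (d + 1 : ℕ)) =
            l * (costRate p₀ * d) + (2 / p₀ * l + 4 * l) by push_cast; rw [costRate]; ring]
          linarith

/-- Weights with average at most one have mean at most one under the multinomial distribution. -/
lemma cwp_multinomial_prod_le (hκ : SeqCost κ) (hS : S.AcceptAtLeast p₀) (hl : 0 ≤ l)
    (hl' : l ≤ p₀ / 2) (hk : 0 < k) {y : ℕ → ℝ≥0∞} (hy : ∑ i ∈ Finset.range k, y i ≤ k) (R : ℕ) :
    cwp κ l (multinomial S k k R (fun _ => 0) : Comp α (ℕ → ℕ))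
      (fun N => ∏ i ∈ Finset.range k, y i ^ N i) ≤ eexp (l * (costRate p₀ * k)) := by
  refine (cwp_multinomial_le hκ hS hl hl' y 1 k R _ le_rfl (by omega) ?_).trans (by simp)
  simpa using hy

lemma pnone_multinomial (d R : ℕ) (N : ℕ → ℕ) :
    pnone (multinomial S k d R N : Comp α (ℕ → ℕ)) = 0 := by
  induction d generalizing R N with
  | zero => exact pnone_pure _
  | succ d ih =>
    rw [multinomial]
    exact pnone_bind_eq_zero (pnone_rejection _ _) fun _ => pnone_bind_eq_zero (pnone_tick _)
      fun _ => ih _ _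

/-! ### TwoSweep -/

/-- Consecutive buckets are adjacent. -/
def Contiguous (k : ℕ) (B : Buckets) : Prop := ∀ i, i + 1 < k → (B i).e = (B (i + 1)).b

/-- The invariant of TwoSweep after `s` rounds: `D` are the outstanding distances of the bucket
ends, `N` the final numbers of staged items, and `m` bounds the number of staged items of every
bucket. A bucket end that still has to move to the right has at least `s + 1` buckets to its right,
and one that has to move to the left has at least `s` buckets to its left. -/
structure SweepInv (k s m : ℕ) (N : ℕ → ℕ) (B : Buckets) (D : ℕ → ℤ) : Prop where
  valid : Valid k B
  contiguous : Contiguous k B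
  balance : ∀ i, i < k → ((B i).staged : ℤ) + D i - (if i = 0 then 0 else D (i - 1)) = N i
  last : D (k - 1) = 0
  right : ∀ i, i < k → 0 < D i → i + s + 1 < k
  left : ∀ i, i < k → D i < 0 → s ≤ i
  le : ∀ i, i < k → (B i).staged ≤ m

lemma roundShift_bounds (B : Buckets) (D : ℕ → ℤ) (i : ℕ) :
    (roundShift B D i).natAbs + (D i - roundShift B D i).natAbs = (D i).natAbs := by
  rw [roundShift]
  split_ifs <;> omega

lemma SweepInv.natAbs_roundShift_le {s m : ℕ} {N : ℕ → ℕ} {D : ℕ → ℤ}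
    (h : SweepInv k s m N B D) {i : ℕ} (hi : i < k) : (roundShift B D i).natAbs ≤ m := by
  have h1 := h.le i hi
  have h2 : i + 1 < k ∨ D i = 0 := by
    by_cases h' : i + 1 < k
    · exact Or.inl h'
    · have := h.last
      rw [show k - 1 = i by omega] at this
      exact Or.inr this
  rw [roundShift]
  rcases h2 with h2 | h2
  · have := h.le (i + 1) h2
    split_ifs <;> omega
  · split_ifs <;> omega

/-- The effect of a round on a bucket, in terms of integers. -/
lemma SweepInv.shift_spec {s m : ℕ} {N : ℕ → ℕ} {D : ℕ → ℤ} (hN : ∀ i, i < k → N i ≤ m)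
    (h : SweepInv k s m N B D) {i : ℕ} (hi : i < k) :
    let B' := shiftBuckets k B (roundShift B D)
    let t : ℤ := if i = 0 then 0 else roundShift B D (i - 1)
    ((B' i).b : ℤ) = (B i).b + t ∧ ((B' i).s : ℤ) = (B i).s + t ∧
      ((B' i).e : ℤ) = (B i).e + roundShift B D i ∧ (B' i).s ≤ (B' i).e ∧ (B' i).staged ≤ m := by
  intro B' t
  have hv := h.valid i hi
  have hb := h.balance i hi
  have hle := h.le i hi
  have hNi := hN i hi
  have hst : ((B i).staged : ℤ) = (B i).e - (B i).s := by
    simp only [Bucket.staged]; omega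
  -- The shift of the left end of the bucket.
  have ht : ∃ Dl sl : ℤ, (if i = 0 then 0 else D (i - 1)) = Dl ∧ 0 ≤ sl ∧ sl ≤ m ∧ sl ≤ (B i).b ∧
      t = (if 0 ≤ Dl then min Dl (B i).staged else max Dl (-sl)) := by
    by_cases hi0 : i = 0
    · refine ⟨0, 0, by simp [hi0], le_rfl, by positivity, by positivity, ?_⟩
      simp [t, hi0]
    · refine ⟨D (i - 1), (B (i - 1)).staged, by simp [hi0], by positivity, ?_, ?_, ?_⟩
      · exact_mod_cast h.le (i - 1) (by omega)
      · have h1 := h.contiguous (i - 1) (by omega)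
        rw [show i - 1 + 1 = i by omega] at h1
        simp only [Bucket.staged]
        omega
      · simp only [t, hi0, if_false, roundShift]
        rw [show i - 1 + 1 = i by omega]
  obtain ⟨Dl, sl, hDl, hsl0, hslm, hslb, ht⟩ := ht
  rw [hDl] at hb
  -- The shift of the right end of the bucket.
  have hr : ∃ sr : ℤ, 0 ≤ sr ∧ (sr ≤ m ∨ D i = 0) ∧
      roundShift B D i = if 0 ≤ D i then min (D i) sr else max (D i) (-((B i).staged : ℤ)) := by
    refine ⟨(B (i + 1)).staged, by positivity, ?_, rfl⟩
    by_cases h' : i + 1 < k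
    · exact Or.inl (by exact_mod_cast h.le (i + 1) h')
    · have := h.last
      rw [show k - 1 = i by omega] at this
      exact Or.inr this
  obtain ⟨sr, hsr0, hsrm, hr⟩ := hr
  have hlast : ¬ i + 1 < k → roundShift B D i = 0 := by
    intro h'
    have := h.last
    rw [show k - 1 = i by omega] at this
    rw [hr, if_pos this.ge, this]
    omega
  have hb' : (B' i).b = ((B i).b + t).toNat := rfl
  have hs' : (B' i).s = ((B i).s + t).toNat := rfl
  have he' : (B' i).e = ((B i).e + roundShift B D i).toNat := by
    by_cases h' : i + 1 < k
    · simp [B', shiftBuckets, h']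
    · simp [B', shiftBuckets, h', hlast h']
  simp only [Bucket.staged, hb', hs', he']
  rw [ht]
  generalize roundShift B D i = δ at hr ⊢
  generalize D i = Di at hr hb hsrm
  split_ifs at hr ⊢ <;> omega

lemma SweepInv.next {s m : ℕ} {N : ℕ → ℕ} {D : ℕ → ℤ} (hN : ∀ i, i < k → N i ≤ m)
    (h : SweepInv k s m N B D) :
    SweepInv k (s + 1) m N (shiftBuckets k B (roundShift B D)) (fun i => D i - roundShift B D i) ∧
      ∀ i, i < k → (shiftBuckets k B (roundShift B D) i).placed = (B i).placed := by
  have hnext : ∀ i, i < k → 0 < D i - roundShift B D i → i + 1 < k ∧ 0 < D (i + 1) := by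
    intro i hi hpos
    have hik : i + 1 < k := by
      by_contra h'
      have := h.last
      rw [show k - 1 = i by omega] at this
      have := roundShift_bounds B D i
      omega
    have hb := h.balance (i + 1) hik
    simp only [Nat.add_eq_zero_iff, one_ne_zero, and_false, if_false, Nat.add_sub_cancel] at hb
    rw [roundShift] at hpos
    refine ⟨hik, ?_⟩
    split_ifs at hpos <;> omega
  have hprev : ∀ i, i < k → D i - roundShift B D i < 0 → i ≠ 0 ∧ D (i - 1) < 0 := by
    intro i hi hneg
    have hb := h.balance i hi
    rw [roundShift] at hneg
    split_ifs at hneg hb <;> omega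
  refine ⟨⟨fun i hi => ?_, fun i hi => ?_, fun i hi => ?_, ?_, fun i hi hpos => ?_,
    fun i hi hneg => ?_, fun i hi => (h.shift_spec hN hi).2.2.2.2⟩, fun i hi => ?_⟩
  · have h1 := h.shift_spec hN hi
    have h2 := h.valid i hi
    exact ⟨by omega, h1.2.2.2.1⟩
  · have h1 := h.shift_spec hN hi
    have h2 := h.shift_spec hN (show i < k by omega)
    simp only [Nat.add_eq_zero_iff, one_ne_zero, and_false, if_false, Nat.add_sub_cancel] at h1
    have h3 := h.contiguous i hi
    omega
  · have h1 := h.shift_spec hN hi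
    have h2 := h.balance i hi
    have h3 := h.valid i hi
    simp only [Bucket.staged] at h1 h2 ⊢
    split_ifs at h1 h2 ⊢ <;> omega
  · have := roundShift_bounds B D (k - 1)
    have := h.last
    omega
  · obtain ⟨h1, h2⟩ := hnext i hi hpos
    have := h.right (i + 1) h1 h2
    omega
  · obtain ⟨h1, h2⟩ := hprev i hi hneg
    have := h.left (i - 1) (by omega) h2
    omega
  · have h1 := h.shift_spec hN hi
    have h2 := h.valid i hi
    simp only [Bucket.placed]
    omega

lemma post_moveBoundary (hκ : SeqCost κ) (B : Buckets) (i : ℕ) (t : ℤ) :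
    Post (moveBoundary B i t : Comp α Unit) fun _ e => κ e ≤ 5 * t.natAbs := by
  rw [moveBoundary]
  have hround : ∀ a b : ℕ, Post (swap a b >>= fun _ => tick 3 : Comp α Unit) fun _ e => κ e ≤ 4 :=
    fun a b => (post_swap (Q := fun _ e => κ e = 1) hκ.step).bind fun _ e he =>
      post_tick (by rw [hκ.seq, hκ.steps, he])
  split_ifs with ht
  · refine (post_loop hκ _ _ (fun _ => 4) fun j _ => hround _ _).mono fun _ e he => ?_
    simp at he
    omega
  · refine (post_loop hκ _ _ (fun _ => 4) fun j _ => hround _ _).mono fun _ e he => ?_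
    simp at he
    omega

/-- What TwoSweep achieves: the placed items are kept and bucket `i` has `N i` staged items. -/
structure Swept (k : ℕ) (N : ℕ → ℕ) (B B' : Buckets) : Prop where
  valid : Valid k B'
  placed : ∀ i, i < k → (B' i).placed = (B i).placed
  staged : ∀ i, i < k → (B' i).staged = N i

lemma post_sweepRounds (hk : 2 ≤ k) {s m r : ℕ} {N : ℕ → ℕ} {D : ℕ → ℤ}
    (hN : ∀ i, i < k → N i ≤ m) (h : SweepInv k s m N B D) (hr : s + r = k) :
    Post (sweepRounds k r B D : Comp α Buckets) fun B' e => Swept k N B B' ∧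
      e.span ≤ r * (6 * k + 5 * m) ∧
      e.work ≤ r * (9 * k) + 5 * ∑ i ∈ Finset.range k, (D i).natAbs := by
  induction r generalizing s B D with
  | zero =>
    refine post_pure ⟨⟨h.valid, fun _ _ => rfl, fun i hi => ?_⟩, by simp [Exec.span],
      by simp [Exec.work]⟩
    have hD : ∀ j, j < k → D j = 0 := fun j hj => by
      have h1 := h.right j hj
      have h2 := h.left j hj
      omega
    have hb := h.balance i hi
    rw [hD i hi] at hb
    split_ifs at hb with h0
    · omega
    · rw [hD (i - 1) (by omega)] at hb
      omega
  | succ r ih =>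
    rw [sweepRounds]
    obtain ⟨hinv, hpl⟩ := h.next hN
    refine (post_parLoop (by omega) (s := 3) (w := fun _ => 3) fun i _ _ =>
      post_tick ⟨(seqCost_span.steps 3).le, (seqCost_work.steps 3).le⟩).bind fun _ e he => ?_
    refine (post_parLoop (by omega) (s := 5 * m) (w := fun i => 5 * (roundShift B D i).natAbs)
      fun i _ hi => ((post_moveBoundary seqCost_span B i _).and
        (post_moveBoundary seqCost_work B i _)).mono fun _ e he => ⟨?_, he.2⟩).bind fun _ e' he' => ?_
    · have := h.natAbs_roundShift_le (show i < k by omega)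
      omega
    · refine (ih hinv (by omega)).mono fun B' e'' he'' => ⟨⟨he''.1.valid, fun i hi => ?_,
        he''.1.staged⟩, ?_, ?_⟩
      · rw [he''.1.placed i hi, hpl i hi]
      · have h1 : (r + 1) * (6 * k + 5 * m) = r * (6 * k + 5 * m) + (6 * k + 5 * m) := by ring
        simp only [Exec.span]
        omega
      · have h1 : (r + 1) * (9 * k) = r * (9 * k) + 9 * k := by ring
        have h2 : ∑ i ∈ Finset.Ico 0 (0 + (k - 1)), 5 * (roundShift B D i).natAbs ≤
            5 * ∑ i ∈ Finset.range k, (roundShift B D i).natAbs := by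
          rw [Finset.mul_sum]
          refine Finset.sum_le_sum_of_subset fun i hi => ?_
          simp only [Finset.mem_Ico, Finset.mem_range] at hi ⊢
          omega
        have h3 : ∑ i ∈ Finset.range k, (roundShift B D i).natAbs +
            ∑ i ∈ Finset.range k, (D i - roundShift B D i).natAbs =
            ∑ i ∈ Finset.range k, (D i).natAbs := by
          rw [← Finset.sum_add_distrib]
          exact Finset.sum_congr rfl fun i _ => roundShift_bounds B D i
        have h4 := he''.2.2
        simp only [Exec.work]
        simp only [Finset.sum_const, Nat.card_Ico, smul_eq_mul] at he
        omega

lemma post_parTwoSweep (hk : 2 ≤ k) {m : ℕ} {N : ℕ → ℕ} (hB : Valid k B) (hc : Contiguous k B)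
    (hsum : ∑ i ∈ Finset.range k, N i = B.staged k) (hN : ∀ i, i < k → N i ≤ m)
    (hBm : ∀ i, i < k → (B i).staged ≤ m) :
    Post (parTwoSweep k B N : Comp α Buckets) fun B' e => Swept k N B B' ∧
      e.span ≤ 9 * k ^ 2 + 5 * k * m ∧
      e.work ≤ 12 * k ^ 2 + 5 * ∑ i ∈ Finset.range k, (boundaryShift B N i).natAbs := by
  have hlast : boundaryShift B N (k - 1) = 0 := by
    rw [boundaryShift, show k - 1 + 1 = k by omega, Finset.sum_sub_distrib, sub_eq_zero]
    rw [Buckets.staged] at hsum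
    exact_mod_cast hsum
  have hinv : SweepInv k 0 m N B (boundaryShift B N) := by
    refine ⟨hB, hc, fun i hi => ?_, hlast, fun i hi hpos => ?_, fun _ _ _ => Nat.zero_le _, hBm⟩
    · by_cases h0 : i = 0
      · subst h0
        simp [boundaryShift]
      · rw [if_neg h0, boundaryShift, boundaryShift, show i - 1 + 1 = i by omega,
          Finset.sum_range_succ]
        ring
    · by_contra h'
      rw [show k - 1 = i by omega] at hlast
      omega
  rw [parTwoSweep]
  refine (post_tick (Q := fun _ e => e = .steps (3 * k)) rfl).bind fun _ e he =>
    (post_sweepRounds hk hN hinv (zero_add k)).mono fun B' e' he' => ⟨he'.1, ?_, ?_⟩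
  · rw [Exec.span, he, seqCost_span.steps]
    nlinarith [he'.2.1]
  · rw [Exec.work, he, seqCost_work.steps]
    nlinarith [he'.2.2]

lemma pnone_parTwoSweep (B : Buckets) (N : ℕ → ℕ) :
    pnone (parTwoSweep k B N : Comp α Buckets) = 0 := by
  have hmove : ∀ (B : Buckets) (i : ℕ) (t : ℤ), pnone (moveBoundary B i t : Comp α Unit) = 0 := by
    intro B i t
    rw [moveBoundary]
    split_ifs <;> exact pnone_loop _ _ fun _ => pnone_bind_eq_zero (pnone_swap _ _) fun _ =>
      pnone_tick _
  have hloop : ∀ (lo len : ℕ) (f : ℕ → Comp α Unit), (∀ i, pnone (f i) = 0) →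
      pnone (parLoop lo len f) = 0 := fun lo len f hf =>
    le_antisymm ((pnone_parLoop_le _ _ _).trans (by simp [hf])) zero_le
  have hrounds : ∀ (r : ℕ) (B : Buckets) (D : ℕ → ℤ),
      pnone (sweepRounds k r B D : Comp α Buckets) = 0 := by
    intro r
    induction r with
    | zero => exact fun _ _ => pnone_pure _
    | succ r ih =>
      intro B D
      rw [sweepRounds]
      exact pnone_bind_eq_zero (hloop _ _ _ fun _ => pnone_tick _) fun _ =>
        pnone_bind_eq_zero (hloop _ _ _ fun _ => hmove _ _ _) fun _ => ih _ _
  exact pnone_bind_eq_zero (pnone_tick _) fun _ => hrounds _ _ _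

/-! ### Shuffling the staged items -/

lemma post_compactStaged (hκ : SeqCost κ) (lo : ℕ) (B : Buckets) :
    Post (compactStaged k lo B : Comp α Unit) fun _ e => κ e ≤ 3 * k + 2 * B.staged k := by
  rw [compactStaged]
  refine (post_loop hκ k _ (fun i => 2 + 2 * (B i).staged) fun i _ => ?_).mono fun _ e he => ?_
  · refine (post_tick (Q := fun _ e => κ e = 2) (hκ.steps 2)).bind fun _ e he => ?_
    refine (post_loop hκ _ _ (fun _ => 1) fun j _ => post_swap hκ.step.le).mono fun _ e' he' => ?_
    rw [hκ.seq]
    simp at he'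
    omega
  · rw [Buckets.staged, Finset.mul_sum]
    simp [Finset.sum_add_distrib] at he
    omega

lemma post_restoreStaged (hκ : SeqCost κ) (lo : ℕ) (B : Buckets) :
    Post (restoreStaged k lo B : Comp α Unit) fun _ e => κ e ≤ 3 * k + 2 * B.staged k := by
  rw [restoreStaged]
  refine (post_loop hκ k _ (fun i => 2 + 2 * (B (k - 1 - i)).staged) fun i _ => ?_).mono
    fun _ e he => ?_
  · refine (post_tick (Q := fun _ e => κ e = 2) (hκ.steps 2)).bind fun _ e he => ?_
    refine (post_loop hκ _ _ (fun _ => 1) fun j _ => post_swap hκ.step.le).mono fun _ e' he' => ?_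
    rw [hκ.seq]
    simp at he'
    omega
  · have h1 := Finset.sum_range_reflect (fun i => 2 * (B i).staged) k
    rw [Buckets.staged, Finset.mul_sum, ← h1]
    simp [Finset.sum_add_distrib] at he
    omega

lemma pnone_fisherYates (lo n : ℕ) : pnone (fisherYates S lo n : Comp α Unit) = 0 := by
  induction n with
  | zero => exact pnone_tick _
  | succ n ih =>
    match n, ih with
    | 0, _ => exact pnone_tick _
    | i + 1, ih =>
      exact pnone_bind_eq_zero (pnone_rejection _ _) fun _ => pnone_bind_eq_zero (pnone_swap _ _)
        fun _ => pnone_bind_eq_zero (pnone_tick _) fun _ => ih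

lemma pnone_shuffleStaged (lo : ℕ) (B : Buckets) :
    pnone (shuffleStaged S k lo B : Comp α Unit) = 0 :=
  pnone_bind_eq_zero (pnone_loop _ _ fun _ => pnone_bind_eq_zero (pnone_tick _) fun _ =>
    pnone_loop _ _ fun _ => pnone_swap _ _) fun _ => pnone_bind_eq_zero (pnone_fisherYates _ _)
    fun _ => pnone_loop _ _ fun _ => pnone_bind_eq_zero (pnone_tick _) fun _ =>
    pnone_loop _ _ fun _ => pnone_swap _ _

lemma cwp_shuffleStaged_le (hκ : SeqCost κ) (hS : S.AcceptAtLeast p₀) (hl : 0 ≤ l)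
    (hl' : l ≤ p₀ / 2) (lo : ℕ) (B : Buckets) :
    cwp κ l (shuffleStaged S k lo B : Comp α Unit) (fun _ => 1) ≤
      eexp (l * (6 * k + 1 + (costRate p₀ + 4) * B.staged k)) := by
  rw [shuffleStaged]
  refine (cwp_bind_le hκ _ _ _).trans ((cwp_le_of_post (w := 3 * k + 2 * B.staged k) hl
    (b := eexp (l * (costRate p₀ * B.staged k + 1)) * eexp (l * (3 * k + 2 * B.staged k))) ?_).trans
    ?_)
  · refine (post_compactStaged hκ lo B).mono fun _ e he => ⟨by exact_mod_cast he, ?_⟩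
    refine (cwp_bind_le hκ _ _ _).trans ?_
    refine (cwp_mono (G' := fun _ => eexp (l * (3 * k + 2 * B.staged k)) * 1) fun _ => ?_).trans ?_
    · refine cwp_le_of_post hl ((post_restoreStaged hκ lo B).mono fun _ e he =>
        ⟨by exact_mod_cast he, le_rfl⟩)
    · rw [cwp_const_mul, mul_comm]
      gcongr
      exact cwp_fisherYates_le hκ hS hl hl' lo _
  · rw [← eexp_add, ← eexp_add]
    apply eexp_mono
    apply le_of_eq
    ring

/-! ### FineScatter -/

lemma post_parFineScatter (hk : 2 ≤ k) (lo : ℕ) (hB : Valid k B) (hc : Contiguous k B) :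
    Post (parFineScatter S k lo B : Comp α Buckets) fun B' _ => B'.size k = B.size k := by
  rw [parFineScatter]
  refine (post_tick (Q := fun _ _ => True) trivial).bind fun _ _ _ => ?_
  refine (post_multinomial k _ _ le_rfl (by omega)).bind fun N _ hN => ?_
  have hsum : ∑ i ∈ Finset.range k, N i = B.staged k := by simpa using hN
  refine (post_parTwoSweep hk hB hc hsum (m := B.staged k) (fun i hi => ?_) fun i hi => ?_).bind
    fun B' _ hB' => ?_
  · rw [← hsum]
    exact Finset.single_le_sum (f := N) (fun _ _ => Nat.zero_le _) (Finset.mem_range.2 hi)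
  · exact Finset.single_le_sum (f := fun i => (B i).staged) (fun _ _ => Nat.zero_le _)
      (Finset.mem_range.2 hi)
  · refine (Post.of_forall (Q := fun _ _ => True) fun _ _ => trivial).bind fun _ _ _ => post_pure ?_
    rw [← hB.sum_placed_add_staged, ← hB'.1.valid.sum_placed_add_staged, ← hsum]
    congr 1
    · exact Finset.sum_congr rfl fun i hi => hB'.1.placed i (Finset.mem_range.1 hi)
    · exact Finset.sum_congr rfl fun i hi => hB'.1.staged i (Finset.mem_range.1 hi)

/-- FineScatter reduces to the multinomial variate: the cost of TwoSweep is certain when the final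
numbers of staged items are known. -/
lemma cwp_parFineScatter_le (hκ : SeqCost κ) (hS : S.AcceptAtLeast p₀) (hl : 0 ≤ l)
    (hl' : l ≤ p₀ / 2) (hk : 2 ≤ k) (lo : ℕ)
    {G : Buckets → ℝ≥0∞} {H : (ℕ → ℕ) → ℝ≥0∞} {w : (ℕ → ℕ) → ℝ}
    (hw : ∀ N, ∑ i ∈ Finset.range k, N i = B.staged k →
      Post (parTwoSweep k B N : Comp α Buckets) fun B' e => Swept k N B B' ∧ (κ e : ℝ) ≤ w N)
    (hG : ∀ N B', Swept k N B B' → G B' ≤ H N) :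
    cwp κ l (parFineScatter S k lo B : Comp α Buckets) G ≤
      eexp (l * (8 * k + (costRate p₀ + 4) * B.staged k)) *
        cwp κ l (multinomial S k k (B.staged k) (fun _ => 0) : Comp α (ℕ → ℕ))
          (fun N => eexp (l * w N) * H N) := by
  rw [parFineScatter]
  refine (cwp_tick_bind_le hκ _ _ _).trans ?_
  have hk2 : (2 : ℝ) ≤ k := by exact_mod_cast hk
  calc _ ≤ eexp (l * (k + 1 : ℕ)) *
        cwp κ l (multinomial S k k (B.staged k) (fun _ => 0) : Comp α (ℕ → ℕ)) (fun N =>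
          eexp (l * (6 * k + 1 + (costRate p₀ + 4) * B.staged k)) * (eexp (l * w N) * H N)) := by
        gcongr
        refine (cwp_bind_le hκ _ _ _).trans (cwp_mono_of_post
          ((post_multinomial k _ _ le_rfl (by omega)).mono fun N _ hN => ?_))
        have hsum : ∑ i ∈ Finset.range k, N i = B.staged k := by simpa using hN
        refine (cwp_bind_le hκ _ _ _).trans ?_
        rw [mul_left_comm]
        refine cwp_le_of_post hl ((hw N hsum).mono fun B' e hB' => ⟨hB'.2, ?_⟩)
        have hst : B'.staged k = B.staged k := by
          rw [← hsum]
          exact Finset.sum_congr rfl fun i hi => hB'.1.staged i (Finset.mem_range.1 hi)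
        refine (cwp_bind_le hκ _ _ _).trans ((cwp_mono (G' := fun _ => H N * 1) fun _ =>
          (cwp_pure_le hκ _ _).trans (by simpa using hG N B' hB'.1)).trans ?_)
        rw [cwp_const_mul, mul_comm, ← hst]
        gcongr
        exact cwp_shuffleStaged_le hκ hS hl hl' lo B'
    _ ≤ _ := by
        rw [cwp_const_mul, ← mul_assoc, ← eexp_add, ← mul_add]
        gcongr
        apply eexp_mono
        refine mul_le_mul_of_nonneg_left ?_ hl
        push_cast
        linarith

lemma pnone_parFineScatter (lo : ℕ) (B : Buckets) :
    pnone (parFineScatter S k lo B : Comp α Buckets) = 0 :=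
  pnone_bind_eq_zero (pnone_tick _) fun _ => pnone_bind_eq_zero (pnone_multinomial _ _ _) fun _ =>
    pnone_bind_eq_zero (pnone_parTwoSweep _ _) fun _ =>
    pnone_bind_eq_zero (pnone_shuffleStaged _ _) fun _ => pnone_pure _

end ScatterShuffle

namespace ScatterShuffle
open ForkJoin ForkJoin.Comp

variable {α : Type u} {κ : Exec → ℕ} {l p₀ : ℝ} {S : Samplers} {k N₀ : ℕ}

/-! ### The initial buckets -/

lemma allStaged_initialBuckets (k lo m : ℕ) : AllStaged k (initialBuckets k lo m) := fun i _ => by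
  refine ⟨rfl, ?_⟩
  have : i * m / k ≤ (i + 1) * m / k := Nat.div_le_div_right (Nat.mul_le_mul_right _ (by omega))
  simp only [initialBuckets]
  omega

lemma contiguous_initialBuckets (k lo m : ℕ) : Contiguous k (initialBuckets k lo m) :=
  fun _ _ => rfl

lemma sum_size_initialBuckets (k lo m i : ℕ) :
    ∑ j ∈ Finset.range i, (initialBuckets k lo m j).size = i * m / k := by
  induction i with
  | zero => simp
  | succ i ih =>
    rw [Finset.sum_range_succ, ih]
    have : i * m / k ≤ (i + 1) * m / k := Nat.div_le_div_right (Nat.mul_le_mul_right _ (by omega))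
    simp only [initialBuckets, Bucket.size]
    omega

lemma size_initialBuckets (hk : 0 < k) (lo m : ℕ) : (initialBuckets k lo m).size k = m := by
  rw [Buckets.size, sum_size_initialBuckets, Nat.mul_div_cancel_left _ hk]

lemma balanced_initialBuckets (hk : 0 < k) (lo m : ℕ) : Balanced k (initialBuckets k lo m) := by
  refine ⟨m / k, fun i _ => ?_⟩
  have := Nat.add_div (a := i * m) (b := m) hk
  simp only [initialBuckets, Bucket.size, add_one_mul]
  generalize (i * m + m) / k = x at *
  generalize i * m / k = y at *
  generalize m / k = z at *
  split_ifs at this <;> omega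

lemma abs_natDiv_sub_le (hk : 0 < k) (a : ℕ) : |((a / k : ℕ) : ℝ) - a / k| ≤ 1 := by
  have hk' : (0 : ℝ) < k := by exact_mod_cast hk
  have h1 : ((a / k : ℕ) : ℝ) ≤ a / k := Nat.cast_div_le
  have h2 : (a : ℝ) / k < (a / k : ℕ) + 1 := by
    rw [div_lt_iff₀ hk']
    have := Nat.lt_mul_div_succ a hk
    rw [mul_comm]
    exact_mod_cast this
  rw [abs_le]
  constructor <;> linarith

lemma Contiguous.of_sameCells {B B' : Buckets} (h : Contiguous k B) (h' : SameCells k B B') :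
    Contiguous k B' := fun i hi => by
  rw [(h' i (by omega)).2, (h' (i + 1) hi).1, h i hi]

/-! ### The random choices of one call -/

/-- The random choices of one call: the buckets after RoughScatter with its execution, and the final
numbers of staged items with the execution that draws them. -/
abbrev Draw := (Buckets × Exec) × ((ℕ → ℕ) × Exec)

variable (α S k N₀) in
/-- The mean over the random choices of one call on the buckets `B₀`. -/
def drawMean (B₀ : Buckets) (g : Draw → ℝ≥0∞) : ℝ≥0∞ :=
  wp (parRoughScatter S k N₀ B₀ : Comp α Buckets) fun B e =>
    wp (multinomial S k k (B.staged k) (fun _ => 0) : Comp α (ℕ → ℕ)) fun N e' => g ((B, e), (N, e'))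

lemma sublinear_drawMean (B₀ : Buckets) : Sublinear (drawMean α S k N₀ B₀) where
  mono _ _ h := wp_mono fun _ _ => wp_mono fun _ _ => h _
  add _ _ := (wp_mono fun _ _ => wp_add_le _ _ _).trans (wp_add_le _ _ _)
  mul _ _ := (wp_mono fun _ _ => (wp_const_mul _ _ _).le).trans (wp_const_mul _ _ _).le
  one := (wp_mono fun _ _ => wp_const_le _ _).trans (wp_const_le _ _)

variable {B₀ : Buckets}

lemma post_parRoughScatter (hk : 0 < k) (hB : AllStaged k B₀) :
    Post (parRoughScatter S k N₀ B₀ : Comp α Buckets) fun B _ => Scattered k B₀ B :=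
  post_parRoughScatterAux hk _ _ hB

lemma drawMean_mono (hk : 0 < k) (hB : AllStaged k B₀) {g g' : Draw → ℝ≥0∞}
    (h : ∀ B e N e', Scattered k B₀ B → ∑ i ∈ Finset.range k, N i = B.staged k →
      g ((B, e), (N, e')) ≤ g' ((B, e), (N, e'))) :
    drawMean α S k N₀ B₀ g ≤ drawMean α S k N₀ B₀ g' := by
  refine wp_mono_of_post ((post_parRoughScatter hk hB).mono fun B e hBs => ?_)
  refine wp_mono_of_post ((post_multinomial k _ _ le_rfl (by omega)).mono fun N e' hN => ?_)
  exact h B e N e' hBs (by simpa using hN)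

lemma drawMean_fst_le (g : Buckets → Exec → ℝ≥0∞) :
    drawMean α S k N₀ B₀ (fun ω => g ω.1.1 ω.1.2) ≤
      wp (parRoughScatter S k N₀ B₀ : Comp α Buckets) g :=
  wp_mono fun _ _ => wp_const_le _ _

/-- The final number of cells of a bucket. -/
def Draw.size (ω : Draw) (i : ℕ) : ℕ := (ω.1.1 i).placed + ω.2.1 i

lemma Scattered.sum_draw_size {B : Buckets} {e e' : Exec} {N : ℕ → ℕ} (h : Scattered k B₀ B)
    (hN : ∑ i ∈ Finset.range k, N i = B.staged k) :
    ∑ i ∈ Finset.range k, Draw.size ((B, e), (N, e')) i = B₀.size k := by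
  simp only [Draw.size]
  rw [Finset.sum_add_distrib, hN, h.valid.sum_placed_add_staged, h.same.total_eq]

/-- Weights with average at most one, for the placements of RoughScatter and for the multinomial
variate. -/
lemma drawMean_weight_le (hS : S.AcceptAtLeast p₀) (hk : 0 < k) (hB : AllStaged k B₀)
    {y z : ℕ → ℝ≥0∞} (hy : ∑ i ∈ Finset.range k, y i ≤ k) (hz : ∑ i ∈ Finset.range k, z i ≤ k) :
    drawMean α S k N₀ B₀ (fun ω => placedWeight k y ω.1.1 *
      ∏ i ∈ Finset.range k, z i ^ ω.2.1 i) ≤ 1 := by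
  have hp := hS.pos
  calc _ ≤ wp (parRoughScatter S k N₀ B₀ : Comp α Buckets) (fun B _ => placedWeight k y B * 1) := by
        refine wp_mono fun B e => ?_
        refine (wp_const_mul (multinomial S k k (B.staged k) (fun _ => 0) : Comp α (ℕ → ℕ))
          (placedWeight k y B) fun N _ => ∏ i ∈ Finset.range k, z i ^ N i).le.trans ?_
        gcongr
        have := cwp_multinomial_prod_le (α := α) seqCost_span hS le_rfl (by positivity) hk
          hz (B.staged k)
        simpa [cwp_zero, eexp_zero] using this
    _ ≤ 1 := by
        have := cwp_parRoughScatterAux_placedWeight_le (α := α) (N₀ := N₀) seqCost_span hS hk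
          hy (B₀.size k) B₀ hB
        rw [cwp_zero] at this
        simp only [mul_one]
        exact this

/-- Up to exponential moments, the number of items that end up in a set `A` of buckets is at most a
binomial variate. -/
lemma drawMean_tilt_le (hS : S.AcceptAtLeast p₀) (hk : 0 < k) (hB : AllStaged k B₀)
    {A : Finset ℕ} (hA : A ⊆ Finset.range k) (ν : ℝ) :
    drawMean α S k N₀ B₀ (fun ω => eexp (ν * (∑ i ∈ A, ω.size i : ℕ) -
      (Real.exp ν - 1) * A.card / k * B₀.size k)) ≤ 1 := by
  refine le_trans ?_ (drawMean_weight_le (α := α) (N₀ := N₀) hS hk hB (sum_tilt_le hk hA ν)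
    (sum_tilt_le hk hA ν))
  refine drawMean_mono hk hB fun B e N e' h hN => ?_
  rw [placedWeight, ← Finset.prod_mul_distrib]
  simp only [← pow_add]
  rw [prod_tilt_pow hA ν (fun i => (B i).placed + N i)]
  have := h.sum_draw_size (e := e) (e' := e') hN
  simp only [Draw.size] at this ⊢
  rw [this]

lemma wp_staged_le (hS : S.AcceptAtLeast p₀) (hk : 0 < k) {μ : ℝ} (hμ : 0 ≤ μ)
    (hμk : μ * k ≤ 1) (hB : AllStaged k B₀) (hbal : Balanced k B₀) :
    wp (parRoughScatter S k N₀ B₀ : Comp α Buckets) (fun B _ => eexp (μ * B.staged k)) ≤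
      eexp (Real.log k + (μ * k + μ ^ 2 * (B₀.size k * k))) := by
  have := cwp_staged_le (α := α) (N₀ := N₀) seqCost_span hS hk hμ hμk (B₀.size k) hB hbal
  rw [cwp_zero] at this
  rw [eexp_add, eexp_log_natCast hk]
  exact this

/-! ### Bucket sizes -/

/-- The sum of the squares of the bucket sizes shrinks by a factor of the order `k`. -/
lemma drawMean_sum_sq_le (hS : S.AcceptAtLeast p₀) (hk : 2 ≤ k) (hB : AllStaged k B₀)
    (hM : k ^ 2 < B₀.size k) :
    drawMean α S k N₀ B₀ (fun ω => ∑ i ∈ Finset.range k, (ω.size i : ℝ≥0∞) ^ 2) ≤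
      ENNReal.ofReal (1.86 / k) * (B₀.size k : ℝ≥0∞) ^ 2 := by
  have hk2 : (2 : ℝ) ≤ k := by exact_mod_cast hk
  have hk0 : (0 : ℝ) < k := by linarith
  set m : ℝ := ((B₀.size k : ℕ) : ℝ) with hm
  have hm0 : (k : ℝ) ^ 2 + 1 ≤ m := by
    rw [hm]
    exact_mod_cast hM
  have hmpos : 0 < m := lt_of_lt_of_le (by positivity) hm0
  set ν : ℝ := k / m with hν
  have hν0 : 0 < ν := by positivity
  have hν1 : ν ≤ 2 / 5 := by
    rw [hν, div_le_div_iff₀ hmpos (by norm_num)]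
    nlinarith
  -- By convexity, `e ^ ν - 1` is at most `1.23 * ν` for `ν ≤ 2 / 5`.
  have hexp : Real.exp ν - 1 ≤ 1.23 * ν := by
    have h := convexOn_exp.2 (Set.mem_univ 0) (Set.mem_univ (2 / 5 : ℝ))
      (show 0 ≤ 1 - ν / (2 / 5) by linarith) (show 0 ≤ ν / (2 / 5) by positivity) (by ring)
    simp only [smul_eq_mul, mul_zero, zero_add, Real.exp_zero, mul_one] at h
    rw [div_mul_cancel₀ _ (by norm_num : (2 / 5 : ℝ) ≠ 0)] at h
    have h25 : Real.exp (2 / 5) ≤ 1.492 := by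
      have := Real.exp_bound' (x := 2 / 5) (by norm_num) (by norm_num) (n := 5) (by norm_num)
      norm_num [Finset.sum_range_succ, Nat.factorial] at this ⊢
      linarith
    have := mul_le_mul_of_nonneg_left h25 (show 0 ≤ ν / (2 / 5) by positivity)
    linarith
  have hconst : 4 * Real.exp (-0.77) ≤ 1.86 := by
    have h77 : (2.1506 : ℝ) ≤ Real.exp 0.77 := by
      have := Real.sum_le_exp_of_nonneg (x := 0.77) (by norm_num) 6
      norm_num [Finset.sum_range_succ, Nat.factorial] at this ⊢
      linarith
    rw [Real.exp_neg]
    rw [← div_eq_mul_inv, div_le_iff₀ (by positivity)]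
    linarith
  have hx : ∀ x : ℕ, (x : ℝ) ^ 2 ≤ (m / k) ^ 2 * (4 * Real.exp (-2)) * Real.exp (ν * x) := by
    intro x
    have h1 := Real.add_one_le_exp (ν * x / 2 - 1)
    have h2 : (ν * x / 2) ^ 2 ≤ Real.exp (ν * x / 2 - 1) ^ 2 := by
      gcongr
      linarith
    rw [← Real.exp_nat_mul, show ((2 : ℕ) : ℝ) * (ν * x / 2 - 1) = -2 + ν * x by push_cast; ring,
      Real.exp_add] at h2
    have h3 : (x : ℝ) ^ 2 = (m / k) ^ 2 * (4 * (ν * x / 2) ^ 2) := by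
      rw [hν]; field_simp; ring
    rw [h3, mul_assoc]
    exact mul_le_mul_of_nonneg_left (by linarith) (by positivity)
  have hone : ∀ i ∈ Finset.range k, drawMean α S k N₀ B₀ (fun ω => (ω.size i : ℝ≥0∞) ^ 2) ≤
      ENNReal.ofReal (1.86 * (m / k) ^ 2) := by
    intro i hi
    have hA : ({i} : Finset ℕ) ⊆ Finset.range k := by simpa using hi
    have ht := drawMean_tilt_le (α := α) (N₀ := N₀) hS (by omega) hB hA ν
    calc drawMean α S k N₀ B₀ (fun ω => (ω.size i : ℝ≥0∞) ^ 2)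
        ≤ drawMean α S k N₀ B₀ (fun ω => ENNReal.ofReal (1.86 * (m / k) ^ 2) *
          eexp (ν * (∑ j ∈ ({i} : Finset ℕ), ω.size j : ℕ) -
            (Real.exp ν - 1) * ({i} : Finset ℕ).card / k * B₀.size k)) := by
          refine (sublinear_drawMean _).mono _ _ fun ω => ?_
          rw [eexp, ← ENNReal.ofReal_mul (by positivity), Finset.sum_singleton,
            Finset.card_singleton, Nat.cast_one, mul_one, ← hm]
          rw [show ((ω.size i : ℝ≥0∞)) ^ 2 = ENNReal.ofReal ((ω.size i : ℝ) ^ 2) by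
            rw [ENNReal.ofReal_pow (by positivity), ENNReal.ofReal_natCast]]
          refine ENNReal.ofReal_le_ofReal ((hx _).trans ?_)
          have hE : (Real.exp ν - 1) / k * m ≤ 1.23 := by
            have : (Real.exp ν - 1) / k * m = (Real.exp ν - 1) / ν := by rw [hν]; field_simp
            rw [this, div_le_iff₀ hν0]
            exact hexp
          calc (m / k) ^ 2 * (4 * Real.exp (-2)) * Real.exp (ν * ω.size i)
              = (m / k) ^ 2 * 4 * Real.exp (-2 + ν * ω.size i) := by rw [Real.exp_add]; ring
            _ ≤ (m / k) ^ 2 * 4 *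
                Real.exp (-0.77 + (ν * ω.size i - (Real.exp ν - 1) / k * m)) := by
              gcongr ?_ * Real.exp ?_
              linarith
            _ = (4 * Real.exp (-0.77)) * (m / k) ^ 2 *
                Real.exp (ν * ω.size i - (Real.exp ν - 1) / k * m) := by rw [Real.exp_add]; ring
            _ ≤ _ := by gcongr
      _ ≤ ENNReal.ofReal (1.86 * (m / k) ^ 2) * 1 :=
          ((sublinear_drawMean _).mul _ _).trans (by gcongr)
      _ = _ := mul_one _
  refine ((sublinear_drawMean _).sum _ _).trans ((Finset.sum_le_sum hone).trans ?_)
  rw [Finset.sum_const, Finset.card_range, nsmul_eq_mul, ← ENNReal.ofReal_natCast (n := k),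
    ← ENNReal.ofReal_natCast (n := B₀.size k), ← ENNReal.ofReal_pow (by positivity),
    ← ENNReal.ofReal_mul (by positivity), ← ENNReal.ofReal_mul (by positivity), ← hm]
  refine ENNReal.ofReal_le_ofReal (le_of_eq ?_)
  field_simp

/-- The distances by which TwoSweep moves the bucket ends have deviations of the order `√m`. -/
lemma drawMean_boundaryShift_le (hS : S.AcceptAtLeast p₀) (hk : 0 < k) {lo m i : ℕ} (hm : 0 < m)
    (hi : i < k) :
    drawMean α S k N₀ (initialBuckets k lo m)
      (fun ω => eexp (1 / √m * (boundaryShift ω.1.1 ω.2.1 i).natAbs)) ≤ eexp 3 := by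
  have hk' : (0 : ℝ) < k := by exact_mod_cast hk
  have hm1 : (1 : ℝ) ≤ m := by exact_mod_cast hm
  set r := √(m : ℝ) with hr
  have hrr : r * r = m := Real.mul_self_sqrt (by linarith)
  have hr1 : 1 ≤ r := Real.one_le_sqrt.2 hm1
  have hB := allStaged_initialBuckets k lo m
  have hA : Finset.range (i + 1) ⊆ Finset.range k := Finset.range_subset_range.2 (by omega)
  have hμ1 : 1 / r ≤ 1 := by rw [div_le_one (by linarith)]; exact hr1
  have signed : ∀ ν : ℝ, |ν| = 1 / r → drawMean α S k N₀ (initialBuckets k lo m)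
      (fun ω => eexp (ν * (boundaryShift ω.1.1 ω.2.1 i : ℤ))) ≤ eexp 2 := by
    intro ν hν
    calc _ ≤ drawMean α S k N₀ (initialBuckets k lo m) (fun ω => eexp 2 *
          eexp (ν * (∑ j ∈ Finset.range (i + 1), ω.size j : ℕ) - (Real.exp ν - 1) *
            (Finset.range (i + 1)).card / k * (initialBuckets k lo m).size k)) := by
          refine drawMean_mono hk hB fun B e N e' h hN => ?_
          rw [← eexp_add]
          apply eexp_mono
          rw [size_initialBuckets hk, Finset.card_range]
          have h1 : ((boundaryShift B N i : ℤ) : ℝ) =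
              ((∑ j ∈ Finset.range (i + 1), Draw.size ((B, e), (N, e')) j : ℕ) : ℝ) -
                (((i + 1) * m / k : ℕ) : ℝ) := by
            rw [← sum_size_initialBuckets k lo m (i + 1), boundaryShift]
            push_cast
            rw [← Finset.sum_sub_distrib]
            refine Finset.sum_congr rfl fun j hj => ?_
            have hj' : j < k := by have := Finset.mem_range.1 hj; omega
            rw [← h.same.size_eq hj', ← h.valid.placed_add_staged hj']
            simp only [Draw.size]
            push_cast
            ring
          have h2 := abs_natDiv_sub_le hk ((i + 1) * m)
          set F : ℝ := (((i + 1) * m / k : ℕ) : ℝ) with hF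
          have h3 : Real.exp ν - 1 ≤ ν + ν ^ 2 := exp_sub_one_le (by rw [hν]; exact hμ1)
          have h4 : ν ^ 2 * m = 1 := by
            rw [← sq_abs, hν, ← hrr]
            field_simp
          set x : ℝ := ((i + 1 : ℕ) : ℝ) / k with hx
          have hx1 : x ≤ 1 := by
            rw [hx, div_le_one hk']
            exact_mod_cast hi
          have hx0 : 0 ≤ x := by positivity
          have h5 : ((((i + 1) * m : ℕ) : ℝ)) / k = x * m := by rw [hx]; push_cast; ring
          rw [h5] at h2
          have h6 : (Real.exp ν - 1) * ((i + 1 : ℕ) : ℝ) / k * m = (Real.exp ν - 1) * (x * m) := by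
            rw [hx]; ring
          have h7 : (Real.exp ν - 1) * (x * m) ≤ (ν + ν ^ 2) * (x * m) := by gcongr
          have h8 : -(ν * (F - x * m)) ≤ 1 := by
            refine (neg_le_abs _).trans ?_
            rw [abs_mul, hν]
            exact mul_le_one₀ hμ1 (abs_nonneg _) h2
          rw [h1, h6]
          have h9 : ν ^ 2 * (x * m) ≤ 1 := by
            calc ν ^ 2 * (x * m) = x * (ν ^ 2 * m) := by ring
              _ ≤ 1 := by rw [h4, mul_one]; exact hx1
          linarith
      _ ≤ eexp 2 := ((sublinear_drawMean _).mul _ _).trans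
          (mul_le_of_le_one_right' (drawMean_tilt_le hS hk hB hA ν))
  have hpos := signed (1 / r) (abs_of_nonneg (by positivity))
  have hneg := signed (-(1 / r)) (by rw [abs_neg, abs_of_nonneg (by positivity)])
  calc _ ≤ drawMean α S k N₀ (initialBuckets k lo m)
        (fun ω => eexp (1 / r * (boundaryShift ω.1.1 ω.2.1 i : ℤ)) +
          eexp (-(1 / r) * (boundaryShift ω.1.1 ω.2.1 i : ℤ))) := by
        refine (sublinear_drawMean _).mono _ _ fun ω => ?_
        rw [Nat.cast_natAbs, Int.cast_abs]
        rcases abs_cases ((boundaryShift ω.1.1 ω.2.1 i : ℤ) : ℝ) with h | h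
        · rw [h.1]
          exact le_self_add
        · rw [h.1, mul_neg, neg_mul]
          exact le_add_self
    _ ≤ eexp 2 + eexp 2 := ((sublinear_drawMean _).add _ _).trans (add_le_add hpos hneg)
    _ ≤ eexp 3 := by
        rw [show (3 : ℝ) = 1 + 2 by norm_num, eexp_add, ← two_mul]
        gcongr
        have := Real.add_one_le_exp 1
        calc (2 : ℝ≥0∞) = ENNReal.ofReal 2 := by simp
          _ ≤ _ := ENNReal.ofReal_le_ofReal (by linarith)

end ScatterShuffle

namespace ForkJoin.Comp

/-- Exponential moments of a sum of four dependent parts. -/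
lemma Sublinear.eexp_add_four {Ω : Type*} {Φ : (Ω → ℝ≥0∞) → ℝ≥0∞} (hΦ : Sublinear Φ)
    {f₁ f₂ f₃ f₄ : Ω → ℝ} {X₁ X₂ X₃ X₄ : ℝ}
    (h₁ : Φ (fun x => eexp (4 * f₁ x)) ≤ eexp (4 * X₁))
    (h₂ : Φ (fun x => eexp (4 * f₂ x)) ≤ eexp (4 * X₂))
    (h₃ : Φ (fun x => eexp (4 * f₃ x)) ≤ eexp (4 * X₃))
    (h₄ : Φ (fun x => eexp (4 * f₄ x)) ≤ eexp (4 * X₄)) :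
    Φ (fun x => eexp (f₁ x + f₂ x + f₃ x + f₄ x)) ≤ eexp (X₁ + X₂ + X₃ + X₄) := by
  have := hΦ.eexp_convex_two (v := 1 / 2) (w := 1 / 2) (by norm_num) (by norm_num) (by norm_num)
    (hΦ.eexp_convex_two (v := 1 / 2) (w := 1 / 2) (by norm_num) (by norm_num) (by norm_num) h₁ h₂)
    (hΦ.eexp_convex_two (v := 1 / 2) (w := 1 / 2) (by norm_num) (by norm_num) (by norm_num) h₃ h₄)
  ring_nf at this ⊢
  exact this

end ForkJoin.Comp

namespace ScatterShuffle
open ForkJoin ForkJoin.Comp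

variable {α : Type u} {κ : Exec → ℕ} {l p₀ : ℝ} {S : Samplers} {k N₀ lo m : ℕ} {B₀ : Buckets}

/-! ### The cost of distributing the items to the buckets -/

variable (α S k N₀) in
/-- The exponential mean over RoughScatter and FineScatter on the `m` cells that start at `lo`. -/
def cwpDistribute (κ : Exec → ℕ) (l : ℝ) (lo m : ℕ) (G : Buckets → ℝ≥0∞) : ℝ≥0∞ :=
  cwp κ l (parRoughScatter S k N₀ (initialBuckets k lo m) : Comp α Buckets) fun B =>
    cwp κ l (parFineScatter S k lo B : Comp α Buckets) G

lemma cwpDistribute_const_mul (b : ℝ≥0∞) (G : Buckets → ℝ≥0∞) :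
    cwpDistribute α S k N₀ κ l lo m (fun B => b * G B) = b * cwpDistribute α S k N₀ κ l lo m G := by
  simp only [cwpDistribute, cwp_const_mul]

lemma cwpDistribute_mono (hk : 2 ≤ k) {G G' : Buckets → ℝ≥0∞}
    (h : ∀ B, ∑ i ∈ Finset.range k, (B i).size = m → G B ≤ G' B) :
    cwpDistribute α S k N₀ κ l lo m G ≤ cwpDistribute α S k N₀ κ l lo m G' := by
  refine cwp_mono_of_post ((post_parRoughScatter (by omega) (allStaged_initialBuckets k lo m)).mono
    fun B _ hB => cwp_mono_of_post ((post_parFineScatter hk lo hB.valid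
      ((contiguous_initialBuckets k lo m).of_sameCells hB.same)).mono fun B' _ h' => h B' ?_))
  rw [← size_initialBuckets (show 0 < k by omega) lo m, ← hB.same.total_eq, ← h']
  rfl

lemma cwpDistribute_le (hκ : SeqCost κ) (hS : S.AcceptAtLeast p₀) (hl : 0 ≤ l)
    (hl' : l ≤ p₀ / 2) (hk : 2 ≤ k)
    {G : Buckets → ℝ≥0∞} {H : Buckets → (ℕ → ℕ) → ℝ≥0∞} {w : Buckets → (ℕ → ℕ) → ℝ}
    (hw : ∀ B N, Valid k B → Contiguous k B → ∑ i ∈ Finset.range k, N i = B.staged k →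
      Post (parTwoSweep k B N : Comp α Buckets) fun B' e => Swept k N B B' ∧ (κ e : ℝ) ≤ w B N)
    (hG : ∀ B N B', Swept k N B B' → G B' ≤ H B N) :
    cwpDistribute α S k N₀ κ l lo m G ≤
      drawMean α S k N₀ (initialBuckets k lo m) (fun ω => eexp (l * κ ω.1.2 +
        l * (8 * k + (costRate p₀ + 4) * ω.1.1.staged k) + l * κ ω.2.2 +
          l * w ω.1.1 ω.2.1) * H ω.1.1 ω.2.1) := by
  refine (cwp_mono_of_post ((post_parRoughScatter (by omega)
    (allStaged_initialBuckets k lo m)).mono fun B e h => cwp_parFineScatter_le hκ hS hl hl' hk lo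
      (hw B · h.valid ((contiguous_initialBuckets k lo m).of_sameCells h.same))
      (hG B))).trans (le_of_eq ?_)
  rw [cwp, drawMean]
  congr 1
  funext B e
  rw [cwp, ← wp_const_mul, ← wp_const_mul]
  congr 1
  funext N e'
  simp only [eexp_add]
  ring

lemma staged_le_staged (B : Buckets) {i : ℕ} (hi : i < k) : (B i).staged ≤ B.staged k :=
  Finset.single_le_sum (f := fun i => (B i).staged) (fun _ _ => Nat.zero_le _)
    (Finset.mem_range.2 hi)

/-- The largest number of staged items of a bucket before and after TwoSweep. -/
def maxStaged (k : ℕ) (B : Buckets) (N : ℕ → ℕ) : ℕ :=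
  (Finset.range k).sup fun i => max (B i).staged (N i)

lemma eexp_maxStaged_le (hk : 0 < k) (x : ℝ) (B : Buckets) (N : ℕ → ℕ) :
    eexp (x * maxStaged k B N) ≤
      ∑ i ∈ Finset.range k, (eexp (x * (B i).staged) + eexp (x * N i)) := by
  obtain ⟨i, hi, h⟩ := Finset.exists_mem_eq_sup (Finset.range k) (by simpa using hk.ne')
    fun i => max (B i).staged (N i)
  rw [maxStaged, h]
  refine le_trans ?_ (Finset.single_le_sum (f := fun i => eexp (x * (B i).staged) + eexp (x * N i))
    (fun _ _ => zero_le) hi)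
  rcases le_total (B i).staged (N i) with h | h
  · rw [max_eq_right h]
    exact le_add_self
  · rw [max_eq_left h]
    exact le_self_add

lemma drawMean_multinomial_le (hκ : SeqCost κ) (hS : S.AcceptAtLeast p₀) (hl : 0 ≤ l)
    (hl' : l ≤ p₀ / 2) (hk : 0 < k) :
    drawMean α S k N₀ B₀ (fun ω => eexp (l * κ ω.2.2)) ≤ eexp (l * (costRate p₀ * k)) := by
  refine (wp_mono fun B e => ?_).trans (wp_const_le _ _)
  have := cwp_multinomial_prod_le (α := α) hκ hS hl hl' hk (y := fun _ => 1) (by simp) (B.staged k)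
  simpa [cwp] using this

/-- The numbers of staged items of a single bucket, before and after TwoSweep, when the rate is
proportional to `k`. -/
lemma drawMean_bucket_staged_le (hS : S.AcceptAtLeast p₀) (hk : 2 ≤ k) (hm : k ^ 2 < m)
    (hl : 0 ≤ l) (hrate : (4 * l) ^ 2 * (m * k) ≤ rateBound p₀ ^ 2 * Real.log k) {i : ℕ}
    (hi : i < k) :
    drawMean α S k N₀ (initialBuckets k lo m)
        (fun ω => eexp (20 * l * k * (ω.1.1 i).staged)) ≤ eexp (2 * Real.log k) ∧
      drawMean α S k N₀ (initialBuckets k lo m)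
        (fun ω => eexp (20 * l * k * ω.2.1 i)) ≤ eexp (2 * Real.log k) := by
  have hk2 : (2 : ℝ) ≤ k := by exact_mod_cast hk
  have hk0 : (0 : ℝ) < k := by linarith
  have hm0 : (k : ℝ) ^ 2 ≤ m := by exact_mod_cast hm.le
  have hlog := half_le_log hk
  have hlogk : Real.log k ≤ k := (Real.log_le_sub_one_of_pos (by linarith)).trans (by linarith)
  have hε := rateBound_pos hS
  have hε' := rateBound_le' hS
  have hε2 : rateBound p₀ ^ 2 ≤ (1 / 72) ^ 2 := by gcongr
  have hrate' : (4 * l) ^ 2 * (m * k) ≤ (1 / 72) ^ 2 * Real.log k :=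
    hrate.trans (by gcongr)
  have hlk : 4 * l * k ≤ 1 / 72 := by
    refine le_of_sq_le_sq ?_ (by norm_num)
    have h1 : (4 * l) ^ 2 * (k ^ 2 * k) ≤ (1 / 72) ^ 2 * k :=
      (mul_le_mul_of_nonneg_left (mul_le_mul_of_nonneg_right hm0 hk0.le) (by positivity)).trans
        (hrate'.trans (by gcongr))
    have h2 : ((4 * l * k) ^ 2) * k ≤ (1 / 72) ^ 2 * k := by linarith
    exact le_of_mul_le_mul_right h2 hk0
  have hB := allStaged_initialBuckets k lo m
  have hbal := balanced_initialBuckets (show 0 < k by omega) lo m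
  have hsize := size_initialBuckets (show 0 < k by omega) lo m
  have hA : ({i} : Finset ℕ) ⊆ Finset.range k := by simpa using hi
  set x : ℝ := 20 * l * k with hx
  have hx0 : 0 ≤ x := by positivity
  have hx1 : x ≤ 5 / 72 := by linarith
  have hstaged : drawMean α S k N₀ (initialBuckets k lo m)
      (fun ω => eexp (80 * l * ω.1.1.staged k)) ≤ eexp (2 * Real.log k) := by
    refine (drawMean_fst_le (fun B _ => eexp (80 * l * B.staged k))).trans
      ((wp_staged_le hS (by omega) (by positivity) (by linarith) hB hbal).trans (eexp_mono ?_))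
    rw [hsize]
    nlinarith
  have hone : ∑ i ∈ Finset.range k, (fun _ : ℕ => (1 : ℝ≥0∞)) i ≤ k := by simp
  have half := fun {f : Draw → ℝ} (hf : drawMean α S k N₀ (initialBuckets k lo m)
      (fun ω => eexp (f ω)) ≤ eexp 0) =>
    (sublinear_drawMean (α := α) (S := S) (N₀ := N₀) (initialBuckets k lo m)).eexp_convex_two
      (v := 1 / 2) (w := 1 / 2) (by norm_num) (by norm_num) (by norm_num) hf hstaged
  constructor
  · have ht := drawMean_weight_le (α := α) (N₀ := N₀) hS (by omega) hB
      (sum_tilt_le (by omega) hA (-(2 * x))) hone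
    simp only [placedWeight, prod_tilt_pow hA, one_pow, Finset.prod_const_one, mul_one] at ht
    rw [← eexp_zero] at ht
    refine le_trans ?_ ((mul_le_mul' (le_refl (eexp (Real.log k))) (half ht)).trans ?_)
    · refine le_trans ?_ ((sublinear_drawMean _).mul _ _)
      refine drawMean_mono (by omega) hB fun B e N e' h hN => ?_
      rw [← eexp_add]
      apply eexp_mono
      have h1 : ((B i).placed : ℝ) + (B i).staged = (initialBuckets k lo m i).size := by
        rw [← h.same.size_eq hi, ← h.valid.placed_add_staged hi]
        push_cast
        rfl
      have h2 : ((∑ j ∈ Finset.range k, (B j).placed : ℕ) : ℝ) + B.staged k = m := by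
        have := h.valid.sum_placed_add_staged
        rw [h.same.total_eq, hsize] at this
        exact_mod_cast this
      have h3 : ((initialBuckets k lo m i).size : ℝ) ≤ m / k + 1 := by
        have hq : (initialBuckets k lo m i).size ≤ m / k + 1 := by
          have := Nat.add_div (a := i * m) (b := m) (show 0 < k by omega)
          simp only [initialBuckets, Bucket.size, add_one_mul]
          generalize (i * m + m) / k = x at *
          generalize i * m / k = y at *
          generalize m / k = z at *
          split_ifs at this <;> omega
        have hq' : ((m / k : ℕ) : ℝ) ≤ m / k := Nat.cast_div_le
        have : ((initialBuckets k lo m i).size : ℝ) ≤ ((m / k + 1 : ℕ) : ℝ) := by exact_mod_cast hq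
        push_cast at this
        linarith
      have h4 := exp_sub_one_le (x := -(2 * x)) (by rw [abs_neg, abs_of_nonneg] <;> linarith)
      simp only [Finset.sum_singleton, Finset.card_singleton, Nat.cast_one, mul_one]
      set P : ℝ := ((∑ j ∈ Finset.range k, (B j).placed : ℕ) : ℝ) with hP
      set R : ℝ := ((B.staged k : ℕ) : ℝ) with hR
      have hP0 : 0 ≤ P := by positivity
      have hR0 : 0 ≤ R := by positivity
      have h5 : (Real.exp (-(2 * x)) - 1) / k * P ≤ (-(2 * x) + (-(2 * x)) ^ 2) / k * P := by
        gcongr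
      have h6 : (-(2 * x) + (-(2 * x)) ^ 2) / k * P ≤
          -(2 * x) * (m / k) + 40 * l * R + 4 * x ^ 2 * (m / k) := by
        have e1 : (-(2 * x) + (-(2 * x)) ^ 2) / k * P =
          -(2 * x) * (m / k) + 2 * x / k * R + 4 * x ^ 2 / k * P := by
          rw [← h2]; field_simp; ring
        have e2 : 2 * x / k * R = 40 * l * R := by rw [hx]; field_simp; ring
        have e3 : 4 * x ^ 2 / k * P ≤ 4 * x ^ 2 / k * m := by
          gcongr
          linarith
        have e4 : 4 * x ^ 2 / k * m = 4 * x ^ 2 * (m / k) := by ring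
        linarith
      have h7 : 4 * x ^ 2 * (m / k) ≤ 1 / 10 * Real.log k := by
        have : 4 * x ^ 2 * (m / k) = 100 * ((4 * l) ^ 2 * (m * k)) := by
          rw [hx]; field_simp; ring
        rw [this]
        linarith
      have h8 : (2 * x) * (initialBuckets k lo m i).size ≤ 2 * x * (m / k + 1) := by gcongr
      have h9 : 0 ≤ l * R := by positivity
      have h10 : 2 * x * (B i).staged =
          2 * x * (initialBuckets k lo m i).size - 2 * x * (B i).placed := by
        rw [← h1]; ring
      linarith
    · rw [← eexp_add]
      apply eexp_mono
      linarith
  · have ht := drawMean_weight_le (α := α) (N₀ := N₀) hS (by omega) hB hone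
      (sum_tilt_le (by omega) hA (2 * x))
    simp only [placedWeight, prod_tilt_pow hA, one_pow, Finset.prod_const_one, one_mul] at ht
    rw [← eexp_zero] at ht
    refine le_trans ?_ ((half ht).trans ?_)
    · refine drawMean_mono (by omega) hB fun B e N e' h hN => ?_
      apply eexp_mono
      rw [hN]
      have h4 := exp_sub_one_le (x := 2 * x) (by rw [abs_of_nonneg] <;> linarith)
      simp only [Finset.sum_singleton, Finset.card_singleton, Nat.cast_one, mul_one]
      set R : ℝ := ((B.staged k : ℕ) : ℝ) with hR
      have hR0 : 0 ≤ R := by positivity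
      have h5 : (Real.exp (2 * x) - 1) / k * R ≤ (4 * x) / k * R := by
        gcongr
        nlinarith
      have e2 : 4 * x / k * R = 80 * l * R := by rw [hx]; field_simp; ring
      linarith
    · apply eexp_mono
      linarith

/-- The parallel depth of distributing the items to the buckets. The rate is of the order
`√(log k / (m * k))`. -/
lemma cwpDistribute_span_le (hS : S.AcceptAtLeast p₀) (hk : 2 ≤ k) (hN : k ^ 2 ≤ N₀)
    (hm : N₀ < m) (hl : 0 ≤ l)
    (hrate : (4 * l) ^ 2 * (m * k) ≤ rateBound p₀ ^ 2 * Real.log k) :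
    cwpDistribute α S k N₀ Exec.span l lo m (fun _ => 1) ≤
      eexp (6 * Real.log k + (2 * costRate p₀ + 15) * (l * N₀)) := by
  have hk2 : (2 : ℝ) ≤ k := by exact_mod_cast hk
  have hk0 : (0 : ℝ) < k := by linarith
  have hm2 : k ^ 2 < m := hN.trans_lt hm
  have hm0 : (k : ℝ) ^ 2 ≤ m := by exact_mod_cast hm2.le
  have hN0 : (k : ℝ) ^ 2 ≤ N₀ := by exact_mod_cast hN
  have hm1 : (1 : ℝ) ≤ m := by nlinarith
  have hlog := half_le_log hk
  have hlogk : Real.log k ≤ k := (Real.log_le_sub_one_of_pos (by linarith)).trans (by linarith)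
  have hg := four_le_costRate hS
  have hε := rateBound_pos hS
  have h4l : 4 * l ≤ p₀ / 2 := (rate_le_of_sq_le hS hk hm1 hrate).trans (rateBound_le hS)
  have hB := allStaged_initialBuckets k lo m
  have hbal := balanced_initialBuckets (show 0 < k by omega) lo m
  have hsize := size_initialBuckets (show 0 < k by omega) lo m
  refine (cwpDistribute_le (H := fun _ _ => 1)
    (w := fun B N => 9 * k ^ 2 + 5 * k * maxStaged k B N) seqCost_span hS hl (by linarith) hk
    (fun B N hBv hBc hN => ?_) fun _ _ _ _ => le_rfl).trans ?_
  · refine (post_parTwoSweep hk hBv hBc hN (m := maxStaged k B N) (fun i hi => ?_)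
      fun i hi => ?_).mono fun B' e h => ⟨h.1, by exact_mod_cast h.2.1⟩
    · exact (le_max_right _ _).trans (Finset.le_sup (f := fun i => max (B i).staged (N i))
        (Finset.mem_range.2 hi))
    · exact (le_max_left _ _).trans (Finset.le_sup (f := fun i => max (B i).staged (N i))
        (Finset.mem_range.2 hi))
  -- The cost of TwoSweep is split into its certain and its random part.
  have hsplit : ∀ ω : Draw, l * Exec.span ω.1.2 + l * (8 * k + (costRate p₀ + 4) * ω.1.1.staged k) +
      l * Exec.span ω.2.2 + l * (9 * k ^ 2 + 5 * k * maxStaged k ω.1.1 ω.2.1) =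
      l * Exec.span ω.1.2 + l * (8 * k + 9 * k ^ 2 + (costRate p₀ + 4) * ω.1.1.staged k) +
      l * Exec.span ω.2.2 + 5 * l * k * maxStaged k ω.1.1 ω.2.1 := fun ω => by ring
  simp only [hsplit, mul_one]
  have hΦ := sublinear_drawMean (α := α) (S := S) (N₀ := N₀) (k := k) (initialBuckets k lo m)
  refine (hΦ.eexp_add_four (X₁ := (14 * Real.log k + 4 * l * ((costRate p₀ + 2) * N₀)) / 4)
    (X₂ := l * (13 * N₀) + Real.log k / 2) (X₃ := l * (costRate p₀ * N₀)) (X₄ := Real.log k)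
    ?_ ?_ ?_ ?_).trans (eexp_mono ?_)
  · have := cwp_span_parRoughScatterAux_le (α := α) hS hk hN m hB hbal (l := 4 * l) (by positivity)
      (by rw [hsize]; omega) (by rw [hsize]; omega) (by rw [hsize]; exact hrate)
    rw [mul_div_cancel₀ _ (by norm_num : (4 : ℝ) ≠ 0)]
    simp only [← mul_assoc]
    refine (drawMean_fst_le (fun _ e => eexp (4 * l * Exec.span e))).trans ?_
    rw [parRoughScatter, hsize]
    simpa [cwp, mul_assoc] using this
  · set μ : ℝ := 4 * l * (costRate p₀ + 4) with hμ
    have hμ0 : 0 ≤ μ := by positivity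
    have hgε : (costRate p₀ + 4) * rateBound p₀ ≤ 1 / 6 := by
      have := rateBound_mul hS
      nlinarith
    have hμ2 : μ ^ 2 * (m * k) ≤ (1 / 6) ^ 2 * Real.log k := by
      calc μ ^ 2 * (m * k) = (costRate p₀ + 4) ^ 2 * ((4 * l) ^ 2 * (m * k)) := by rw [hμ]; ring
        _ ≤ (costRate p₀ + 4) ^ 2 * (rateBound p₀ ^ 2 * Real.log k) := by gcongr
        _ = ((costRate p₀ + 4) * rateBound p₀) ^ 2 * Real.log k := by ring
        _ ≤ _ := by gcongr
    have hμk : μ * k ≤ 1 / 6 := by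
      refine le_of_sq_le_sq ?_ (by norm_num)
      have h1 : μ ^ 2 * (k ^ 2 * k) ≤ (1 / 6) ^ 2 * k :=
        (mul_le_mul_of_nonneg_left (mul_le_mul_of_nonneg_right hm0 hk0.le) (by positivity)).trans
          (hμ2.trans (by gcongr))
      have h2 : (μ * k) ^ 2 * k ≤ (1 / 6) ^ 2 * k := by linarith
      exact le_of_mul_le_mul_right h2 hk0
    have := wp_staged_le (α := α) (N₀ := N₀) hS (by omega) hμ0 (by linarith) hB hbal
    calc _ = drawMean α S k N₀ (initialBuckets k lo m) (fun ω => eexp (4 * l * (8 * k + 9 * k ^ 2)) *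
          eexp (μ * ω.1.1.staged k)) := by
          congr 1
          funext ω
          rw [← eexp_add, hμ]
          congr 1
          ring
      _ ≤ eexp (4 * l * (8 * k + 9 * k ^ 2)) *
          eexp (Real.log k + (μ * k + μ ^ 2 * ((initialBuckets k lo m).size k * k))) := by
          refine (hΦ.mul _ _).trans (mul_le_mul' le_rfl ?_)
          exact (drawMean_fst_le (fun B _ => eexp (μ * B.staged k))).trans this
      _ ≤ _ := by
          rw [← eexp_add, hsize]
          apply eexp_mono
          have h1 : 8 * (k : ℝ) + 9 * k ^ 2 ≤ 13 * N₀ := by nlinarith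
          have h2 : l * (8 * k + 9 * k ^ 2) ≤ l * (13 * N₀) := by gcongr
          linarith
  · simp only [← mul_assoc]
    refine (drawMean_multinomial_le seqCost_span hS (by positivity) h4l (by omega)).trans
      (eexp_mono ?_)
    have : (k : ℝ) ≤ N₀ := by nlinarith
    simp only [mul_assoc]
    gcongr
  · have hb := fun i (hi : i ∈ Finset.range k) => drawMean_bucket_staged_le (α := α) (lo := lo)
      (N₀ := N₀) hS hk hm2 hl hrate (Finset.mem_range.1 hi)
    refine (hΦ.mono _ _ fun ω => ?_).trans ((hΦ.sum (Finset.range k) fun i ω =>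
      eexp (20 * l * k * (ω.1.1 i).staged) + eexp (20 * l * k * ω.2.1 i)).trans
      ((Finset.sum_le_sum fun i hi => (hΦ.add _ _).trans (add_le_add (hb i hi).1 (hb i hi).2)).trans
        ?_))
    · refine le_trans (le_of_eq ?_) (eexp_maxStaged_le (by omega) (20 * l * k) ω.1.1 ω.2.1)
      congr 1
      ring
    · rw [Finset.sum_const, Finset.card_range, nsmul_eq_mul, ← two_mul,
        show 4 * Real.log k = Real.log k + (Real.log k + 2 * Real.log k) by ring, eexp_add,
        eexp_add, eexp_log_natCast (by omega)]
      gcongr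
      exact_mod_cast hk
  · linarith

/-- The number of instructions per item for distributing the items to the buckets. -/
def distributeRate (p₀ : ℝ) : ℝ := 4 * costRate p₀ + 2 * workGain p₀ + 45

/-- The work of distributing the items to the buckets. The rate is of the order `1 / (k * √m)`. -/
lemma cwpDistribute_work_le (hS : S.AcceptAtLeast p₀) (hk : 2 ≤ k) (hN : k ^ 2 ≤ N₀)
    (hm : N₀ < m) (hl : 0 ≤ l) (hrate : 4 * l * (k * √m) ≤ rateBound p₀) :
    cwpDistribute α S k N₀ Exec.work l lo m (fun _ => 1) ≤
      eexp (l * (distributeRate p₀ * m)) := by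
  have hk2 : (2 : ℝ) ≤ k := by exact_mod_cast hk
  have hk0 : (0 : ℝ) < k := by linarith
  have hm2 : k ^ 2 < m := hN.trans_lt hm
  have hm0 : (k : ℝ) ^ 2 ≤ m := by exact_mod_cast hm2.le
  have hm1 : (1 : ℝ) ≤ m := by nlinarith
  have hlogk : Real.log k ≤ k - 1 := Real.log_le_sub_one_of_pos (by linarith)
  have hg := four_le_costRate hS
  have hε := rateBound_pos hS
  have hε' := rateBound_le' hS
  set r := √(m : ℝ) with hr
  have hrr : r * r = m := Real.mul_self_sqrt (by linarith)
  have hkr : (k : ℝ) ≤ r := Real.le_sqrt_of_sq_le hm0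
  have hr0 : 0 < r := by linarith
  have hlr : 4 * l * r ≤ rateBound p₀ := by
    refine le_trans ?_ hrate
    gcongr
    exact le_mul_of_one_le_left hr0.le (by linarith)
  have h4l : 4 * l ≤ p₀ / 2 := by
    refine le_trans (le_mul_of_one_le_right (by positivity) ?_) (hlr.trans (rateBound_le hS))
    linarith
  have hB := allStaged_initialBuckets k lo m
  have hbal := balanced_initialBuckets (show 0 < k by omega) lo m
  have hsize := size_initialBuckets (show 0 < k by omega) lo m
  refine (cwpDistribute_le (H := fun _ _ => 1)
    (w := fun B N => 12 * k ^ 2 + 5 * ∑ i ∈ Finset.range k, ((boundaryShift B N i).natAbs : ℝ))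
    seqCost_work hS hl (by linarith) hk
    (fun B N hBv hBc hN => ?_) fun _ _ _ _ => le_rfl).trans ?_
  · refine (post_parTwoSweep hk hBv hBc hN (m := B.staged k) (fun i hi => ?_)
      fun i hi => staged_le_staged B hi).mono fun B' e h => ⟨h.1, by exact_mod_cast h.2.2⟩
    rw [← hN]
    exact Finset.single_le_sum (f := N) (fun _ _ => Nat.zero_le _) (Finset.mem_range.2 hi)
  -- The cost of TwoSweep is split into its certain and its random part.
  have hsplit : ∀ ω : Draw, l * Exec.work ω.1.2 + l * (8 * k + (costRate p₀ + 4) * ω.1.1.staged k) +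
      l * Exec.work ω.2.2 +
        l * (12 * k ^ 2 + 5 * ∑ i ∈ Finset.range k, ((boundaryShift ω.1.1 ω.2.1 i).natAbs : ℝ)) =
      l * Exec.work ω.1.2 + l * (8 * k + 12 * k ^ 2 + (costRate p₀ + 4) * ω.1.1.staged k) +
      l * Exec.work ω.2.2 +
        5 * l * ∑ i ∈ Finset.range k, ((boundaryShift ω.1.1 ω.2.1 i).natAbs : ℝ) :=
    fun ω => by ring
  simp only [hsplit, mul_one]
  have hΦ := sublinear_drawMean (α := α) (S := S) (N₀ := N₀) (k := k) (initialBuckets k lo m)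
  refine (hΦ.eexp_add_four (X₁ := l * ((costRate p₀ + 6 + 2 * workGain p₀) * m))
    (X₂ := l * ((2 * costRate p₀ + 24) * m)) (X₃ := l * (costRate p₀ * m)) (X₄ := l * (15 * m))
    ?_ ?_ ?_ ?_).trans (eexp_mono ?_)
  · have := cwp_work_parRoughScatterAux_le (α := α) hS hk hN m hB hbal (l := 4 * l) (by positivity)
      (by rw [hsize]; omega) (by rw [hsize]; omega)
      (by rw [hsize, ← hrr, show (4 * l) ^ 2 * (r * r) = (4 * l * r) ^ 2 by ring]; gcongr)
    simp only [← mul_assoc]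
    refine (drawMean_fst_le (fun _ e => eexp (4 * l * Exec.work e))).trans ?_
    rw [parRoughScatter, hsize]
    simp only [cwp, mul_one] at this
    refine this.trans (eexp_mono ?_)
    rw [hsize]
    have hw : 0 ≤ workGain p₀ * (k * √(m : ℝ)) := by
      rw [workGain]
      positivity
    rw [mul_assoc (4 * l)]
    gcongr
    linarith
  · set v : ℝ := 4 * l * (costRate p₀ + 4) * r with hv
    have hv0 : 0 ≤ v := by positivity
    have hv1 : v ≤ 1 := by
      have h1 := rateBound_mul hS
      have h2 : v = (costRate p₀ + 4) * (4 * l * r) := by rw [hv]; ring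
      have h3 : v ≤ (costRate p₀ + 4) * rateBound p₀ := by
        rw [h2]
        gcongr
      nlinarith
    have hst := wp_staged_le (α := α) (N₀ := N₀) hS (by omega) (μ := 1 / r) (by positivity)
      (by rw [one_div_mul_eq_div, div_le_one hr0]; exact hkr) hB hbal
    have hst' := hΦ.eexp_mul hv0 hv1
      ((drawMean_fst_le (fun B _ => eexp (1 / r * B.staged k))).trans hst)
    calc _ = drawMean α S k N₀ (initialBuckets k lo m)
          (fun ω => eexp (4 * l * (8 * k + 12 * k ^ 2)) *
          eexp (v * (1 / r * ω.1.1.staged k))) := by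
          congr 1
          funext ω
          rw [← eexp_add, hv]
          congr 1
          field_simp
      _ ≤ eexp (4 * l * (8 * k + 12 * k ^ 2)) * eexp (v * (Real.log k + (1 / r * k +
          (1 / r) ^ 2 * ((initialBuckets k lo m).size k * k)))) :=
          (hΦ.mul _ _).trans (mul_le_mul' le_rfl hst')
      _ ≤ _ := by
          rw [← eexp_add, hsize]
          apply eexp_mono
          have h1 : 8 * (k : ℝ) + 12 * k ^ 2 ≤ 16 * m := by nlinarith
          have h2 : l * (8 * k + 12 * k ^ 2) ≤ l * (16 * m) := by gcongr
          have h3 : (1 / r) ^ 2 * (m * k) = k := by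
            rw [← hrr]
            field_simp
          have h4 : 1 / r * k ≤ 1 := by rw [one_div_mul_eq_div, div_le_one hr0]; exact hkr
          have h5 : v * (Real.log k + (1 / r * k + (1 / r) ^ 2 * (m * k))) ≤ v * (2 * r) := by
            gcongr
            linarith
          have h6 : v * (2 * r) = 4 * (l * ((2 * costRate p₀ + 8) * m)) := by
            rw [hv, ← hrr]
            ring
          linarith
  · simp only [← mul_assoc]
    refine (drawMean_multinomial_le seqCost_work hS (by positivity) h4l (by omega)).trans
      (eexp_mono ?_)
    have : (k : ℝ) ≤ m := by nlinarith
    simp only [mul_assoc]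
    gcongr
  · set x : ℝ := 20 * l * k * r with hx
    have hx0 : 0 ≤ x := by positivity
    have hx1 : x ≤ 1 := by
      have : x = 5 * (4 * l * (k * r)) := by rw [hx]; ring
      linarith
    have hD := hΦ.eexp_convex (Finset.range k) (fun _ => 1 / (k : ℝ)) (fun _ => x * 3)
      (fun i ω => x * (1 / r * (boundaryShift ω.1.1 ω.2.1 i).natAbs))
      (fun _ _ => by positivity) (by simp [hk0.ne'])
      fun i hi => hΦ.eexp_mul hx0 hx1
        (drawMean_boundaryShift_le hS (by omega) (by omega) (Finset.mem_range.1 hi))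
    refine (le_of_eq ?_).trans (hD.trans (eexp_mono ?_))
    · congr 1
      funext ω
      congr 1
      rw [Finset.mul_sum, Finset.mul_sum]
      refine Finset.sum_congr rfl fun i _ => ?_
      rw [hx]
      field_simp
      ring
    · rw [Finset.sum_const, Finset.card_range, nsmul_eq_mul, ← mul_assoc,
        mul_one_div_cancel hk0.ne', one_mul, hx]
      have : k * r ≤ r * r := by gcongr
      rw [← hrr]
      nlinarith
  · rw [distributeRate]
    linarith

/-- The sum of the squares of the bucket sizes after distributing the items. -/
lemma cwpDistribute_sum_sq_le (hS : S.AcceptAtLeast p₀) (hk : 2 ≤ k) (hN : k ^ 2 ≤ N₀)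
    (hm : N₀ < m) :
    cwpDistribute α S k N₀ Exec.work 0 lo m
      (fun B' => ∑ i ∈ Finset.range k, ((B' i).size : ℝ≥0∞) ^ 2) ≤
      ENNReal.ofReal (1.86 / k) * (m : ℝ≥0∞) ^ 2 := by
  have hp := hS.pos
  have hB := allStaged_initialBuckets k lo m
  have hsize := size_initialBuckets (show 0 < k by omega) lo m
  have := cwpDistribute_le (α := α) (N₀ := N₀) (lo := lo) (m := m) (l := 0) (w := fun B N => 12 * k ^ 2 +
      5 * ∑ i ∈ Finset.range k, ((boundaryShift B N i).natAbs : ℝ))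
    (G := fun B' => ∑ i ∈ Finset.range k, ((B' i).size : ℝ≥0∞) ^ 2)
    (H := fun B N => ∑ i ∈ Finset.range k, (((B i).placed + N i : ℕ) : ℝ≥0∞) ^ 2)
    seqCost_work hS le_rfl (by positivity) hk
    (fun B N hBv hBc hN => ?_) fun B N B' h => ?_
  · refine this.trans ?_
    simp only [zero_mul, add_zero, eexp_zero, one_mul]
    have := drawMean_sum_sq_le (α := α) (N₀ := N₀) hS hk hB (by rw [hsize]; omega)
    rw [hsize] at this
    exact this
  · refine (post_parTwoSweep hk hBv hBc hN (m := B.staged k) (fun i hi => ?_)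
      fun i hi => ?_).mono fun B' e h => ⟨h.1, by exact_mod_cast h.2.2⟩
    · rw [← hN]
      exact Finset.single_le_sum (f := N) (fun _ _ => Nat.zero_le _) (Finset.mem_range.2 hi)
    · exact staged_le_staged B hi
  · refine (Finset.sum_congr rfl fun i hi => ?_).le
    have hi := Finset.mem_range.1 hi
    rw [← h.placed i hi, ← h.staged i hi, h.valid.placed_add_staged hi]

end ScatterShuffle

namespace ForkJoin.Comp

variable {α : Type u} {β γ : Type} {κ : Exec → ℕ} {l : ℝ}

/-! ### The cost of parallel loops -/

lemma cwp_one_bind_pure_le (hκ : SeqCost κ) (c : Comp α β) :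
    cwp κ l (c >>= fun _ => pure ()) (fun _ => 1) ≤ cwp κ l c (fun _ => 1) :=
  (cwp_bind_le hκ _ _ _).trans (cwp_mono fun _ => cwp_pure_le hκ _ _)

lemma cwp_span_parLoop_le (hl : 0 ≤ l) {lo len : ℕ} (hlen : 1 ≤ len) (f : ℕ → Comp α Unit) :
    cwp Exec.span l (parLoop lo len f) (fun _ => 1) ≤
      eexp (l * (3 * len)) *
        ∑ i ∈ Finset.Ico lo (lo + len), cwp Exec.span l (f i) (fun _ => 1) := by
  induction len using Nat.strong_induction_on generalizing lo with
  | _ len ih =>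
    rcases hlen.eq_or_lt with rfl | h2
    · rw [parLoop_one]
      refine (cwp_tick_bind_le seqCost_span _ _ _).trans ?_
      rw [Nat.Ico_succ_singleton, Finset.sum_singleton]
      gcongr
      apply eexp_mono
      push_cast
      linarith
    · rw [parLoop_of_two_le h2]
      have part : ∀ a b, 1 ≤ b → b < len →
          cwp Exec.span l (frame 4 (parLoop a b f)) (fun _ => 1) ≤ eexp (l * (3 * len - 3)) *
            ∑ i ∈ Finset.Ico a (a + b), cwp Exec.span l (f i) (fun _ => 1) := by
        intro a b h1 hb
        refine (cwp_frame_le seqCost_span _ _ _).trans ((ih b hb h1).trans ?_)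
        gcongr
        apply eexp_mono
        have : (b : ℝ) + 1 ≤ len := by exact_mod_cast hb
        gcongr
        linarith
      refine (cwp_tick_bind_le seqCost_span _ _ _).trans ((mul_le_mul' le_rfl
        ((cwp_one_bind_pure_le seqCost_span _).trans ((cwp_span_fork_le _ _).trans (mul_le_mul'
          le_rfl (add_le_add (part _ _ (by omega) (by omega))
            (part _ _ (by omega) (by omega))))))).trans ?_)
      rw [← mul_add, sum_Ico_halves, ← mul_assoc, ← mul_assoc, ← eexp_add, ← eexp_add]
      gcongr
      apply eexp_mono
      push_cast
      linarith

lemma cwp_work_parLoop_le {lo len : ℕ} (hlen : 1 ≤ len) (f : ℕ → Comp α Unit) :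
    cwp Exec.work l (parLoop lo len f) (fun _ => 1) ≤
      eexp (l * (3 * len - 2)) *
        ∏ i ∈ Finset.Ico lo (lo + len), cwp Exec.work l (f i) (fun _ => 1) := by
  induction len using Nat.strong_induction_on generalizing lo with
  | _ len ih =>
    rcases hlen.eq_or_lt with rfl | h2
    · rw [parLoop_one]
      refine (cwp_tick_bind_le seqCost_work _ _ _).trans (le_of_eq ?_)
      rw [Nat.Ico_succ_singleton, Finset.prod_singleton]
      norm_num
    · rw [parLoop_of_two_le h2]
      have h1 := (cwp_frame_le seqCost_work 4 (parLoop lo (len / 2) f) (fun _ => 1)).trans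
        (ih (len / 2) (by omega) (by omega))
      have h2 := (cwp_frame_le seqCost_work 4 (parLoop (lo + len / 2) (len - len / 2) f)
        (fun _ => 1)).trans (ih (len - len / 2) (by omega) (by omega))
      refine (cwp_tick_bind_le seqCost_work _ _ _).trans ((mul_le_mul' le_rfl
        ((cwp_one_bind_pure_le seqCost_work _).trans (cwp_work_fork_le _ _ _))).trans ?_)
      have h3 := cwp_const_mul (κ := Exec.work) (l := l) (frame 4 (parLoop lo (len / 2) f))
        (cwp Exec.work l (frame 4 (parLoop (lo + len / 2) (len - len / 2) f)) fun _ => 1) (fun _ => 1)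
      simp only [mul_one] at h3
      rw [h3]
      refine (mul_le_mul' le_rfl (mul_le_mul' le_rfl (mul_le_mul' h2 h1))).trans (le_of_eq ?_)
      rw [← Finset.prod_Ico_consecutive _ (show lo ≤ lo + len / 2 by omega)
        (show lo + len / 2 ≤ lo + len by omega), show lo + len / 2 + (len - len / 2) = lo + len by omega,
        show l * (3 * (len : ℝ) - 2) = l * (1 : ℕ) + (l + (l * (3 * ((len / 2 : ℕ) : ℝ) - 2) +
          l * (3 * ((len - len / 2 : ℕ) : ℝ) - 2))) by
          rw [Nat.cast_sub (Nat.div_le_self _ _)]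
          push_cast
          ring, eexp_add, eexp_add, eexp_add]
      ring

/-! ### Auxiliary memory -/

end ForkJoin.Comp

namespace ForkJoin

/-- The execution uses at most `A` words of memory, and `P` more for every active subtask. -/
def Exec.MemLe (P A : ℕ) (E : Exec) : Prop := ∀ t m, E.Config t m → m ≤ A + P * t

namespace Exec
variable {P A A' w : ℕ} {a b : Exec}

lemma MemLe.mono (h : a.MemLe P A) (hA : A ≤ A') : a.MemLe P A' :=
  fun t m hc => (h t m hc).trans (by gcongr)

lemma memLe_done : done.MemLe P A := fun _ _ hc => by cases hc; omega

lemma memLe_step : step.MemLe P A := fun _ _ hc => by cases hc; omega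

lemma MemLe.seq (ha : a.MemLe P A) (hb : b.MemLe P A) : (seq a b).MemLe P A := fun t m hc => by
  cases hc with
  | seqLeft h => exact ha _ _ h
  | seqRight h => exact hb _ _ h

lemma memLe_steps (n : ℕ) : (steps n).MemLe P A := by
  induction n with
  | zero => exact memLe_done
  | succ n ih => exact memLe_step.seq ih

lemma MemLe.frame (h : a.MemLe P A) : (Exec.frame w a).MemLe P (A + w) := fun t m hc => by
  cases hc with
  | frame hc =>
    have := h _ _ hc
    omega

/-- The memory of the two branches is paid for by the subtasks. -/
lemma MemLe.fork (ha : a.MemLe P P) (hb : b.MemLe P P) : (fork a b).MemLe P A := fun t m hc => by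
  cases hc with
  | forkNone => omega
  | forkLeft h =>
    have := ha _ _ h
    rw [mul_add]
    omega
  | forkRight h =>
    have := hb _ _ h
    rw [mul_add]
    omega
  | forkBoth h h' =>
    have := ha _ _ h
    have := hb _ _ h'
    rw [mul_add, mul_add]
    omega

end Exec

namespace Comp

variable {α : Type u} {β γ : Type} {P A A' w n : ℕ}

/-- All executions of the program satisfy the bound on the memory. -/
def MemLe (P A : ℕ) (c : Comp α β) : Prop := Post c fun _ e => e.MemLe P A

lemma MemLe.mono {c : Comp α β} (h : MemLe P A c) (hA : A ≤ A') : MemLe P A' c :=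
  Post.mono h fun _ _ he => he.mono hA

lemma memLe_pure (x : β) : MemLe P A (pure x : Comp α β) := post_pure Exec.memLe_done

lemma memLe_tick (n : ℕ) : MemLe P A (tick n : Comp α Unit) := post_tick (Exec.memLe_steps n)

lemma memLe_swap (i j : ℕ) : MemLe P A (swap i j : Comp α Unit) := post_swap Exec.memLe_step

lemma memLe_rejection (p : I) (μ : PMF ℕ) : MemLe P A (rejection p μ : Comp α ℕ) :=
  post_rejection fun _ _ _ => Exec.memLe_steps _

lemma MemLe.bind {c : Comp α β} {f : β → Comp α γ} (hc : MemLe P A c) (hf : ∀ x, MemLe P A (f x)) :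
    MemLe P A (c >>= f) :=
  Post.bind hc fun x _ he => Post.mono (hf x) fun _ _ he' => he.seq he'

lemma MemLe.frame {c : Comp α β} (h : MemLe P A c) : MemLe P (A + w) (frame w c) :=
  Post.frame (Post.mono h fun _ _ he => he.frame)

lemma MemLe.fork {c : Comp α β} {d : Comp α γ} (hc : MemLe P P c) (hd : MemLe P P d) :
    MemLe P A (fork c d) :=
  Post.fork hc hd fun _ _ _ _ he he' => he.fork he'

lemma memLe_loop {f : ℕ → Comp α Unit} (hf : ∀ i, MemLe P A (f i)) (n : ℕ) :
    MemLe P A (loop n f) := by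
  induction n with
  | zero => exact memLe_pure _
  | succ n ih => exact ih.bind fun _ => (memLe_tick 1).bind fun _ => hf n

/-- The memory of the iterations of a parallel loop that forks is paid for by the subtasks. -/
lemma memLe_parLoop {f : ℕ → Comp α Unit} (hf : ∀ i, MemLe P A (f i)) (hA : A + 4 ≤ P) (lo : ℕ)
    {len : ℕ} (h : 2 ≤ len ∨ A ≤ A') : MemLe P A' (parLoop lo len f) := by
  induction len using Nat.strong_induction_on generalizing lo A' with
  | _ len ih =>
    rcases Nat.lt_or_ge len 2 with h2 | h2
    · have hA' : A ≤ A' := by omega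
      interval_cases len
      · rw [parLoop_zero]
        exact memLe_tick _
      · rw [parLoop_one]
        exact (memLe_tick _).bind fun _ => (hf _).mono hA'
    · rw [parLoop_of_two_le h2]
      refine (memLe_tick _).bind fun _ => MemLe.bind ?_ fun _ => memLe_pure _
      exact MemLe.fork ((ih _ (by omega) _ (Or.inr le_rfl)).frame.mono hA)
        ((ih _ (by omega) _ (Or.inr le_rfl)).frame.mono hA)

end Comp

end ForkJoin

namespace ScatterShuffle
open ForkJoin ForkJoin.Comp

variable {α : Type u} {κ : Exec → ℕ} {l p₀ : ℝ} {S : Samplers} {k N₀ P A n : ℕ}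

lemma memLe_fisherYates (lo n : ℕ) : MemLe P A (fisherYates S lo n : Comp α Unit) := by
  induction n with
  | zero => exact memLe_tick _
  | succ n ih =>
    match n, ih with
    | 0, _ => exact memLe_tick _
    | n + 1, ih =>
      exact (memLe_rejection _ _).bind fun _ => (memLe_swap _ _).bind fun _ =>
        (memLe_tick _).bind fun _ => ih

lemma memLe_roughScatterLoop (t : ℕ) (B : Buckets) :
    MemLe P A (roughScatterLoop S k t B : Comp α Buckets) := by
  induction t generalizing B with
  | zero => exact memLe_pure _
  | succ t ih =>
    refine (memLe_rejection _ _).bind fun _ => (memLe_swap _ _).bind fun _ =>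
      (memLe_tick _).bind fun _ => ?_
    dsimp only
    split_ifs
    · exact memLe_pure _
    · exact ih _

lemma memLe_roughScatter (B : Buckets) : MemLe P A (roughScatter S k B : Comp α Buckets) := by
  refine (memLe_tick _).bind fun _ => ?_
  split_ifs
  · exact memLe_pure _
  · exact memLe_roughScatterLoop _ _

lemma memLe_mergeHalves (L R : Buckets) : MemLe P A (mergeHalves k L R : Comp α Buckets) :=
  (memLe_loop (fun _ => (memLe_tick _).bind fun _ => memLe_loop (fun _ => memLe_swap _ _) _) _).bind
    fun _ => memLe_pure _

lemma memLe_parRoughScatterAux (hP : 3 * k + 8 ≤ P) (h : ℕ) (B : Buckets) :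
    MemLe P 0 (parRoughScatterAux S k N₀ h B : Comp α Buckets) := by
  induction h generalizing B with
  | zero => exact memLe_roughScatter B
  | succ h ih =>
    refine (memLe_tick _).bind fun _ => ?_
    split_ifs
    · exact memLe_roughScatter B
    · refine (memLe_tick _).bind fun _ => MemLe.bind ?_ fun _ => (memLe_mergeHalves _ _).bind
        fun _ => memLe_roughScatter _
      exact MemLe.fork ((ih _).frame.mono (by omega)) ((ih _).frame.mono (by omega))

lemma memLe_multinomial (d R : ℕ) (N : ℕ → ℕ) :
    MemLe P A (multinomial S k d R N : Comp α (ℕ → ℕ)) := by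
  induction d generalizing R N with
  | zero => exact memLe_pure _
  | succ d ih => exact (memLe_rejection _ _).bind fun _ => (memLe_tick _).bind fun _ => ih _ _

lemma memLe_parTwoSweep (hP : 4 ≤ P) (B : Buckets) (N : ℕ → ℕ) :
    MemLe P 0 (parTwoSweep k B N : Comp α Buckets) := by
  have hmove : ∀ (B : Buckets) (i : ℕ) (t : ℤ), MemLe P 0 (moveBoundary B i t : Comp α Unit) := by
    intro B i t
    rw [moveBoundary]
    split_ifs <;> exact memLe_loop (fun _ => (memLe_swap _ _).bind fun _ => memLe_tick _) _
  have hrounds : ∀ (r : ℕ) (B : Buckets) (D : ℕ → ℤ),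
      MemLe P 0 (sweepRounds k r B D : Comp α Buckets) := by
    intro r
    induction r with
    | zero => exact fun _ _ => memLe_pure _
    | succ r ih =>
      exact fun B D => (memLe_parLoop (fun _ => memLe_tick _) (by omega) _ (Or.inr le_rfl)).bind
        fun _ => (memLe_parLoop (fun _ => hmove _ _ _) (by omega) _ (Or.inr le_rfl)).bind
          fun _ => ih _ _
  exact (memLe_tick _).bind fun _ => hrounds _ _ _

lemma memLe_shuffleStaged (lo : ℕ) (B : Buckets) :
    MemLe P A (shuffleStaged S k lo B : Comp α Unit) :=
  (memLe_loop (fun _ => (memLe_tick _).bind fun _ => memLe_loop (fun _ => memLe_swap _ _) _) _).bind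
    fun _ => (memLe_fisherYates _ _).bind fun _ =>
      memLe_loop (fun _ => (memLe_tick _).bind fun _ => memLe_loop (fun _ => memLe_swap _ _) _) _

lemma memLe_parFineScatter (hP : 4 ≤ P) (lo : ℕ) (B : Buckets) :
    MemLe P 0 (parFineScatter S k lo B : Comp α Buckets) :=
  (memLe_tick _).bind fun _ => (memLe_multinomial _ _ _).bind fun _ =>
    (memLe_parTwoSweep hP _ _).bind fun _ => (memLe_shuffleStaged _ _).bind fun _ => memLe_pure _

/-- The arrays of a call are used while its subtasks are active, so every word is paid for by the
call itself or by an active subtask. -/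
lemma memLe_pIpScShuf (hk : 2 ≤ k) (f lo m : ℕ) :
    MemLe (6 * k + 20) (6 * k + 16) (pIpScShuf S k N₀ f lo m : Comp α Unit) := by
  induction f generalizing lo m with
  | zero => exact post_diverge
  | succ f ih =>
    refine (memLe_tick _).bind fun _ => ?_
    split_ifs
    · exact (memLe_fisherYates lo m (A := 0)).frame.mono (by omega)
    · refine MemLe.mono (MemLe.frame (A := 0) ?_) (by omega)
      exact (memLe_tick _).bind fun _ => (memLe_parRoughScatterAux (by omega) _ _).bind fun _ =>
        (memLe_parFineScatter (by omega) _ _).bind fun _ =>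
          memLe_parLoop (fun _ => ih _ _) (by omega) _ (Or.inl hk)

/-! ### The recursion -/

/-- One call of the recursion. -/
lemma cwp_pIpScShuf_succ_le (hκ : SeqCost κ) (hk : 2 ≤ k) {f lo m : ℕ} (hm : N₀ < m) {b : ℝ≥0∞}
    (h : ∀ B : Buckets, ∑ i ∈ Finset.range k, (B i).size = m →
      cwp κ l (parLoop 0 k fun i => pIpScShuf S k N₀ f (B i).b (B i).size : Comp α Unit)
        (fun _ => 1) ≤ b) :
    cwp κ l (pIpScShuf S k N₀ (f + 1) lo m : Comp α Unit) (fun _ => 1) ≤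
      eexp (l * (3 * k + 1)) * (b * cwpDistribute α S k N₀ κ l lo m fun _ => 1) := by
  rw [pIpScShuf, if_neg hm.not_ge]
  refine (cwp_tick_bind_le hκ _ _ _).trans ((mul_le_mul' le_rfl ((cwp_frame_le hκ _ _ _).trans
    ((cwp_tick_bind_le hκ _ _ _).trans (mul_le_mul' le_rfl ((cwp_bind_le hκ _ _ _).trans
      (cwp_mono fun B => cwp_bind_le hκ _ _ _)))))).trans ?_)
  rw [← mul_assoc, ← eexp_add, ← cwpDistribute_const_mul]
  refine mul_le_mul' (eexp_mono ?_) (cwpDistribute_mono hk fun B hB => ?_)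
  · push_cast
    linarith
  · rw [mul_one]
    exact h B hB

lemma cwp_pIpScShuf_base_le (hκ : SeqCost κ) (hS : S.AcceptAtLeast p₀) (hl : 0 ≤ l)
    (hl' : l ≤ p₀ / 2) {f lo m : ℕ} (hm : m ≤ N₀) :
    cwp κ l (pIpScShuf S k N₀ (f + 1) lo m : Comp α Unit) (fun _ => 1) ≤
      eexp (l * (costRate p₀ * m + 2)) := by
  rw [pIpScShuf, if_pos hm]
  refine (cwp_tick_bind_le hκ _ _ _).trans ((mul_le_mul' le_rfl ((cwp_frame_le hκ _ _ _).trans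
    (cwp_fisherYates_le hκ hS hl hl' lo m))).trans ?_)
  rw [← eexp_add]
  apply eexp_mono
  push_cast
  linarith

lemma cwp_pIpScShuf_zero_le (lo m : ℕ) (b : ℝ≥0∞) :
    cwp κ l (pIpScShuf S k N₀ 0 lo m : Comp α Unit) (fun _ => 1) ≤ b :=
  wp_le_of_post (b := b) (Post.mono (post_diverge (Q := fun _ _ => False)) fun _ _ h => h.elim)

/-- The parallel depth: every level of the recursion contributes `7 * log k` and a multiple of
`l * N₀`, since the maximum over the `k` buckets costs a factor of `k`. -/
lemma cwp_span_pIpScShuf_le (hS : S.AcceptAtLeast p₀) (hk : 2 ≤ k) (hN : k ^ 2 ≤ N₀) (hl : 0 ≤ l)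
    (hn : 1 ≤ n) (hrate : (4 * l) ^ 2 * (n * k) ≤ rateBound p₀ ^ 2 * Real.log k)
    (f lo m : ℕ) (hm : m ≤ n) :
    cwp Exec.span l (pIpScShuf S k N₀ f lo m : Comp α Unit) (fun _ => 1) ≤
      eexp (f * (7 * Real.log k + (2 * costRate p₀ + 20) * (l * N₀))) := by
  have hk2 : (2 : ℝ) ≤ k := by exact_mod_cast hk
  have hN0 : (k : ℝ) ^ 2 ≤ N₀ := by exact_mod_cast hN
  have hlog := half_le_log hk
  have hg := four_le_costRate hS
  have h4l := (rate_le_of_sq_le hS hk (by exact_mod_cast hn) hrate).trans (rateBound_le hS)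
  set Λ := 7 * Real.log k + (2 * costRate p₀ + 20) * (l * N₀) with hΛ
  have hΛ0 : 0 ≤ Λ := by positivity
  induction f generalizing lo m with
  | zero => exact cwp_pIpScShuf_zero_le lo m _
  | succ f ih =>
    rcases le_or_gt m N₀ with hmN | hmN
    · refine (cwp_pIpScShuf_base_le seqCost_span hS hl (by linarith) hmN).trans (eexp_mono ?_)
      have h1 : (m : ℝ) ≤ N₀ := by exact_mod_cast hmN
      have h2 : l * (costRate p₀ * m + 2) ≤ l * ((2 * costRate p₀ + 20) * N₀) := by
        gcongr
        nlinarith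
      have h3 : (0 : ℝ) ≤ f * Λ := by positivity
      push_cast
      nlinarith
    · refine (cwp_pIpScShuf_succ_le seqCost_span hk hmN (b := eexp (l * (3 * k)) *
        (k * eexp (f * Λ))) fun B hB => ?_).trans ?_
      · refine (cwp_span_parLoop_le hl (by omega) _).trans (mul_le_mul' le_rfl ?_)
        rw [zero_add, ← Finset.range_eq_Ico]
        refine (Finset.sum_le_card_nsmul _ _ (eexp (f * Λ)) fun i hi => ih _ _ ?_).trans (by simp)
        exact ((Finset.single_le_sum (f := fun i => (B i).size) (fun _ _ => Nat.zero_le _)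
          hi).trans hB.le).trans hm
      · have hd := cwpDistribute_span_le (α := α) (lo := lo) hS hk hN hmN hl
          (le_trans (by gcongr) hrate)
        refine (mul_le_mul' le_rfl (mul_le_mul' le_rfl hd)).trans ?_
        rw [← eexp_log_natCast (show 0 < k by omega), ← eexp_add, ← eexp_add, ← eexp_add,
          ← eexp_add]
        apply eexp_mono
        have h1 : l * (6 * k + 1) ≤ l * (5 * N₀) := by
          gcongr
          nlinarith
        push_cast
        linarith

/-- The work: every level of the recursion contributes a linear amount. -/
lemma cwp_work_pIpScShuf_le (hS : S.AcceptAtLeast p₀) (hk : 2 ≤ k) (hN : k ^ 2 ≤ N₀) (hl : 0 ≤ l)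
    (hn : 1 ≤ n) (hrate : 4 * l * (k * √n) ≤ rateBound p₀) (f lo m : ℕ) (hm : m ≤ n) :
    cwp Exec.work l (pIpScShuf S k N₀ f lo m : Comp α Unit) (fun _ => 1) ≤
      eexp (l * ((distributeRate p₀ + 8) * m * f + 2)) := by
  have hk2 : (2 : ℝ) ≤ k := by exact_mod_cast hk
  have hg := four_le_costRate hS
  have h4l : 4 * l ≤ p₀ / 2 := by
    refine le_trans (le_mul_of_one_le_right (by positivity) ?_) (hrate.trans (rateBound_le hS))
    have : 1 ≤ √(n : ℝ) := Real.one_le_sqrt.2 (by exact_mod_cast hn)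
    nlinarith
  set A := distributeRate p₀ + 8 with hA
  have hAg : costRate p₀ ≤ A := by
    rw [hA, distributeRate, workGain]
    linarith
  have hA0 : 0 ≤ A := by linarith
  induction f generalizing lo m with
  | zero => exact cwp_pIpScShuf_zero_le lo m _
  | succ f ih =>
    rcases le_or_gt m N₀ with hmN | hmN
    · refine (cwp_pIpScShuf_base_le seqCost_work hS hl (by linarith) hmN).trans (eexp_mono ?_)
      have h1 : costRate p₀ * m ≤ A * m := by gcongr
      have h2 : 0 ≤ A * m * f := by positivity
      refine mul_le_mul_of_nonneg_left ?_ hl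
      push_cast
      linarith
    · refine (cwp_pIpScShuf_succ_le seqCost_work hk hmN (b := eexp (l * (3 * k - 2)) *
        eexp (l * (A * m * f + 2 * k))) fun B hB => ?_).trans ?_
      · refine (cwp_work_parLoop_le (by omega) _).trans (mul_le_mul' le_rfl ?_)
        rw [zero_add, ← Finset.range_eq_Ico]
        refine (Finset.prod_le_prod' fun i hi => ih _ _ ?_).trans (le_of_eq ?_)
        · exact ((Finset.single_le_sum (f := fun i => (B i).size) (fun _ _ => Nat.zero_le _)
            hi).trans hB.le).trans hm
        · rw [← eexp_sum, ← Finset.mul_sum, Finset.sum_add_distrib, ← Finset.sum_mul,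
            ← Finset.mul_sum, ← Nat.cast_sum, hB]
          congr 2
          simp [mul_comm]
      · have hd := cwpDistribute_work_le (α := α) (lo := lo) hS hk hN hmN hl
          (le_trans (by gcongr) hrate)
        refine (mul_le_mul' le_rfl (mul_le_mul' le_rfl hd)).trans ?_
        rw [← eexp_add, ← eexp_add, ← eexp_add, ← mul_add, ← mul_add, ← mul_add]
        apply eexp_mono
        have h1 : (k : ℝ) ≤ m := by
          have : k ≤ m := by nlinarith
          exact_mod_cast this
        refine mul_le_mul_of_nonneg_left ?_ hl
        push_cast
        rw [hA]
        linarith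

/-- The probability that the recursion budget is exhausted. -/
lemma pnone_pIpScShuf_le (hS : S.AcceptAtLeast p₀) (hk : 2 ≤ k) (hN : k ^ 2 ≤ N₀) (f lo m : ℕ) :
    pnone (pIpScShuf S k N₀ (f + 1) lo m : Comp α Unit) ≤
      ENNReal.ofReal (1.86 / k) ^ f * (m : ℝ≥0∞) ^ 2 := by
  induction f generalizing lo m with
  | zero =>
    rw [pow_zero, one_mul]
    rcases Nat.eq_zero_or_pos m with rfl | hm
    · rw [pIpScShuf, if_pos (Nat.zero_le _), pnone_bind_eq_zero (pnone_tick _)]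
      · exact zero_le
      · exact fun _ => le_antisymm ((pnone_frame _ _).trans (pnone_fisherYates _ _).le) zero_le
    · exact (pnone_le_one _).trans (one_le_pow₀ (by exact_mod_cast hm))
  | succ f ih =>
    rw [pIpScShuf]
    refine (pnone_bind_le _ _).trans ?_
    rw [pnone_tick, zero_add]
    refine (wp_const_le _ _).trans ?_
    split_ifs with hm
    · exact ((pnone_frame _ _).trans (pnone_fisherYates _ _).le).trans zero_le
    · refine (pnone_frame _ _).trans ((pnone_bind_le _ _).trans ?_)
      rw [pnone_tick, zero_add]
      refine (wp_const_le _ _).trans ((pnone_bind_le _ _).trans ?_)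
      rw [parRoughScatter, pnone_parRoughScatterAux, zero_add]
      have hstep : ∀ B : Buckets, pnone (parFineScatter S k lo B >>= fun B' =>
          parLoop 0 k fun i => pIpScShuf S k N₀ (f + 1) (B' i).b (B' i).size : Comp α Unit) ≤
          cwp Exec.work 0 (parFineScatter S k lo B : Comp α Buckets) fun B' =>
            ENNReal.ofReal (1.86 / k) ^ f * ∑ i ∈ Finset.range k, ((B' i).size : ℝ≥0∞) ^ 2 := by
        intro B
        refine (pnone_bind_le _ _).trans ?_
        rw [pnone_parFineScatter, zero_add, cwp_zero]
        refine wp_mono fun B' _ => (pnone_parLoop_le _ _ _).trans ?_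
        rw [zero_add, ← Finset.range_eq_Ico, Finset.mul_sum]
        exact Finset.sum_le_sum fun i _ => ih _ _
      refine (wp_mono fun B _ => hstep B).trans ?_
      have := cwpDistribute_sum_sq_le (α := α) (lo := lo) hS hk hN (not_le.1 hm)
      rw [pow_succ, mul_assoc]
      refine le_trans (le_of_eq ?_) (mul_le_mul' le_rfl this)
      rw [← cwpDistribute_const_mul, cwpDistribute, cwp_zero]
      rfl

end ScatterShuffle

namespace ForkJoin.Comp

variable {α : Type u} {β : Type} {κ : Exec → ℕ} {l : ℝ}

/-! ### Tail bounds -/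

lemma one_le_toOuterMeasure_add (c : Comp α Unit) (X : ℕ → α) {P : Exec → Prop} {g : Exec → ℝ≥0∞}
    (h : Post c fun _ e => P e ∨ 1 ≤ g e) :
    1 ≤ (c X).toOuterMeasure {o | ∃ Y E, o = some ((), Y, E) ∧ P E} +
      (pnone c + wp c fun _ e => g e) := by
  classical
  set s : Set (Option (Unit × (ℕ → α) × Exec)) := {o | ∃ Y E, o = some ((), Y, E) ∧ P E} with hs
  have hmeas : (c X).toOuterMeasure s = mean (c X) (fun o => if o ∈ s then 1 else 0) := by
    rw [PMF.toOuterMeasure_apply, mean]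
    exact tsum_congr fun o => by simp [Set.indicator_apply]
  calc (1 : ℝ≥0∞) = mean (c X) (fun _ => 1) := (mean_const _ _).symm
    _ ≤ mean (c X) (fun o => (if o ∈ s then 1 else 0) +
          ((if o = none then 1 else 0) + weight (fun _ e => g e) o)) := by
        refine mean_mono _ fun o ho => ?_
        match o, ho with
        | none, _ =>
          rw [if_pos rfl]
          exact le_self_add.trans le_add_self
        | some ((), Y, e), ho =>
          rcases h X () Y e ho with hP | hg
          · have : some ((), Y, e) ∈ s := ⟨Y, e, rfl, hP⟩
            rw [if_pos this]
            exact le_self_add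
          · exact hg.trans (le_add_self.trans le_add_self)
    _ ≤ _ := by
        rw [mean_add, mean_add, hmeas, ← apply_none_eq_mean]
        gcongr
        · exact le_pnone c X
        · exact mean_le_wp c _ X

open Classical in
/-- Markov's inequality for the exponential moment of a cost. -/
lemma wp_lt_cost_le {c : Comp α β} (hl : 0 ≤ l) {T x : ℝ}
    (h : cwp κ l c (fun _ => 1) ≤ eexp (l * T - x)) :
    wp c (fun _ e => if T < κ e then 1 else 0) ≤ eexp (-x) := by
  calc wp c (fun _ e => if T < κ e then 1 else 0)
      ≤ wp c (fun _ e => eexp (-(l * T)) * (eexp (l * κ e) * 1)) := by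
        refine wp_mono fun _ e => ?_
        split_ifs with hT
        · rw [mul_one, ← eexp_add]
          apply one_le_eexp
          have : l * T ≤ l * κ e := by gcongr
          linarith
        · exact zero_le
    _ ≤ eexp (-(l * T)) * eexp (l * T - x) := by
        rw [wp_const_mul]
        exact mul_le_mul' le_rfl h
    _ = eexp (-x) := by
        rw [← eexp_add]
        congr 1
        ring

end ForkJoin.Comp

namespace ScatterShuffle
open ForkJoin ForkJoin.Comp

/-! ### The choice of the rates -/

section numbers
variable {c p₀ : ℝ} {k n : ℕ}

/-- An upper bound for `log k / log n`. -/
def logRatio (c : ℝ) : ℝ := 1 + 2 * |Real.log c|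

lemma one_le_logRatio (c : ℝ) : 1 ≤ logRatio c := by
  rw [logRatio]
  linarith [abs_nonneg (Real.log c)]

lemma log_le_logRatio_mul (hc : 0 < c) (hk : 2 ≤ k) (hn : 2 ≤ n)
    (h : (k : ℝ) ^ 3 * Real.log k ≤ c * n) : Real.log k ≤ logRatio c * Real.log n := by
  have hk2 : (2 : ℝ) ≤ k := by exact_mod_cast hk
  have hn2 : (2 : ℝ) ≤ n := by exact_mod_cast hn
  have hlog := half_le_log hk
  have hL := half_le_log hn
  have h1 : (k : ℝ) ≤ c * n := by
    refine le_trans ?_ h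
    calc (k : ℝ) = k * (2 * (1 / 2)) := by ring
      _ ≤ k * (k ^ 2 * Real.log k) := by
          gcongr
          nlinarith
      _ = k ^ 3 * Real.log k := by ring
  have h2 : Real.log k ≤ Real.log c + Real.log n := by
    rw [← Real.log_mul (by positivity) (by positivity)]
    exact Real.log_le_log (by positivity) h1
  rw [logRatio]
  nlinarith [le_abs_self (Real.log c), abs_nonneg (Real.log c)]

/-- The recursion depth grows at most at this rate times `log k n`. -/
def levelRate (c : ℝ) : ℝ := 100 + 3 * logRatio c

lemma ratio_le_exp (hk : 2 ≤ k) : 1.86 / (k : ℝ) ≤ Real.exp (-(Real.log k / 20)) := by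
  have hk2 : (2 : ℝ) ≤ k := by exact_mod_cast hk
  have hk0 : (0 : ℝ) < k := by linarith
  refine le_of_pow_le_pow_left₀ (n := 20) (by norm_num) (by positivity) ?_
  rw [← Real.exp_nat_mul, show ((20 : ℕ) : ℝ) * -(Real.log k / 20) = -Real.log k by push_cast; ring,
    Real.exp_neg, Real.exp_log hk0, div_pow, div_le_iff₀ (by positivity),
    show (k : ℝ) ^ 20 = k * k ^ 19 by ring, ← mul_assoc, inv_mul_cancel₀ hk0.ne', one_mul]
  calc (1.86 : ℝ) ^ 20 ≤ 2 ^ 19 := by norm_num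
    _ ≤ _ := by gcongr

lemma log_pow_six_le (hn : 1 ≤ n) : Real.log n ^ 6 ≤ 6 ^ 6 * n := by
  have hn1 : (1 : ℝ) ≤ n := by exact_mod_cast hn
  have h0 := Real.log_nonneg hn1
  have h1 := Real.add_one_le_exp (Real.log n / 6)
  have h2 : (Real.log n / 6) ^ 6 ≤ Real.exp (Real.log n / 6) ^ 6 := by
    gcongr
    linarith
  rw [← Real.exp_nat_mul, show ((6 : ℕ) : ℝ) * (Real.log n / 6) = Real.log n by push_cast; ring,
    Real.exp_log (by linarith), div_pow, div_le_iff₀ (by norm_num)] at h2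
  linarith

lemma mul_log_le_sqrt (hc : 0 < c) (hk : 2 ≤ k) (hn : 2 ≤ n)
    (h : (k : ℝ) ^ 3 * Real.log k ≤ c * n) : k * Real.log n ≤ 6 * (1 + 2 * c) * √n := by
  have hlog := half_le_log hk
  have hL := half_le_log hn
  have hn2 : (2 : ℝ) ≤ n := by exact_mod_cast hn
  refine le_of_pow_le_pow_left₀ (n := 6) (by norm_num) (by positivity) ?_
  have h1 : (k : ℝ) ^ 3 ≤ 2 * c * n := by
    have : (k : ℝ) ^ 3 * (1 / 2) ≤ k ^ 3 * Real.log k := by gcongr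
    linarith
  have h2 : √(n : ℝ) ^ 6 = n ^ 3 := by
    rw [show √(n : ℝ) ^ 6 = (√(n : ℝ) ^ 2) ^ 3 by ring, Real.sq_sqrt (by positivity)]
  calc ((k : ℝ) * Real.log n) ^ 6 = ((k : ℝ) ^ 3) ^ 2 * Real.log n ^ 6 := by ring
    _ ≤ (2 * c * n) ^ 2 * (6 ^ 6 * n) := by
        gcongr
        exact log_pow_six_le (by omega)
    _ = (2 * c) ^ 2 * (6 ^ 6 * n ^ 3) := by ring
    _ ≤ (1 + 2 * c) ^ 6 * (6 ^ 6 * n ^ 3) := by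
        gcongr
        calc (2 * c) ^ 2 ≤ (1 + 2 * c) ^ 2 := by gcongr; linarith
          _ ≤ (1 + 2 * c) ^ 6 := pow_le_pow_right₀ (by linarith) (by norm_num)
    _ = _ := by rw [mul_pow, mul_pow, h2]; ring

end numbers

variable {α : Type u} {p₀ : ℝ} {S : Samplers} {k N₀ n : ℕ} {a c : ℝ}

/-- A sufficient recursion budget. -/
lemma exists_budget (hS : S.AcceptAtLeast p₀) (hk : 2 ≤ k) (hn : 2 ≤ n) (hN : k ^ 2 ≤ N₀)
    (hc : 0 < c) (h : (k : ℝ) ^ 3 * Real.log k ≤ c * n) :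
    ∃ f : ℕ, pnone (pIpScShuf S k N₀ f 0 n : Comp α Unit) ≤ eexp (-(3 * Real.log n)) ∧
      (f : ℝ) ≤ levelRate c * (Real.log n / Real.log k) := by
  have hlog := half_le_log hk
  have hL := half_le_log hn
  have hlog0 : 0 < Real.log k := by linarith
  have hn0 : (0 : ℝ) < n := by exact_mod_cast (by omega : 0 < n)
  set t := 100 * (Real.log n / Real.log k) with ht
  refine ⟨⌈t⌉₊ + 1, ?_, ?_⟩
  · refine (pnone_pIpScShuf_le hS hk hN _ _ _).trans ?_
    have h1 : ENNReal.ofReal (1.86 / k) ^ ⌈t⌉₊ ≤ eexp (-(5 * Real.log n)) := by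
      refine (pow_le_pow_left' (ENNReal.ofReal_le_ofReal (ratio_le_exp hk)) _).trans ?_
      rw [← eexp, ← eexp_nat_mul]
      apply eexp_mono
      have h2 : t * (Real.log k / 20) ≤ ⌈t⌉₊ * (Real.log k / 20) := by
        gcongr
        exact Nat.le_ceil t
      have h3 : t * (Real.log k / 20) = 5 * Real.log n := by
        rw [ht]
        field_simp
        ring
      linarith
    have h2 : (n : ℝ≥0∞) ^ 2 = eexp (2 * Real.log n) := by
      rw [← eexp_log_natCast (show 0 < n by omega), ← eexp_nat_mul]
      norm_num
    rw [h2]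
    refine (mul_le_mul' h1 le_rfl).trans ?_
    rw [← eexp_add]
    apply eexp_mono
    linarith
  · have h1 : (⌈t⌉₊ : ℝ) < t + 1 := Nat.ceil_lt_add_one (by positivity)
    have h2 : 1 ≤ logRatio c * (Real.log n / Real.log k) := by
      rw [← mul_div_assoc, le_div_iff₀ hlog0, one_mul]
      exact log_le_logRatio_mul hc hk hn h
    rw [levelRate, add_mul]
    push_cast
    linarith

/-- The parallel depth for a recursion budget of the order `log n / log k`. -/
lemma exists_span_bound (ha : 1 ≤ a) (hc : 0 < c) (hp₀ : 0 < p₀) {b : ℝ} (hb : 0 ≤ b) :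
    ∃ C : ℝ, 0 < C ∧ ∀ (α : Type u) (S : Samplers) (k N₀ n f : ℕ), S.AcceptAtLeast p₀ →
      2 ≤ k → 2 ≤ n → (k : ℝ) ^ 3 * Real.log k ≤ c * n → k ^ 2 ≤ N₀ → (N₀ : ℝ) ≤ a * (k : ℝ) ^ 2 →
      (f : ℝ) ≤ b * (Real.log n / Real.log k) →
      ∃ l : ℝ, 0 ≤ l ∧ cwp Exec.span l (pIpScShuf S k N₀ f 0 n : Comp α Unit) (fun _ => 1) ≤
        eexp (l * (C * (√(n * k / Real.log k) * Real.log n)) - 3 * Real.log n) := by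
  have hg : 4 ≤ costRate p₀ := by
    rw [costRate]
    linarith [show 0 ≤ 2 / p₀ by positivity]
  have hε : 0 < rateBound p₀ := by
    rw [rateBound]
    positivity
  set q := rateBound p₀ / 4 with hq
  have hq0 : 0 < q := by positivity
  set Λ := 7 + 2 * (2 * costRate p₀ + 20) * (q * a * √c) with hΛ
  refine ⟨(b * Λ + 3) / q, by positivity, ?_⟩
  intro α S k N₀ n f hS hk hn h hN haN hf
  have hlog := half_le_log hk
  have hL := half_le_log hn
  have hlog0 : 0 < Real.log k := by linarith
  have hn0 : (0 : ℝ) < n := by exact_mod_cast (by omega : 0 < n)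
  have hk0 : (0 : ℝ) < k := by exact_mod_cast (by omega : 0 < k)
  set r := √(n * k / Real.log k) with hr
  have hr0 : 0 < r := Real.sqrt_pos.2 (by positivity)
  have hrr : r ^ 2 = n * k / Real.log k := Real.sq_sqrt (by positivity)
  refine ⟨q / r, by positivity, ?_⟩
  have hrate : (4 * (q / r)) ^ 2 * (n * k) ≤ rateBound p₀ ^ 2 * Real.log k := by
    rw [mul_pow, div_pow, hrr, hq]
    apply le_of_eq
    field_simp
  refine (cwp_span_pIpScShuf_le hS hk hN (by positivity) (by omega) hrate f 0 n le_rfl).trans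
    (eexp_mono ?_)
  have h1 : q / r * N₀ ≤ q * a * √c := by
    have h2 : (k : ℝ) ^ 2 ≤ √c * r := by
      rw [hr, ← Real.sqrt_mul hc.le]
      apply Real.le_sqrt_of_sq_le
      rw [← mul_div_assoc, le_div_iff₀ hlog0]
      nlinarith
    calc q / r * N₀ ≤ q / r * (a * (√c * r)) := by
          gcongr
          exact haN.trans (by gcongr)
      _ = q * a * √c := by field_simp
  have h3 : 7 * Real.log k + (2 * costRate p₀ + 20) * (q / r * N₀) ≤ Λ * Real.log k := by
    have h4 : (2 * costRate p₀ + 20) * (q / r * N₀) ≤ (2 * costRate p₀ + 20) * (q * a * √c) := by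
      gcongr
    have h5 : 0 ≤ (2 * costRate p₀ + 20) * (q * a * √c) := by positivity
    rw [hΛ]
    nlinarith
  have h6 : q / r * ((b * Λ + 3) / q * (r * Real.log n)) = (b * Λ + 3) * Real.log n := by
    field_simp
  have h7 : (f : ℝ) * (7 * Real.log k + (2 * costRate p₀ + 20) * (q / r * N₀)) ≤
      b * (Real.log n / Real.log k) * (Λ * Real.log k) := by gcongr
  have h8 : b * (Real.log n / Real.log k) * (Λ * Real.log k) = b * Λ * Real.log n := by
    field_simp
  rw [h6]
  linarith

/-- The work for a recursion budget of the order `log n / log k`. -/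
lemma exists_work_bound (hc : 0 < c) (hp₀ : 0 < p₀) {b : ℝ} (hb : 0 ≤ b) :
    ∃ C : ℝ, 0 < C ∧ ∀ (α : Type u) (S : Samplers) (k N₀ n f : ℕ), S.AcceptAtLeast p₀ →
      2 ≤ k → 2 ≤ n → (k : ℝ) ^ 3 * Real.log k ≤ c * n → k ^ 2 ≤ N₀ →
      (f : ℝ) ≤ b * (Real.log n / Real.log k) →
      ∃ l : ℝ, 0 ≤ l ∧ cwp Exec.work l (pIpScShuf S k N₀ f 0 n : Comp α Unit) (fun _ => 1) ≤
        eexp (l * (C * (n * Real.logb k n)) - 3 * Real.log n) := by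
  have hg : 4 ≤ costRate p₀ := by
    rw [costRate]
    linarith [show 0 ≤ 2 / p₀ by positivity]
  have hε : 0 < rateBound p₀ := by
    rw [rateBound]
    positivity
  have hA : 0 < distributeRate p₀ + 8 := by
    rw [distributeRate, workGain]
    linarith
  set A := distributeRate p₀ + 8
  have hd := one_le_logRatio c
  set d := logRatio c
  set q := rateBound p₀ / (4 * (6 * (1 + 2 * c))) with hq
  have hq0 : 0 < q := by positivity
  refine ⟨A * b + 2 * d + 3 * d / q, by positivity, ?_⟩
  intro α S k N₀ n f hS hk hn h hN hf
  have hlog := half_le_log hk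
  have hL := half_le_log hn
  have hlog0 : 0 < Real.log k := by linarith
  have hn2 : (2 : ℝ) ≤ n := by exact_mod_cast hn
  have hn0 : (0 : ℝ) < n := by linarith
  refine ⟨q * Real.log n / n, by positivity, ?_⟩
  have hrate : 4 * (q * Real.log n / n) * (k * √n) ≤ rateBound p₀ := by
    have h1 := mul_log_le_sqrt hc hk hn h
    calc 4 * (q * Real.log n / n) * (k * √n) = 4 * q * (k * Real.log n) * √n / n := by ring
      _ ≤ 4 * q * (6 * (1 + 2 * c) * √n) * √n / n := by gcongr
      _ = 4 * q * (6 * (1 + 2 * c)) * (√n * √n) / n := by ring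
      _ = rateBound p₀ := by
          rw [Real.mul_self_sqrt hn0.le, hq]
          field_simp
  refine (cwp_work_pIpScShuf_le hS hk hN (by positivity) (by omega) hrate f 0 n le_rfl).trans
    (eexp_mono ?_)
  have hx : 1 ≤ d * (Real.log n / Real.log k) := by
    rw [← mul_div_assoc, le_div_iff₀ hlog0, one_mul]
    exact log_le_logRatio_mul hc hk hn h
  have hlogb : Real.logb k n = Real.log n / Real.log k := rfl
  rw [hlogb]
  set x := Real.log n / Real.log k with hxdef
  have h1 : A * n * f ≤ A * n * (b * x) := by gcongr
  have h2 : q * Real.log n / n * (A * n * f + 2) ≤ q * Real.log n / n * (A * n * (b * x) +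
      2 * d * n * x) := by
    gcongr
    nlinarith
  have h3 : q * Real.log n / n * ((A * b + 2 * d + 3 * d / q) * (n * x)) =
      q * Real.log n / n * (A * n * (b * x) + 2 * d * n * x) + 3 * Real.log n * (d * x) := by
    field_simp
  have h4 : 3 * Real.log n * 1 ≤ 3 * Real.log n * (d * x) := by gcongr
  rw [h3]
  linarith

end ScatterShuffle

end

theorem mainTheorem1 (a c p₀ : ℝ) (ha : 1 ≤ a) (hc : 0 < c) (hp₀ : 0 < p₀) :
    ∃ C : ℝ, 0 < C ∧
      ∀ (α : Type u) (S : ScatterShuffle.Samplers) (k N₀ n : ℕ) (X : ℕ → α),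
        (∀ s, p₀ ≤ (S.uniformAcc s : ℝ)) →
        (∀ m q, p₀ ≤ (S.binomialAcc m q : ℝ)) →
        2 ≤ k → 2 ≤ n →
        (k : ℝ) ^ 3 * Real.log k ≤ c * n →
        (k : ℝ) ^ 2 ≤ N₀ → (N₀ : ℝ) ≤ a * (k : ℝ) ^ 2 →
        1 - (n : ℝ≥0∞)⁻¹ ≤ ScatterShuffle.shuffleProb S k N₀ n X fun E =>
          (E.span : ℝ) ≤ C * (Real.sqrt (n * k / Real.log k) * Real.log n) ∧
          (E.work : ℝ) ≤ C * (n * Real.logb k n) ∧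
          ∀ t m : ℕ, E.Config t m → (m : ℝ) ≤ C * (k * (Real.logb k n + t)) := by
  classical
  open ScatterShuffle ForkJoin ForkJoin.Comp in
  have hd := one_le_logRatio c
  have hb : 0 ≤ levelRate c := by
    rw [levelRate]
    linarith
  obtain ⟨Cs, hCs, hspan⟩ := exists_span_bound.{u} ha hc hp₀ hb
  obtain ⟨Cw, hCw, hwork⟩ := exists_work_bound.{u} hc hp₀ hb
  refine ⟨Cs + Cw + 16 * logRatio c, by positivity, ?_⟩
  intro α S k N₀ n X hu hbin hk hn h hN haN
  have hS : S.AcceptAtLeast p₀ := ⟨hp₀, hu, hbin⟩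
  have hN' : k ^ 2 ≤ N₀ := by exact_mod_cast hN
  have hlog := half_le_log hk
  have hL := half_le_log hn
  have hlog0 : 0 < Real.log k := by linarith
  have hk2 : (2 : ℝ) ≤ k := by exact_mod_cast hk
  have hn2 : (2 : ℝ) ≤ n := by exact_mod_cast hn
  have hlogb : Real.logb k n = Real.log n / Real.log k := rfl
  have hx : 1 ≤ logRatio c * Real.logb k n := by
    rw [hlogb, ← mul_div_assoc, le_div_iff₀ hlog0, one_mul]
    exact log_le_logRatio_mul hc hk hn h
  have hx0 : 0 ≤ Real.logb k n := by
    rw [hlogb]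
    positivity
  obtain ⟨f, hf, hfle⟩ := exists_budget (α := α) hS hk hn hN' hc h
  obtain ⟨l, hl, hs⟩ := hspan α S k N₀ n f hS hk hn h hN' haN hfle
  obtain ⟨l', hl', hw⟩ := hwork α S k N₀ n f hS hk hn h hN' hfle
  set T := Cs * (√(n * k / Real.log k) * Real.log n) with hT
  set T' := Cw * (n * Real.logb k n) with hT'
  have key := one_le_toOuterMeasure_add (pIpScShuf S k N₀ f 0 n : Comp α Unit) X
    (P := fun E => (E.span : ℝ) ≤ (Cs + Cw + 16 * logRatio c) *
        (Real.sqrt (n * k / Real.log k) * Real.log n) ∧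
      (E.work : ℝ) ≤ (Cs + Cw + 16 * logRatio c) * (n * Real.logb k n) ∧
      ∀ t m : ℕ, E.Config t m → (m : ℝ) ≤ (Cs + Cw + 16 * logRatio c) * (k * (Real.logb k n + t)))
    (g := fun e => (if T < e.span then 1 else 0) + if T' < e.work then 1 else 0) ?_
  · have hfail : pnone (pIpScShuf S k N₀ f 0 n : Comp α Unit) +
        wp (pIpScShuf S k N₀ f 0 n : Comp α Unit) (fun _ e =>
          (if T < e.span then 1 else 0) + if T' < e.work then 1 else 0) ≤ (n : ℝ≥0∞)⁻¹ := by
      refine (add_le_add hf ((wp_add_le _ _ _).trans (add_le_add (wp_lt_cost_le hl hs)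
        (wp_lt_cost_le hl' hw)))).trans ?_
      have hsum : (n : ℝ≥0∞)⁻¹ = eexp (-Real.log n) := by
        rw [eexp, Real.exp_neg, Real.exp_log (by linarith),
          ENNReal.ofReal_inv_of_pos (by linarith), ENNReal.ofReal_natCast]
      rw [hsum, eexp, eexp, ← ENNReal.ofReal_add (by positivity) (by positivity),
        ← ENNReal.ofReal_add (by positivity) (by positivity)]
      apply ENNReal.ofReal_le_ofReal
      have h3 : Real.exp (-(3 * Real.log n)) = Real.exp (-Real.log n) * ((n : ℝ) ^ 2)⁻¹ := by
        rw [show -(3 * Real.log n) = -Real.log n + -(2 * Real.log n) by ring, Real.exp_add,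
          Real.exp_neg (2 * Real.log n), two_mul, Real.exp_add, Real.exp_log (by linarith), sq]
      rw [h3]
      have h4 : ((n : ℝ) ^ 2)⁻¹ ≤ 1 / 4 := by
        rw [inv_eq_one_div]
        apply one_div_le_one_div_of_le (by norm_num)
        nlinarith
      nlinarith [Real.exp_pos (-Real.log n)]
    refine le_trans ?_ (le_iSup _ f)
    exact tsub_le_iff_right.2 (key.trans (by gcongr))
  · refine Post.mono (memLe_pIpScShuf hk f 0 n) fun _ e hmem => ?_
    by_cases hsp : T < e.span
    · right
      rw [if_pos hsp]
      exact le_self_add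
    by_cases hwk : T' < e.work
    · right
      rw [if_pos hwk]
      exact le_add_self
    left
    refine ⟨(not_lt.1 hsp).trans ?_, (not_lt.1 hwk).trans ?_, fun t m hc' => ?_⟩
    · rw [hT]
      gcongr
      linarith
    · rw [hT']
      gcongr
      linarith
    · have h1 : (m : ℝ) ≤ 6 * k + 16 + (6 * k + 20) * t := by exact_mod_cast hmem t m hc'
      have h2 : (m : ℝ) ≤ 16 * k * (1 + t) := by
        have : (0 : ℝ) ≤ t := by positivity
        nlinarith
      have h3 : (1 : ℝ) + t ≤ logRatio c * (Real.logb k n + t) := by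
        have : (0 : ℝ) ≤ t := by positivity
        nlinarith
      have h4 : 16 * k * (1 + t) ≤ 16 * k * (logRatio c * (Real.logb k n + t)) := by gcongr
      have h5 : 0 ≤ (Cs + Cw) * (k * (Real.logb k n + t)) := by positivity
      linarith
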